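/- Let $a\ge 0$ be an integer, $m=-a$, $n=2a+3$, and $$A_{m,n}=\begin{pmatrix}0&1&0\\0&0&1\\1&-m&-n\end{pmatrix}\in SL(3,\mathbb Z).$$ The characteristic polynomial of $A_{m,n}$ is irreducible over $\mathbb Q$ and its roots are real and distinct. The three planes spanned by pairs of linearly independent eigenvectors of $A_{m,n}$ split $\mathbb R^3$ into open orthants; the sail of an orthant is the boundary of the convex hull of all integer points except the origin in its closure, and the faces of the sail are the faces of this convex hull. Exactly one orthant has a sail that contains the point $(0,0,1)$; let $S$ be this sail, and let $G$ be the group of the operators in $SL(3,\mathbb Z)$ that commute with $A_{m,n}$ and map $S$ to itself. Let $$X=A_{m,n}^{-2},\qquad Y=(2I-A_{m,n}^{-1})^{-1},$$ $$A=(0,0,1),\quad B=(2,1,1),\quad C=(7,4,2),\quad D=(-a,1,0),\quad E=(3,2,1).$$ Then $G$ is a free abelian group with basis $X,Y$. The operator $X$ maps $A$ to $D$, $B$ to $C$, and the segment $AB$ onto $DC$; the operator $Y$ maps $A$ to $B$, $D$ to $C$, and the segment $AD$ onto $BC$. The point $E$ lies on $S$. In both cases below, the torus triangulation is the decomposition of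 the quotient $S/G$ into the images of the vertices, edges and two-dimensional faces of $S$; it is said to be homeomorphic to a decomposition of $\mathbb R^2/\mathbb Z^2$ if some homeomorphism of $S/G$ onto $\mathbb R^2/\mathbb Z^2$ carries the cells of each dimension onto the cells of the same dimension. In the plane let $A'=(0,0)$, $B'=(0,1)$, $C'=(1,1)$, $D'=(1,0)$, $E'=(2/3,2/3)$. The integer length of a segment (integer area of a triangle) with integer vertices is its Euclidean length (area) divided by the least Euclidean length (area) of a nondegenerate integer segment (triangle) in the same line (plane); the integer distance from an integer plane to an integer point is the Euclidean distance divided by the least Euclidean distance from the plane to an integer point outside the plane. **Case $a=0$.** The torus triangulation is homeomorphic to the decomposition of $\mathbb R^2/\mathbb Z^2$ into the images of the vertex $A'$, the edges $A'B'$, $A'D'$, $B'D'$ and the triangles $A'B'D'$, $B'C'D'$. The vertex $A$, the edges $AB$, $AD$, $BD$ and the triangles $ABD$, $BCD$ are faces of $S$, and they contain exactly one face from each class of faces of $S$ under $G$; so the union $ABD\cup BCD$ is the closure of a fundamental region. The vertices of $S$ on it are exactly $A,B,C,D$, and $E$ is the centroid of the face $BCD$. The integer lengths of $AB$, $BC$,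 $CD$, $DA$ are equal to $1$; the integer areas of $ABD$ and $BCD$ are $1$ and $3$; the integer distances from the origin to the planes containing $ABD$ and $BCD$ are $2$ and $1$, respectively. **Case $a>0$.** The torus triangulation is homeomorphic to the decomposition of $\mathbb R^2/\mathbb Z^2$ into the images of the vertices $A'$, $E'$, the edges $A'B'$, $A'D'$, $B'D'$, $B'E'$, $C'E'$, $D'E'$ and the triangles $A'B'D'$, $B'D'E'$, $B'C'E'$, $C'E'D'$. The vertices $A$, $E$, the edges $AB$, $AD$, $BD$, $BE$, $CE$, $DE$ and the triangles $ABD$, $BDE$, $BCE$, $CED$ are faces of $S$, and they contain exactly one face from each class of faces of $S$ under $G$; so the union of the four triangles is the closure of a fundamental region. The vertices of $S$ on it are exactly $A,B,C,D,E$. The integer lengths of all sides $AB$, $BC$, $CD$, $DA$, $BD$, $BE$, $CE$, $DE$ and the integer areas of all four triangles are equal to $1$; the integer distances from the origin to the planes containing $ABD$, $BDE$, $BCE$, $CED$ are $a+2$, $a+1$, $1$, $1$, respectively. -/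

import Mathlib

namespace TorusSail

/-- Three-dimensional Euclidean space. -/
abbrev E3 : Type := EuclideanSpace ℝ (Fin 3)

/-- The group `SL(3, ℤ)`. -/
abbrev SL3Z : Type := Matrix.SpecialLinearGroup (Fin 3) ℤ

/-- The linear operator of `ℝ³` given by an integer matrix of determinant one
(acting on column vectors). -/
noncomputable def act (g : SL3Z) : E3 →ₗ[ℝ] E3 :=
  Matrix.toEuclideanLin ((g : Matrix (Fin 3) (Fin 3) ℤ).map (Int.cast : ℤ → ℝ))

theorem act_one : act 1 = LinearMap.id := by
  simp [act, Matrix.toEuclideanLin]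

theorem act_mul (g h : SL3Z) : act (g * h) = act g ∘ₗ act h := by
  simp [act, Matrix.toEuclideanLin, Matrix.map_mul_intCast]

theorem act_inv_act (g : SL3Z) (p : E3) : act g⁻¹ (act g p) = p := by
  have h := act_mul g⁻¹ g
  rw [inv_mul_cancel, act_one] at h
  exact (LinearMap.congr_fun h p).symm

/-- The integer points of `ℝ³`. -/
def integerPoints : Set E3 := {p | ∀ i, ∃ k : ℤ, p i = k}

/-- The integer point with the given coordinates. -/
noncomputable def pt (x y z : ℤ) : E3 := !₂[(x : ℝ), (y : ℝ), (z : ℝ)]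

/-! ### Sails -/

/-- The planes spanned by pairs of linearly independent eigenvectors of `M`. -/
def eigenplanes (M : SL3Z) : Set (Submodule ℝ E3) :=
  {H | ∃ (μ ν : ℝ) (v w : E3), Module.End.HasEigenvector (act M) μ v ∧
    Module.End.HasEigenvector (act M) ν w ∧ LinearIndependent ℝ ![v, w] ∧
    H = Submodule.span ℝ {v, w}}

/-- The complement of the union of these planes. -/
def eigenplanesCompl (M : SL3Z) : Set E3 := (⋃ H ∈ eigenplanes M, (H : Set E3))ᶜ

/-- An open orthant of `M`: a connected component of the complement of the planes. -/
def IsOrthant (M : SL3Z) (O : Set E3) : Prop :=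
  ∃ p ∈ eigenplanesCompl M, O = connectedComponentIn (eigenplanesCompl M) p

/-- The convex hull of all integer points, except the origin, in the closure of the orthant. -/
def sailHull (O : Set E3) : Set E3 :=
  convexHull ℝ ((closure O ∩ integerPoints) \ {0})

/-- The sail of an orthant. -/
def sail (O : Set E3) : Set E3 := frontier (sailHull O)

/-- The faces of dimension `k` of the sail: the `k`-dimensional nonempty sets which are cut out of
the convex hull by a supporting plane. -/
def IsFace (O : Set E3) (k : ℕ) (F : Set E3) : Prop :=
  F.Nonempty ∧ F ⊆ sail O ∧ IsExposed ℝ (sailHull O) F ∧ Module.finrank ℝ (vectorSpan ℝ F) = k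

/-- The group of the integer operators of determinant one that commute with `M` and map the sail
to itself. -/
def periodGroup (M : SL3Z) (O : Set E3) : Subgroup SL3Z where
  carrier := {g | g * M = M * g ∧ act g '' sail O = sail O}
  one_mem' := by simp [act_one]
  mul_mem' := by
    rintro g h ⟨hg, hg'⟩ ⟨hh, hh'⟩
    refine ⟨by rw [mul_assoc, hh, ← mul_assoc, hg, mul_assoc], ?_⟩
    rw [act_mul, LinearMap.coe_comp, Set.image_comp, hh', hg']
  inv_mem' := by
    rintro g ⟨hg, hg'⟩
    refine ⟨?_, ?_⟩
    · rw [inv_mul_eq_iff_eq_mul, ← mul_assoc, hg, mul_assoc, mul_inv_cancel, mul_one]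
    · conv_lhs => rw [← hg']
      rw [← Set.image_comp]
      convert Set.image_id _ using 2
      funext p
      exact act_inv_act g p

/-- Equivalence of points of the sail under the period group. -/
def periodSetoid (M : SL3Z) (O : Set E3) : Setoid (sail O) where
  r p q := ∃ g ∈ periodGroup M O, act g (p : E3) = (q : E3)
  iseqv :=
    { refl := fun p => ⟨1, one_mem _, by simp [act_one]⟩
      symm := by
        rintro p q ⟨g, hg, h⟩
        exact ⟨g⁻¹, inv_mem hg, by rw [← h, act_inv_act]⟩
      trans := by
        rintro p q r ⟨g, hg, h⟩ ⟨g', hg', h'⟩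
        exact ⟨g' * g, mul_mem hg' hg, by rw [act_mul, LinearMap.comp_apply, h, h']⟩ }

/-- The quotient of the sail by the period group, with the quotient topology. -/
abbrev SailQuotient (M : SL3Z) (O : Set E3) : Type := Quotient (periodSetoid M O)

/-- The decomposition of the quotient of the sail: its (closed) `k`-cells are the images of the
`k`-dimensional faces of the sail. -/
def sailTriangulation (M : SL3Z) (O : Set E3) (k : ℕ) : Set (Set (SailQuotient M O)) :=
  {c | ∃ F, IsFace O k F ∧ c = Quotient.mk (periodSetoid M O) '' {x : sail O | (x : E3) ∈ F}}

/-- Two spaces, each with a decomposition given by its `k`-cells for all `k`, are homeomorphic by a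
homeomorphism that carries the `k`-cells of the first one onto those of the second one. -/
def HomeomorphicDecompositions {T T' : Type} [TopologicalSpace T] [TopologicalSpace T']
    (D : ℕ → Set (Set T)) (D' : ℕ → Set (Set T')) : Prop :=
  ∃ h : T ≃ₜ T', ∀ k, (fun c => h '' c) '' D k = D' k

/-- A family of faces (`R k` consisting of `k`-dimensional ones) that contains exactly one face
from each class of faces of the sail under the period group. -/
def IsFundamentalFamily (M : SL3Z) (O : Set E3) (R : ℕ → Set (Set E3)) : Prop :=
  (∀ k, ∀ F ∈ R k, IsFace O k F) ∧
    ∀ k F, IsFace O k F → ∃! F₀, F₀ ∈ R k ∧ ∃ g ∈ periodGroup M O, act g '' F₀ = F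

/-! ### Integer lengths, areas and distances -/

/-- Integer length of a segment: its Euclidean length divided by the least length of an integer
segment on the same line. -/
noncomputable def integerLength (P Q : E3) : ℝ :=
  dist P Q / sInf {d | ∃ U ∈ integerPoints, ∃ V ∈ integerPoints,
    U ∈ line[ℝ, P, Q] ∧ V ∈ line[ℝ, P, Q] ∧ U ≠ V ∧ d = dist U V}

/-- Euclidean area of a triangle. -/
noncomputable def triangleArea (P Q R : E3) : ℝ :=
  Real.sqrt (‖Q - P‖ ^ 2 * ‖R - P‖ ^ 2 - (inner ℝ (Q - P) (R - P)) ^ 2) / 2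

/-- The plane through three points. -/
noncomputable def plane (P Q R : E3) : AffineSubspace ℝ E3 := affineSpan ℝ {P, Q, R}

/-- Integer area of a triangle: its Euclidean area divided by the least area of a (nondegenerate)
integer triangle in the same plane. -/
noncomputable def integerArea (P Q R : E3) : ℝ :=
  triangleArea P Q R / sInf {s | ∃ U ∈ integerPoints, ∃ V ∈ integerPoints, ∃ W ∈ integerPoints,
    U ∈ plane P Q R ∧ V ∈ plane P Q R ∧ W ∈ plane P Q R ∧
    AffineIndependent ℝ ![U, V, W] ∧ s = triangleArea U V W}

/-- Integer distance from a plane to a point: the Euclidean distance divided by the least distance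
from the plane to an integer point in its complement. -/
noncomputable def integerDistance (H : AffineSubspace ℝ E3) (p : E3) : ℝ :=
  Metric.infDist p H / sInf {d | ∃ q ∈ integerPoints, q ∉ H ∧ d = Metric.infDist q H}

/-! ### The operators and the points of the series -/

/-- The Frobenius operator `A_{m,n}`. -/
def frobeniusOp (m n : ℤ) : SL3Z :=
  ⟨!![0, 1, 0; 0, 0, 1; 1, -m, -n], by simp [Matrix.det_fin_three]⟩

/-- The operator `A_{m,n}` with `m = -a`, `n = 2a + 3`. -/
def opA (a : ℤ) : SL3Z := frobeniusOp (-a) (2 * a + 3)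

/-- The operator `A_{m,n}⁻²`. -/
def opX (a : ℤ) : SL3Z := opA a ^ (-2 : ℤ)

theorem det_two_sub_inv (a : ℤ) :
    ((2 : Matrix (Fin 3) (Fin 3) ℤ) - ((opA a)⁻¹ : SL3Z)).det = 1 := by
  have h : (((opA a)⁻¹ : SL3Z) : Matrix (Fin 3) (Fin 3) ℤ) =
      !![-a, 2 * a + 3, 1; 1, 0, 0; 0, 1, 0] := by
    rw [Matrix.SpecialLinearGroup.coe_inv, opA, frobeniusOp, Matrix.adjugate_fin_three_of]
    ext i j
    fin_cases i <;> fin_cases j <;> simp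
  have h2 : (2 : Matrix (Fin 3) (Fin 3) ℤ) = !![2, 0, 0; 0, 2, 0; 0, 0, 2] := by decide
  rw [h, h2, Matrix.det_fin_three]
  simp
  ring

/-- The operator `2I - A_{m,n}⁻¹`. -/
def twoSubInv (a : ℤ) : SL3Z :=
  ⟨(2 : Matrix (Fin 3) (Fin 3) ℤ) - ((opA a)⁻¹ : SL3Z), det_two_sub_inv a⟩

/-- The operator `(2I - A_{m,n}⁻¹)⁻¹`. -/
def opY (a : ℤ) : SL3Z := (twoSubInv a)⁻¹

noncomputable def ptA : E3 := pt 0 0 1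
noncomputable def ptB : E3 := pt 2 1 1
noncomputable def ptC : E3 := pt 7 4 2
noncomputable def ptD (a : ℤ) : E3 := pt (-a) 1 0
noncomputable def ptE : E3 := pt 3 2 1

/-! ### The two schemes of triangulations

They are written for arbitrary points of a real vector space, since they are used both for the
faces of the sail and for the model in the plane. -/

section Schemes

variable {V : Type} [AddCommGroup V] [Module ℝ V]

/-- The triangle with the given vertices. -/
def tri (P Q R : V) : Set V := convexHull ℝ {P, Q, R}

/-- The quadrangle region `ABCD` cut by the diagonal `BD`: one vertex, three edges, and
two triangles up to the identification of `AB` with `DC` and of `AD` with `BC`. -/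
def schemeTwo (A B C D : V) : ℕ → Set (Set V)
  | 0 => {{A}}
  | 1 => {segment ℝ A B, segment ℝ A D, segment ℝ B D}
  | 2 => {tri A B D, tri B C D}
  | _ => ∅

/-- The same with the triangle `BCD` subdivided by its interior point `E`: two vertices, six edges,
and four triangles up to the identification of `AB` with `DC` and of `AD` with `BC`. -/
def schemeFour (A B C D E : V) : ℕ → Set (Set V)
  | 0 => {{A}, {E}}
  | 1 => {segment ℝ A B, segment ℝ A D, segment ℝ B D,
      segment ℝ B E, segment ℝ C E, segment ℝ D E}
  | 2 => {tri A B D, tri B D E, tri B C E, tri C E D}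
  | _ => ∅

end Schemes

/-- The standard torus `ℝ²/ℤ²`. -/
abbrev StdTorus : Type := UnitAddCircle × UnitAddCircle

/-- The projection of the plane onto the standard torus. -/
def toTorus (p : ℝ × ℝ) : StdTorus := ((p.1 : UnitAddCircle), (p.2 : UnitAddCircle))

/-- The standard torus glued from the unit square, cut by a diagonal into two triangles. -/
def modelTwo (k : ℕ) : Set (Set StdTorus) :=
  (fun c => toTorus '' c) '' schemeTwo ((0, 0) : ℝ × ℝ) (0, 1) (1, 1) (1, 0) k

/-- The standard torus glued from the unit square, cut by a diagonal into two triangles, one of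
which is further cut into three triangles by an interior point. -/
noncomputable def modelFour (k : ℕ) : Set (Set StdTorus) :=
  (fun c => toTorus '' c) ''
    schemeFour ((0, 0) : ℝ × ℝ) (0, 1) (1, 1) (1, 0) (2 / 3, 2 / 3) k

end TorusSail

open TorusSail

/-!
Normalised to be `1` at `(0, 0, 1)`, the three eigenforms of the operator cut out the orthant, and
`X`, `Y` multiply them by positive units. Each of the listed triangles lies in a plane `f = d`,
where `f` is an integer form that is positive on the orthant and at least `d` at the nonzero integer
points of the closed orthant. Across each edge the neighbouring translate lies strictly beyond this
plane, so convexity and local finiteness show that the translates of the triangles make up the whole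
sail.

An element of `G` is determined by the image of `A`, which is a vertex of the sail and therefore in
the orbit of `A` or of `E` under `X`, `Y`. The orbit of `E` is excluded by a determinant: the
integer matrix that commutes with the operator and maps `A` to `E` has determinant `a + 3`. Hence
`X`, `Y` generate `G`. Sending the vertices of the sail to points of the plane, with `X`, `Y` acting
as unit translations, and extending linearly on the triangles gives the homeomorphism
`S / G ≅ ℝ² / ℤ²`.

Integer lengths, areas and distances are read off integer covectors that are dual to a basis of the
lattice.
-/

namespace TorusSail

/-! ### Polyhedral hulls of periodic families of simplices -/

theorem exists_mem_openSegment_of_mem_intrinsicInterior {V : Type*} [NormedAddCommGroup V]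
    [NormedSpace ℝ V] {F : Set V} {p x : V} (hp : p ∈ intrinsicInterior ℝ F) (hx : x ∈ F) :
    ∃ y ∈ F, p ∈ openSegment ℝ x y := by
  obtain ⟨p, hint, rfl⟩ := mem_intrinsicInterior.1 hp
  let ray : ℝ → affineSpan ℝ F := fun t =>
    ⟨AffineMap.lineMap (p : V) x t, AffineMap.lineMap_mem t p.2 (subset_affineSpan ℝ F hx)⟩
  have hray : Continuous ray := AffineMap.lineMap_continuous.subtype_mk _
  have hray0 : ray 0 = p := Subtype.ext (AffineMap.lineMap_apply_zero _ _)
  have hnhds : ∀ᶠ t in nhdsWithin (0 : ℝ) (Set.Iio 0),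
      ray t ∈ interior ((↑) ⁻¹' F : Set (affineSpan ℝ F)) :=
    nhdsWithin_le_nhds <| hray.continuousAt.preimage_mem_nhds <|
      isOpen_interior.mem_nhds (hray0.symm ▸ hint)
  obtain ⟨t, htF, ht⟩ := (hnhds.and self_mem_nhdsWithin).exists
  have ht' : 0 < 1 - t := sub_pos.2 (lt_trans ht one_pos)
  refine ⟨ray t, Set.mem_preimage.1 (interior_subset htF), -t / (1 - t), 1 / (1 - t),
    div_pos (neg_pos.2 ht) ht', one_div_pos.2 ht', by field_simp; ring, ?_⟩
  simp only [ray, AffineMap.lineMap_apply_module', smul_add, smul_smul, smul_sub]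
  match_scalars <;> field_simp <;> ring

/-- The cell spanned by a finite set of labelled points: the convex hull of the points with these
labels. -/
def cell {Λ V : Type*} [AddCommGroup V] [Module ℝ V] (P : Λ → V) (σ : Finset Λ) : Set V :=
  convexHull ℝ (P '' σ)

theorem cell_mono {Λ V : Type*} [AddCommGroup V] [Module ℝ V] (P : Λ → V) {σ σ' : Finset Λ}
    (hσ : σ ⊆ σ') : cell P σ ⊆ cell P σ' :=
  convexHull_mono (Set.image_mono (Finset.coe_subset.2 hσ))

theorem isCompact_cell {Λ V : Type*} [NormedAddCommGroup V] [NormedSpace ℝ V] (P : Λ → V)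
    (σ : Finset Λ) : IsCompact (cell P σ) :=
  (σ.finite_toSet.image P).isCompact_convexHull ℝ

/-- A family of simplices in an open set `O` that forms the boundary of a convex polyhedron. The
simplex `τ` has the vertices `P (vtx τ k)` and spans the hyperplane `φ τ = 1`; all these hyperplanes
support the set `L`, whose convex hull is the polyhedron, and each facet of `τ` is the intersection
of the simplex with another one of them. -/
structure IsConvexTriangulation {ι κ Λ V : Type*} [Fintype κ] [NormedAddCommGroup V]
    [NormedSpace ℝ V] (P : Λ → V) (vtx : ι → κ → Λ) (φ : ι → V →ₗ[ℝ] ℝ) (L O : Set V) : Prop where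
  nonempty : Nonempty ι
  linearIndependent : ∀ τ, LinearIndependent ℝ fun k => P (vtx τ k)
  card_eq_finrank : Fintype.card κ = Module.finrank ℝ V
  injOn_vertices : ∀ τ k τ' k', P (vtx τ k) = P (vtx τ' k') → vtx τ k = vtx τ' k'
  vertex_mem : ∀ τ k, P (vtx τ k) ∈ L
  apply_vertex : ∀ τ k, φ τ (P (vtx τ k)) = 1
  exists_adjacent : ∀ τ k, ∃ τ', (∀ l, l ≠ k → φ τ' (P (vtx τ l)) = 1) ∧ 1 < φ τ' (P (vtx τ k))
  one_le : ∀ p ∈ L, ∀ τ, 1 ≤ φ τ p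
  natCast_smul_mem : ∀ p ∈ L, ∀ n : ℕ, n ≠ 0 → (n : ℝ) • p ∈ L
  isOpen : IsOpen O
  mem_of_forall_one_le : ∀ p, (∀ τ, 1 ≤ φ τ p) → p ∈ O
  pos : ∀ τ, ∀ p ∈ O, 0 < φ τ p
  locallyFinite : ∀ p ∈ O, ∀ C : ℝ, ∃ U ∈ nhds p, {τ | ∃ p' ∈ U, φ τ p' ≤ C}.Finite

namespace IsConvexTriangulation

variable {ι κ Λ V W : Type*} [Fintype κ] [NormedAddCommGroup V] [NormedSpace ℝ V]
  [AddCommGroup W] [Module ℝ W]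
  {P : Λ → V} {vtx : ι → κ → Λ} {φ : ι → V →ₗ[ℝ] ℝ} {L O : Set V} {τ : ι} {s : Finset κ} {p : V}

variable (h : IsConvexTriangulation P vtx φ L O)

section

include h

theorem exists_forall_le (hp : p ∈ O) : ∃ τ, ∀ τ', φ τ p ≤ φ τ' p := by
  obtain ⟨τ₀⟩ := h.nonempty
  obtain ⟨U, hU, hfin⟩ := h.locallyFinite p hp (φ τ₀ p)
  have hfin : {τ | φ τ p ≤ φ τ₀ p}.Finite := hfin.subset fun τ hτ => ⟨p, mem_of_mem_nhds hU, hτ⟩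
  obtain ⟨τ, hτ, hmin⟩ := Set.exists_min_image _ (φ · p) hfin ⟨τ₀, by simp⟩
  exact ⟨τ, fun τ' => (le_total (φ τ' p) (φ τ₀ p)).elim (hmin τ') hτ.trans⟩

theorem one_le_of_mem_hull (hp : p ∈ convexHull ℝ L) (τ : ι) : 1 ≤ φ τ p :=
  convexHull_min (fun q hq => h.one_le q hq τ) (convex_halfSpace_ge (φ τ).isLinear 1) hp

theorem hull_subset : convexHull ℝ L ⊆ O := fun p hp =>
  h.mem_of_forall_one_le p (h.one_le_of_mem_hull hp)

theorem vertex_mem_hull (τ : ι) (k : κ) : P (vtx τ k) ∈ convexHull ℝ L :=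
  subset_convexHull ℝ L (h.vertex_mem τ k)

theorem cell_subset_hull [DecidableEq Λ] : cell P (s.image (vtx τ)) ⊆ convexHull ℝ L :=
  convexHull_mono <| by simpa [Set.subset_def] using fun k _ => h.vertex_mem τ k

theorem smul_mem_hull (hp : p ∈ convexHull ℝ L) {t : ℝ} (ht : 1 ≤ t) : t • p ∈ convexHull ℝ L := by
  suffices hL : ∀ q ∈ L, t • q ∈ convexHull ℝ L from
    convexHull_min hL ((convex_convexHull ℝ L).linear_preimage (LinearMap.lsmul ℝ V t)) hp
  intro q hq
  have hfloor : 1 ≤ ⌊t⌋₊ := Nat.le_floor (by simpa using ht)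
  have hmem : ((⌊t⌋₊ : ℕ) : ℝ) • q ∈ convexHull ℝ L :=
    subset_convexHull ℝ L (h.natCast_smul_mem q hq _ (by lia))
  have hmem' : ((⌊t⌋₊ + 1 : ℕ) : ℝ) • q ∈ convexHull ℝ L :=
    subset_convexHull ℝ L (h.natCast_smul_mem q hq _ (by lia))
  convert (convex_convexHull ℝ L) hmem hmem' (sub_nonneg.2 (Nat.lt_floor_add_one t).le)
    (sub_nonneg.2 (Nat.floor_le (zero_le_one.trans ht))) (by ring) using 1
  push_cast
  module

end

variable [FiniteDimensional ℝ V]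

/-- The basis of the space formed by the vertices of a simplex. -/
noncomputable def basis (τ : ι) : Module.Basis κ ℝ V :=
  .mk (h.linearIndependent τ)
    ((h.linearIndependent τ).span_eq_top_of_card_eq_finrank' h.card_eq_finrank).ge

include h

theorem basis_apply (τ : ι) (k : κ) : h.basis τ k = P (vtx τ k) :=
  Module.Basis.mk_apply _ _ k

theorem coord_vertex [DecidableEq κ] (τ : ι) (k l : κ) :
    (h.basis τ).coord k (P (vtx τ l)) = if l = k then 1 else 0 := by
  rw [← h.basis_apply, Module.Basis.coord_apply, Module.Basis.repr_self, Finsupp.single_apply]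

theorem sum_coord_smul (τ : ι) (f : V →ₗ[ℝ] W) (p : V) :
    ∑ k, (h.basis τ).coord k p • f (P (vtx τ k)) = f p := by
  conv_rhs => rw [← (h.basis τ).sum_repr p, map_sum]
  simp only [map_smul, basis_apply, Module.Basis.coord_apply]

theorem sum_coord (τ : ι) (p : V) : ∑ k, (h.basis τ).coord k p = φ τ p := by
  simpa only [h.apply_vertex, smul_eq_mul, mul_one] using h.sum_coord_smul τ (φ τ) p

section Cells

variable [DecidableEq Λ]

theorem mem_cell_image :
    p ∈ cell P (s.image (vtx τ)) ↔
      (∀ k, 0 ≤ (h.basis τ).coord k p) ∧ φ τ p = 1 ∧ ∀ k ∉ s, (h.basis τ).coord k p = 0 := by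
  classical
  constructor
  · have hmin {C : Set V} (hC : Convex ℝ C) (hs : ∀ l ∈ s, P (vtx τ l) ∈ C) :
        cell P (s.image (vtx τ)) ⊆ C := convexHull_min (by simpa [Set.subset_def] using hs) hC
    refine fun hp => ⟨fun k => ?_, ?_, fun k hk => ?_⟩
    · refine hmin (convex_halfSpace_ge ((h.basis τ).coord k).isLinear 0) (fun l _ => ?_) hp
      rw [Set.mem_ofPred_eq, h.coord_vertex]
      split_ifs <;> norm_num
    · exact hmin (convex_hyperplane (φ τ).isLinear 1) (fun l _ => h.apply_vertex τ l) hp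
    · refine hmin (convex_hyperplane ((h.basis τ).coord k).isLinear 0) (fun l hl => ?_) hp
      rw [Set.mem_ofPred_eq, h.coord_vertex, if_neg (ne_of_mem_of_not_mem hl hk)]
  · rintro ⟨hnonneg, hone, hzero⟩
    have hsum : ∑ k ∈ s, (h.basis τ).coord k p = 1 := by
      rw [← hone, ← h.sum_coord τ p]
      exact Finset.sum_subset s.subset_univ fun k _ hk => hzero k hk
    have hp : ∑ k ∈ s, (h.basis τ).coord k p • P (vtx τ k) = p := by
      conv_rhs => rw [← LinearMap.id_apply (R := ℝ) p, ← h.sum_coord_smul τ]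
      exact Finset.sum_subset s.subset_univ fun k _ hk => by rw [hzero k hk, zero_smul]
    rw [← hp]
    exact (convex_convexHull ℝ _).sum_mem (fun k _ => hnonneg k) hsum fun k hk =>
      subset_convexHull ℝ _ ⟨vtx τ k, Finset.mem_image_of_mem _ hk, rfl⟩

theorem mem_simplex :
    p ∈ cell P (Finset.univ.image (vtx τ)) ↔ (∀ k, 0 ≤ (h.basis τ).coord k p) ∧ φ τ p = 1 := by
  simp only [h.mem_cell_image, Finset.mem_univ, not_true_eq_false, false_imp_iff, implies_true,
    and_true]

end Cells

theorem apply_adjacent_sub {τ' : ι} {k : κ} (hk : ∀ l, l ≠ k → φ τ' (P (vtx τ l)) = 1) (p : V) :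
    φ τ' p - φ τ p = (φ τ' (P (vtx τ k)) - 1) * (h.basis τ).coord k p := by
  rw [← h.sum_coord τ p, ← h.sum_coord_smul τ (φ τ') p, ← Finset.sum_sub_distrib,
    Finset.sum_eq_single k (fun l _ hl => by rw [hk l hl, smul_eq_mul, mul_one, sub_self])
      (by simp)]
  rw [smul_eq_mul]
  ring

/-- A point lies in the cone over the simplex whose functional is the least one at this point. -/
theorem coord_nonneg_of_forall_le (hmin : ∀ τ', φ τ p ≤ φ τ' p) (k : κ) :
    0 ≤ (h.basis τ).coord k p := by
  obtain ⟨τ', heq, hlt⟩ := h.exists_adjacent τ k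
  refine nonneg_of_mul_nonneg_right ?_ (sub_pos.2 hlt)
  rw [← h.apply_adjacent_sub heq]
  exact sub_nonneg.2 (hmin τ')

theorem inv_smul_mem_simplex [DecidableEq Λ] (hpos : 0 < φ τ p) (hmin : ∀ τ', φ τ p ≤ φ τ' p) :
    (φ τ p)⁻¹ • p ∈ cell P (Finset.univ.image (vtx τ)) := by
  refine h.mem_simplex.2 ⟨fun k => ?_, ?_⟩
  · rw [map_smul]
    exact mul_nonneg (inv_nonneg.2 hpos.le) (h.coord_nonneg_of_forall_le hmin k)
  · rw [map_smul, smul_eq_mul, inv_mul_cancel₀ hpos.ne']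

theorem mem_hull_iff : p ∈ convexHull ℝ L ↔ ∀ τ, 1 ≤ φ τ p := by
  classical
  refine ⟨fun hp => h.one_le_of_mem_hull hp, fun hp => ?_⟩
  obtain ⟨τ, hτ⟩ := h.exists_forall_le (h.mem_of_forall_one_le p hp)
  have hpos : 0 < φ τ p := one_pos.trans_le (hp τ)
  simpa only [smul_smul, mul_inv_cancel₀ hpos.ne', one_smul] using
    h.smul_mem_hull (h.cell_subset_hull (h.inv_smul_mem_simplex hpos hτ)) (hp τ)

theorem isClosed_hull : IsClosed (convexHull ℝ L) := by
  have : convexHull ℝ L = ⋂ τ, {p | 1 ≤ φ τ p} := by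
    ext p
    simp only [h.mem_hull_iff, Set.mem_iInter, Set.mem_ofPred_eq]
  rw [this]
  exact isClosed_iInter fun τ =>
    isClosed_le continuous_const (φ τ).continuous_of_finiteDimensional

theorem mem_simplex_of_apply_eq_one [DecidableEq Λ] (hp : p ∈ convexHull ℝ L) (hτ : φ τ p = 1) :
    p ∈ cell P (Finset.univ.image (vtx τ)) :=
  h.mem_simplex.2 ⟨h.coord_nonneg_of_forall_le fun τ' => hτ ▸ h.one_le_of_mem_hull hp τ', hτ⟩

theorem mem_interior_hull (hτ : ∀ τ', φ τ p ≤ φ τ' p)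
    (hlt : 1 < φ τ p) : p ∈ interior (convexHull ℝ L) := by
  classical
  have hpos : 0 < φ τ p := one_pos.trans hlt
  set q := (φ τ p)⁻¹ • p with hq
  have hqL : q ∈ convexHull ℝ L := h.cell_subset_hull (h.inv_smul_mem_simplex hpos hτ)
  have hpq : (φ τ p - 1)⁻¹ • (p - q) = q := by
    rw [show p - q = (φ τ p - 1) • q by rw [sub_smul, one_smul, hq, smul_inv_smul₀ hpos.ne'],
      inv_smul_smul₀ (sub_pos.2 hlt).ne']
  -- `p` lies in the open set `q + (φ τ p - 1) • O`, which is contained in the hull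
  refine mem_interior.2 ⟨(fun x => (φ τ p - 1)⁻¹ • (x - q)) ⁻¹' O, fun x hx => ?_,
    h.isOpen.preimage (by fun_prop), ?_⟩
  · refine h.mem_hull_iff.2 fun τ' => (h.one_le_of_mem_hull hqL τ').trans ?_
    have hx := h.pos τ' _ hx
    rw [map_smul, map_sub, smul_eq_mul] at hx
    exact (sub_pos.1 (pos_of_mul_pos_right hx (inv_pos.2 (sub_pos.2 hlt)).le)).le
  · rw [Set.mem_preimage, hpq]
    exact h.hull_subset hqL

theorem notMem_interior_hull (hτ : φ τ p = 1) : p ∉ interior (convexHull ℝ L) := by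
  intro hp
  have hopen : IsOpenMap (φ τ) := (φ τ).isOpenMap_of_finiteDimensional <|
    LinearMap.surjective fun h0 => one_ne_zero (by rw [← hτ, h0, LinearMap.zero_apply])
  have hp : p ∈ interior (φ τ ⁻¹' Set.Ici 1) :=
    interior_mono (fun q hq => h.one_le_of_mem_hull hq τ) hp
  rw [← hopen.preimage_interior_eq_interior_preimage (φ τ).continuous_of_finiteDimensional,
    interior_Ici] at hp
  exact (hτ ▸ hp : (1 : ℝ) < 1).false

theorem mem_frontier_iff [DecidableEq Λ] :
    p ∈ frontier (convexHull ℝ L) ↔ ∃ τ, p ∈ cell P (Finset.univ.image (vtx τ)) := by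
  rw [h.isClosed_hull.frontier_eq]
  refine ⟨fun ⟨hp, hint⟩ => ?_, fun ⟨τ, hp⟩ =>
    ⟨h.cell_subset_hull hp, h.notMem_interior_hull (h.mem_simplex.1 hp).2⟩⟩
  obtain ⟨τ, hτ⟩ := h.exists_forall_le (h.hull_subset hp)
  refine ⟨τ, h.mem_simplex_of_apply_eq_one hp ((h.one_le_of_mem_hull hp τ).eq_of_not_lt' ?_)⟩
  exact fun hlt => hint (h.mem_interior_hull hτ hlt)

theorem frontier_subset_hull : frontier (convexHull ℝ L) ⊆ convexHull ℝ L :=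
  h.isClosed_hull.frontier_subset

theorem cell_subset_frontier [DecidableEq Λ] :
    cell P (s.image (vtx τ)) ⊆ frontier (convexHull ℝ L) := fun _ hp =>
  h.mem_frontier_iff.2 ⟨τ, cell_mono P (Finset.image_subset_image s.subset_univ) hp⟩

end IsConvexTriangulation

theorem sum_smul_mem_cell {κ Λ V : Type*} [Fintype κ] [DecidableEq Λ] [AddCommGroup V] [Module ℝ V]
    (P : Λ → V) (v : κ → Λ) {b : κ → ℝ} (hb : b ∈ stdSimplex ℝ κ) :
    ∑ k, b k • P (v k) ∈ cell P (Finset.univ.image v) :=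
  (convex_convexHull ℝ _).sum_mem (fun k _ => hb.1 k) hb.2 fun k _ =>
    subset_convexHull ℝ _ ⟨v k, Finset.mem_image_of_mem _ (Finset.mem_univ k), rfl⟩

namespace IsConvexTriangulation

variable {ι κ Λ V W : Type*} [Fintype κ] [NormedAddCommGroup V] [NormedSpace ℝ V]
  [FiniteDimensional ℝ V] [AddCommGroup W] [Module ℝ W] [DecidableEq Λ]
  {P : Λ → V} {vtx : ι → κ → Λ} {φ : ι → V →ₗ[ℝ] ℝ} {L O F : Set V} {τ : ι} {s : Finset κ} {p : V}
  (h : IsConvexTriangulation P vtx φ L O)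

section Faces

include h

omit [DecidableEq Λ] in
theorem isExposed_setOf_apply_eq_one (τ : ι) :
    IsExposed ℝ (convexHull ℝ L) {p ∈ convexHull ℝ L | φ τ p = 1} := by
  rintro ⟨q, hq, hq1⟩
  refine ⟨-LinearMap.toContinuousLinearMap (φ τ), Set.ext fun p => and_congr_right fun hp => ?_⟩
  simp only [neg_apply, LinearMap.coe_toContinuousLinearMap', neg_le_neg_iff]
  exact ⟨fun hp1 y hy => hp1 ▸ h.one_le_of_mem_hull hy τ,
    fun hmin => ((hmin q hq).trans hq1.le).antisymm (h.one_le_of_mem_hull hp τ)⟩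

theorem isExposed_cell : IsExposed ℝ (convexHull ℝ L) (cell P (s.image (vtx τ))) := by
  classical
  choose ν hν hν' using h.exists_adjacent τ
  -- the cell is cut out by the hyperplanes of `τ` and of its neighbours across the vertices
  -- outside `s`
  let B : Finset (Set V) := insert {p ∈ convexHull ℝ L | φ τ p = 1}
    (sᶜ.image fun k => {p ∈ convexHull ℝ L | φ (ν k) p = 1})
  have hB : cell P (s.image (vtx τ)) = ⋂₀ (B : Set (Set V)) := by
    ext p
    simp only [B, Finset.coe_insert, Finset.coe_image, Set.sInter_insert, Set.sInter_image,
      Set.mem_inter_iff, Set.mem_iInter, Set.mem_ofPred_eq, Finset.coe_compl, Set.mem_compl_iff,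
      Finset.mem_coe]
    constructor
    · intro hp
      obtain ⟨-, hone, hzero⟩ := h.mem_cell_image.1 hp
      refine ⟨⟨h.cell_subset_hull hp, hone⟩, fun k hk => ⟨h.cell_subset_hull hp, ?_⟩⟩
      rw [← sub_eq_zero, ← hone, h.apply_adjacent_sub (hν k), hzero k hk, mul_zero]
    · rintro ⟨⟨hp, hone⟩, hadj⟩
      refine h.mem_cell_image.2
        ⟨(h.mem_simplex.1 (h.mem_simplex_of_apply_eq_one hp hone)).1, hone, fun k hk => ?_⟩
      have hmul := h.apply_adjacent_sub (hν k) p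
      rw [(hadj k hk).2, hone, sub_self, eq_comm, mul_eq_zero] at hmul
      exact hmul.resolve_left (sub_pos.2 (hν' k)).ne'
  rw [hB]
  refine IsExposed.sInter (Finset.insert_nonempty _ _) fun C hC => ?_
  rcases Finset.mem_insert.1 hC with rfl | hC
  · exact h.isExposed_setOf_apply_eq_one τ
  · obtain ⟨k, -, rfl⟩ := Finset.mem_image.1 hC
    exact h.isExposed_setOf_apply_eq_one _

omit [DecidableEq Λ] in
theorem vertex_mem_extremePoints (τ : ι) (k : κ) :
    P (vtx τ k) ∈ (convexHull ℝ L).extremePoints ℝ := by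
  classical
  have hextreme := (h.isExposed_cell (τ := τ) (s := {k})).isExtreme
  rwa [cell, Finset.image_singleton, Finset.coe_singleton, Set.image_singleton,
    convexHull_singleton, isExtreme_singleton] at hextreme

omit [FiniteDimensional ℝ V] in
theorem exists_eq_vertex_of_mem_cell (hp : p ∈ cell P (s.image (vtx τ)))
    (hp' : p ∈ (convexHull ℝ L).extremePoints ℝ) : ∃ k ∈ s, P (vtx τ k) = p := by
  have hcell : p ∈ (cell P (s.image (vtx τ))).extremePoints ℝ :=
    inter_extremePoints_subset_extremePoints_of_subset h.cell_subset_hull ⟨hp, hp'⟩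
  simpa using extremePoints_convexHull_subset hcell

theorem mem_of_vertex_mem_cell {τ' : ι} {k : κ} (hk : P (vtx τ k) ∈ cell P (s.image (vtx τ'))) :
    vtx τ k ∈ s.image (vtx τ') := by
  obtain ⟨l, hl, hlk⟩ := h.exists_eq_vertex_of_mem_cell hk (h.vertex_mem_extremePoints τ k)
  rw [h.injOn_vertices _ _ _ _ hlk.symm]
  exact Finset.mem_image_of_mem _ hl

omit [DecidableEq Λ] in
theorem mem_extremePoints_iff :
    p ∈ (convexHull ℝ L).extremePoints ℝ ∧ p ∈ frontier (convexHull ℝ L) ↔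
      ∃ τ k, p = P (vtx τ k) := by
  classical
  constructor
  · rintro ⟨hp, hp'⟩
    obtain ⟨τ, hτ⟩ := h.mem_frontier_iff.1 hp'
    obtain ⟨k, -, hk⟩ := h.exists_eq_vertex_of_mem_cell hτ hp
    exact ⟨τ, k, hk.symm⟩
  · rintro ⟨τ, k, rfl⟩
    exact ⟨h.vertex_mem_extremePoints τ k, h.cell_subset_frontier (τ := τ) (s := {k})
      (subset_convexHull ℝ _ (by simp))⟩

theorem vertex_mem_of_isExposed (hF : IsExposed ℝ (convexHull ℝ L) F) (hpF : p ∈ F)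
    (hp : p ∈ cell P (Finset.univ.image (vtx τ))) {k : κ} (hk : 0 < (h.basis τ).coord k p) :
    P (vtx τ k) ∈ F := by
  obtain ⟨hnonneg, hone⟩ := h.mem_simplex.1 hp
  obtain ⟨f, rfl⟩ := hF ⟨p, hpF⟩
  have hle : ∀ l ∈ Finset.univ,
      (h.basis τ).coord l p * f (P (vtx τ l)) ≤ (h.basis τ).coord l p * f p := fun l _ =>
    mul_le_mul_of_nonneg_left (hpF.2 _ (h.vertex_mem_hull τ l)) (hnonneg l)
  have hsum : ∑ l, (h.basis τ).coord l p * f (P (vtx τ l)) = ∑ l, (h.basis τ).coord l p * f p := by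
    rw [← Finset.sum_mul, h.sum_coord, hone, one_mul]
    exact h.sum_coord_smul τ (f : V →ₗ[ℝ] ℝ) p
  have hk := mul_left_cancel₀ hk.ne' <|
    (Finset.sum_eq_sum_iff_of_le hle).1 hsum k (Finset.mem_univ k)
  exact ⟨h.vertex_mem_hull τ k, fun y hy => hk ▸ hpF.2 y hy⟩

theorem exists_eq_cell (hne : F.Nonempty) (hF : IsExposed ℝ (convexHull ℝ L) F)
    (hsub : F ⊆ frontier (convexHull ℝ L)) :
    ∃ τ, ∃ s : Finset κ, s.Nonempty ∧ F = cell P (s.image (vtx τ)) := by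
  classical
  have hconv := hF.convex (convex_convexHull ℝ L)
  -- the cell is the carrier of a point `p` of the relative interior of `F`
  obtain ⟨p, hp⟩ := hne.intrinsicInterior hconv
  have hpF := intrinsicInterior_subset hp
  obtain ⟨τ, hτ⟩ := h.mem_frontier_iff.1 (hsub hpF)
  obtain ⟨hnonneg, hone⟩ := h.mem_simplex.1 hτ
  let s : Finset κ := {k | 0 < (h.basis τ).coord k p}
  have hps : p ∈ cell P (s.image (vtx τ)) :=
    h.mem_cell_image.2 ⟨hnonneg, hone, fun k hk => le_antisymm
      (not_lt.1 fun hpos => hk (Finset.mem_filter.2 ⟨Finset.mem_univ k, hpos⟩)) (hnonneg k)⟩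
  refine ⟨τ, s, ?_, Set.Subset.antisymm (fun x hx => ?_) (convexHull_min ?_ hconv)⟩
  · rw [← Finset.image_nonempty (f := vtx τ), ← Finset.coe_nonempty, ← Set.image_nonempty (f := P),
      ← convexHull_nonempty_iff (𝕜 := ℝ)]
    exact ⟨p, hps⟩
  · obtain ⟨y, hy, hpxy⟩ := exists_mem_openSegment_of_mem_intrinsicInterior hp hx
    exact h.isExposed_cell.isExtreme.2 (hF.subset hx) (hF.subset hy) hps hpxy
  · simp only [Finset.coe_image, Set.image_subset_iff]
    exact fun l hl => h.vertex_mem_of_isExposed hF hpF hτ (Finset.mem_filter.1 hl).2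

omit [FiniteDimensional ℝ V] in
theorem finrank_vectorSpan_cell (hs : s.Nonempty) :
    Module.finrank ℝ (vectorSpan ℝ (cell P (s.image (vtx τ)))) + 1 = s.card := by
  have hindep : AffineIndependent ℝ fun k : s => P (vtx τ k) :=
    (h.linearIndependent τ).affineIndependent.comp_embedding (Function.Embedding.subtype _)
  have hcell : cell P (s.image (vtx τ)) = convexHull ℝ (Set.range fun k : s => P (vtx τ k)) := by
    rw [cell, Finset.coe_image, ← Set.image_comp, Set.image_eq_range]
    rfl
  have : Nonempty s := hs.to_subtype
  rw [hcell, ← direction_affineSpan, affineSpan_convexHull, direction_affineSpan,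
    hindep.finrank_vectorSpan_add_one, Fintype.card_coe]

end Faces

omit [DecidableEq Λ] in
include h in
theorem exists_mem_stdSimplex (hp : p ∈ frontier (convexHull ℝ L)) :
    ∃ τ, ∃ b ∈ stdSimplex ℝ κ, p = ∑ k, b k • P (vtx τ k) := by
  classical
  obtain ⟨τ, hτ⟩ := h.mem_frontier_iff.1 hp
  obtain ⟨hnonneg, hone⟩ := h.mem_simplex.1 hτ
  exact ⟨τ, fun k => (h.basis τ).coord k p, ⟨hnonneg, (h.sum_coord τ p).trans hone⟩,
    (h.sum_coord_smul τ LinearMap.id p).symm⟩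

section PiecewiseLinear

variable (M : Λ → W)

/-- The linear map sending the vertices of a simplex to prescribed points. -/
noncomputable def chart (τ : ι) : V →ₗ[ℝ] W :=
  (h.basis τ).constr ℝ fun k => M (vtx τ k)

omit [DecidableEq Λ] in
theorem chart_vertex (τ : ι) (k : κ) : h.chart M τ (P (vtx τ k)) = M (vtx τ k) := by
  rw [chart, ← h.basis_apply, Module.Basis.constr_basis]

theorem chart_eq_chart {τ' : ι} (hp : p ∈ cell P (Finset.univ.image (vtx τ)))
    (hp' : p ∈ cell P (Finset.univ.image (vtx τ'))) : h.chart M τ p = h.chart M τ' p := by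
  rw [← h.sum_coord_smul τ (h.chart M τ) p, ← h.sum_coord_smul τ (h.chart M τ') p]
  refine Finset.sum_congr rfl fun k _ => ?_
  rcases ((h.mem_simplex.1 hp).1 k).eq_or_lt with hk | hk
  · rw [← hk, zero_smul, zero_smul]
  · obtain ⟨l, -, hl⟩ := Finset.mem_image.1
      (h.mem_of_vertex_mem_cell (h.vertex_mem_of_isExposed h.isExposed_cell hp' hp hk))
    rw [h.chart_vertex, ← hl, h.chart_vertex]

open Classical in
/-- The piecewise linear map of the boundary of the hull that extends a map of the vertices. Outside
the boundary it has the junk value `0`. -/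
noncomputable def piecewiseLinear (p : V) : W :=
  if hp : ∃ τ, p ∈ cell P (Finset.univ.image (vtx τ)) then h.chart M hp.choose p else 0

theorem piecewiseLinear_eq_chart (hp : p ∈ cell P (Finset.univ.image (vtx τ))) :
    h.piecewiseLinear M p = h.chart M τ p := by
  have hex : ∃ τ, p ∈ cell P (Finset.univ.image (vtx τ)) := ⟨τ, hp⟩
  rw [piecewiseLinear, dif_pos hex]
  exact h.chart_eq_chart M hex.choose_spec hp

theorem piecewiseLinear_sum_smul {b : κ → ℝ} (hb : b ∈ stdSimplex ℝ κ) :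
    h.piecewiseLinear M (∑ k, b k • P (vtx τ k)) = ∑ k, b k • M (vtx τ k) := by
  simp only [h.piecewiseLinear_eq_chart M (sum_smul_mem_cell P (vtx τ) hb), map_sum, map_smul,
    h.chart_vertex]

theorem piecewiseLinear_image_cell (τ : ι) (s : Finset κ) :
    h.piecewiseLinear M '' cell P (s.image (vtx τ)) = cell M (s.image (vtx τ)) := by
  rw [Set.image_congr fun p hp => h.piecewiseLinear_eq_chart M
      (cell_mono P (Finset.image_subset_image s.subset_univ) hp),
    cell, cell, LinearMap.image_convexHull, ← Set.image_comp]
  refine congrArg _ (Set.image_congr fun v hv => ?_)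
  obtain ⟨l, -, rfl⟩ := Finset.mem_image.1 (Finset.mem_coe.1 hv)
  exact h.chart_vertex M τ l

theorem continuous_piecewiseLinear [TopologicalSpace W] [IsTopologicalAddGroup W]
    [ContinuousSMul ℝ W] :
    Continuous fun x : frontier (convexHull ℝ L) => h.piecewiseLinear M x := by
  let f : ι → Set (frontier (convexHull ℝ L)) :=
    fun τ => (↑) ⁻¹' cell P (Finset.univ.image (vtx τ))
  refine LocallyFinite.continuous (f := f) ?_ ?_ (fun τ => ?_) fun τ => ?_
  · rintro ⟨p, hp⟩
    obtain ⟨U, hU, hfin⟩ := h.locallyFinite p (h.hull_subset (h.frontier_subset_hull hp)) 1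
    refine ⟨(↑) ⁻¹' U, continuous_subtype_val.continuousAt.preimage_mem_nhds hU, hfin.subset ?_⟩
    rintro τ ⟨x, hx, hxU⟩
    exact ⟨x, hxU, (h.mem_simplex.1 hx).2.le⟩
  · exact Set.eq_univ_of_forall fun x => Set.mem_iUnion.2 (h.mem_frontier_iff.1 x.2)
  · exact (isCompact_cell P _).isClosed.preimage continuous_subtype_val
  · exact ((h.chart M τ).continuous_of_finiteDimensional.comp
      continuous_subtype_val).continuousOn.congr fun x hx => h.piecewiseLinear_eq_chart M hx

end PiecewiseLinear

end IsConvexTriangulation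

/-! ### The operators `X`, `Y` and integer forms -/

/-- The linear form on `ℝ³` with the given coefficients. -/
noncomputable def form (c : Fin 3 → ℝ) : E3 →ₗ[ℝ] ℝ :=
  ∑ i, c i • (EuclideanSpace.proj i : E3 →L[ℝ] ℝ)

theorem form_apply (c : Fin 3 → ℝ) (p : E3) : form c p = c 0 * p 0 + c 1 * p 1 + c 2 * p 2 := by
  simp [form, Fin.sum_univ_three]

/-- The linear form on `ℝ³` with the given integer coefficients. -/
noncomputable def intForm (c : Fin 3 → ℤ) : E3 →ₗ[ℝ] ℝ := form fun i => c i

theorem intForm_apply (c : Fin 3 → ℤ) (p : E3) :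
    intForm c p = c 0 * p 0 + c 1 * p 1 + c 2 * p 2 := form_apply _ p

theorem act_apply (g : SL3Z) (p : E3) (i : Fin 3) :
    act g p i = (g i 0 : ℝ) * p 0 + g i 1 * p 1 + g i 2 * p 2 := by
  simp [act, Matrix.toLpLin_apply, Matrix.mulVec, dotProduct, Fin.sum_univ_three]

theorem act_mul_apply (g g' : SL3Z) (p : E3) : act (g * g') p = act g (act g' p) := by
  rw [act_mul, LinearMap.comp_apply]

theorem act_one_apply (p : E3) : act 1 p = p := by rw [act_one, LinearMap.id_apply]

theorem act_act_inv (g : SL3Z) (p : E3) : act g (act g⁻¹ p) = p := by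
  rw [← act_mul_apply, mul_inv_cancel, act_one_apply]

theorem intForm_act (c : Fin 3 → ℤ) (g : SL3Z) (p : E3) :
    intForm c (act g p) = intForm (Matrix.vecMul c (g : Matrix (Fin 3) (Fin 3) ℤ)) p := by
  simp only [intForm_apply, act_apply, Matrix.vecMul, dotProduct, Fin.sum_univ_three]
  push_cast
  ring

@[simp] theorem pt_apply_zero (x y z : ℤ) : pt x y z 0 = x := rfl
@[simp] theorem pt_apply_one (x y z : ℤ) : pt x y z 1 = y := rfl
@[simp] theorem pt_apply_two (x y z : ℤ) : pt x y z 2 = z := rfl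

theorem ext_three {p q : E3} (h0 : p 0 = q 0) (h1 : p 1 = q 1) (h2 : p 2 = q 2) : p = q :=
  PiLp.ext (Fin.forall_fin_succ.2 ⟨h0, Fin.forall_fin_two.2 ⟨h1, h2⟩⟩)

theorem pt_mem (x y z : ℤ) : pt x y z ∈ integerPoints :=
  Fin.forall_fin_succ.2 ⟨⟨x, rfl⟩, Fin.forall_fin_two.2 ⟨⟨y, rfl⟩, ⟨z, rfl⟩⟩⟩

theorem exists_eq_pt {p : E3} (hp : p ∈ integerPoints) : ∃ x y z : ℤ, p = pt x y z := by
  obtain ⟨x, hx⟩ := hp 0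
  obtain ⟨y, hy⟩ := hp 1
  obtain ⟨z, hz⟩ := hp 2
  exact ⟨x, y, z, ext_three hx hy hz⟩

theorem intForm_pt (c : Fin 3 → ℤ) (x y z : ℤ) :
    intForm c (pt x y z) = ((c 0 * x + c 1 * y + c 2 * z : ℤ) : ℝ) := by
  simp [intForm_apply]

theorem act_mem_integerPoints (g : SL3Z) {p : E3} (hp : p ∈ integerPoints) :
    act g p ∈ integerPoints := by
  obtain ⟨x, y, z, rfl⟩ := exists_eq_pt hp
  exact fun i => ⟨g i 0 * x + g i 1 * y + g i 2 * z, by simp [act_apply]⟩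

theorem opA_inv_coe (a : ℤ) : (((opA a)⁻¹ : SL3Z) : Matrix (Fin 3) (Fin 3) ℤ) =
    !![-a, 2 * a + 3, 1; 1, 0, 0; 0, 1, 0] := by
  rw [Matrix.SpecialLinearGroup.coe_inv, opA, frobeniusOp, Matrix.adjugate_fin_three_of]
  simp

theorem opA_coe (a : ℤ) : (opA a : Matrix (Fin 3) (Fin 3) ℤ) =
    !![0, 1, 0; 0, 0, 1; 1, a, -(2 * a + 3)] := by
  simp [opA, frobeniusOp]

theorem twoSubInv_coe (a : ℤ) : (twoSubInv a : Matrix (Fin 3) (Fin 3) ℤ) =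
    !![2 + a, -(2 * a + 3), -1; -1, 2, 0; 0, -1, 2] := by
  have htwo : (2 : Matrix (Fin 3) (Fin 3) ℤ) = !![2, 0, 0; 0, 2, 0; 0, 0, 2] := by decide
  change (2 : Matrix (Fin 3) (Fin 3) ℤ) - ((opA a)⁻¹ : SL3Z) = _
  rw [opA_inv_coe, htwo]
  ext i j
  fin_cases i <;> fin_cases j <;> simp

theorem act_opA_pt (a x y z : ℤ) :
    act (opA a) (pt x y z) = pt y z (x + a * y - (2 * a + 3) * z) := by
  apply ext_three <;> simp only [act_apply, opA_coe] <;> simp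
  ring

theorem act_opA_inv (a : ℤ) (p : E3) :
    act (opA a)⁻¹ p 0 = -a * p 0 + (2 * a + 3) * p 1 + p 2 ∧ act (opA a)⁻¹ p 1 = p 0 ∧
      act (opA a)⁻¹ p 2 = p 1 := by
  simp only [act_apply, opA_inv_coe]
  simp

theorem act_opA_inv_pt (a x y z : ℤ) :
    act (opA a)⁻¹ (pt x y z) = pt (-a * x + (2 * a + 3) * y + z) x y := by
  obtain ⟨h0, h1, h2⟩ := act_opA_inv a (pt x y z)
  exact ext_three (by simp [h0]) h1 h2

theorem opX_eq (a : ℤ) : opX a = (opA a)⁻¹ * (opA a)⁻¹ := by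
  rw [opX, zpow_neg, ← inv_zpow, zpow_two]

theorem opX_inv_eq (a : ℤ) : (opX a)⁻¹ = opA a * opA a := by
  rw [opX_eq, mul_inv_rev, inv_inv]

theorem act_twoSubInv (a : ℤ) (p : E3) :
    act (twoSubInv a) p = (2 : ℝ) • p - act (opA a)⁻¹ p := by
  apply ext_three <;>
    simp only [act_apply, twoSubInv_coe, PiLp.sub_apply, PiLp.smul_apply, opA_inv_coe] <;>
    simp <;> ring

theorem act_opY_eq_iff (a : ℤ) (p q : E3) : act (opY a) p = q ↔ p = act (twoSubInv a) q := by
  rw [opY]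
  constructor
  · rintro rfl; rw [act_act_inv]
  · rintro rfl; rw [act_inv_act]

theorem commute_opA_twoSubInv (a : ℤ) : Commute (opA a) (twoSubInv a) := by
  have h : Commute (opA a : Matrix (Fin 3) (Fin 3) ℤ) ((opA a)⁻¹ : SL3Z) :=
    congrArg Subtype.val (Commute.refl (opA a)).inv_right.eq
  exact Subtype.ext ((Commute.ofNat_right _ 2).sub_right h).eq

theorem commute_opA_opX (a : ℤ) : Commute (opA a) (opX a) := (Commute.refl _).zpow_right _

theorem commute_opA_opY (a : ℤ) : Commute (opA a) (opY a) := (commute_opA_twoSubInv a).inv_right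

theorem commute_opX_opY (a : ℤ) : Commute (opX a) (opY a) := (commute_opA_opY a).zpow_left _

/-- The operator `X ^ i * Y ^ j` of the period lattice. -/
def latOp (a : ℤ) (q : ℤ × ℤ) : SL3Z := opX a ^ q.1 * opY a ^ q.2

theorem latOp_zero (a : ℤ) : latOp a 0 = 1 := by simp [latOp]

theorem latOp_add (a : ℤ) (q q' : ℤ × ℤ) : latOp a (q + q') = latOp a q * latOp a q' := by
  rw [latOp, Prod.fst_add, Prod.snd_add, zpow_add, zpow_add, latOp, latOp,
    ((commute_opX_opY a).zpow_zpow q'.1 q.2).mul_mul_mul_comm]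

theorem commute_opA_latOp (a : ℤ) (q : ℤ × ℤ) : Commute (opA a) (latOp a q) :=
  ((commute_opA_opX a).zpow_right _).mul_right ((commute_opA_opY a).zpow_right _)

theorem latOp_mem_closure (a : ℤ) (q : ℤ × ℤ) :
    latOp a q ∈ Subgroup.closure {opX a, opY a} :=
  mul_mem (zpow_mem (Subgroup.subset_closure (by simp)) _)
    (zpow_mem (Subgroup.subset_closure (by simp)) _)

/-! ### Eigenforms -/

/-- The form `f` is an eigenform of the operator `g` with the eigenvalue `c`. -/
def IsEigenform (f : E3 →ₗ[ℝ] ℝ) (g : SL3Z) (c : ℝ) : Prop := ∀ p, f (act g p) = c * f p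

namespace IsEigenform

variable {f : E3 →ₗ[ℝ] ℝ} {g g' : SL3Z} {c c' : ℝ}

theorem one : IsEigenform f 1 1 := fun p => by rw [act_one_apply, one_mul]

theorem mul (h : IsEigenform f g c) (h' : IsEigenform f g' c') : IsEigenform f (g * g') (c * c') :=
  fun p => by rw [act_mul_apply, h, h', mul_assoc]

theorem inv (h : IsEigenform f g c) (hc : c ≠ 0) : IsEigenform f g⁻¹ c⁻¹ := fun p => by
  rw [eq_inv_mul_iff_mul_eq₀ hc, ← h, act_act_inv]

theorem pow (h : IsEigenform f g c) (n : ℕ) : IsEigenform f (g ^ n) (c ^ n) := by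
  induction n with
  | zero => simpa only [pow_zero] using IsEigenform.one
  | succ n ih => simpa only [pow_succ] using ih.mul h

theorem zpow (h : IsEigenform f g c) (hc : c ≠ 0) (n : ℤ) : IsEigenform f (g ^ n) (c ^ n) := by
  cases n with
  | ofNat n => simpa only [Int.ofNat_eq_natCast, zpow_natCast] using h.pow n
  | negSucc n => simpa only [zpow_negSucc] using (h.pow _).inv (pow_ne_zero _ hc)

end IsEigenform

/-- The eigenvalue of the inverse operator, as a product of two eigenvalues of the operator. -/
def mu (r : Fin 3 → ℝ) (i : Fin 3) : ℝ := r (i + 1) * r (i + 2)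

/-- The eigenform of the operator, normalized at the point `(0, 0, 1)`. -/
noncomputable def ell (r : Fin 3 → ℝ) (i : Fin 3) : E3 →ₗ[ℝ] ℝ :=
  form ![mu r i, -(r (i + 1) + r (i + 2)), 1]

theorem ell_apply (r : Fin 3 → ℝ) (i : Fin 3) (p : E3) :
    ell r i p = mu r i * p 0 - (r (i + 1) + r (i + 2)) * p 1 + p 2 := by
  simp only [ell, form_apply, Matrix.cons_val]
  ring

theorem ell_ptA (r : Fin 3 → ℝ) (i : Fin 3) : ell r i ptA = 1 := by
  simp [ell_apply, ptA]

/-- The eigenvalue of `X ^ i * Y ^ j`. -/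
noncomputable def latUnit (r : Fin 3 → ℝ) (q : ℤ × ℤ) (i : Fin 3) : ℝ :=
  (mu r i ^ 2) ^ q.1 * ((2 - mu r i)⁻¹) ^ q.2

/-- The eigenvector of the operator. -/
noncomputable def eigv (r : Fin 3 → ℝ) (i : Fin 3) : E3 := !₂[1, r i, r i ^ 2]

theorem ell_eigv (r : Fin 3 → ℝ) (i j : Fin 3) :
    ell r i (eigv r j) = (r j - r (i + 1)) * (r j - r (i + 2)) := by
  simp only [ell_apply, mu, eigv, Matrix.cons_val]
  ring

theorem ell_eigv_of_ne {r : Fin 3 → ℝ} {i j : Fin 3} (hij : j ≠ i) : ell r i (eigv r j) = 0 := by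
  have hj : j = i + 1 ∨ j = i + 2 := by decide +revert
  rcases hj with rfl | rfl <;> simp [ell_eigv]

theorem form_eigv (c r : Fin 3 → ℝ) (i : Fin 3) :
    form c (eigv r i) = c 0 + c 1 * r i + c 2 * r i ^ 2 := by
  simp [form_apply, eigv]

/-! ### The spectrum -/

/-- The three eigenvalues of the operator `A_{m,n}`, in increasing order. -/
structure IsSpectrum (a : ℤ) (r : Fin 3 → ℝ) : Prop where
  sum_eq : r 0 + r 1 + r 2 = -(2 * a + 3)
  sum_mul_eq : r 0 * r 1 + r 1 * r 2 + r 2 * r 0 = -a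
  mul_eq : r 0 * r 1 * r 2 = 1
  apply_zero_lt_neg_one : r 0 < -1
  neg_one_lt_apply_one : -1 < r 1
  apply_one_neg : r 1 < 0
  apply_two_pos : 0 < r 2

theorem vieta_of_roots {m n r s t : ℝ} (hrs : r ≠ s) (hst : s ≠ t) (hrt : r ≠ t)
    (hr : r ^ 3 + n * r ^ 2 + m * r - 1 = 0) (hs : s ^ 3 + n * s ^ 2 + m * s - 1 = 0)
    (ht : t ^ 3 + n * t ^ 2 + m * t - 1 = 0) :
    r + s + t = -n ∧ r * s + s * t + t * r = m ∧ r * s * t = 1 := by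
  have hrs' : r ^ 2 + r * s + s ^ 2 + n * (r + s) + m = 0 :=
    mul_left_cancel₀ (sub_ne_zero.2 hrs) (by linear_combination hr - hs)
  have hst' : s ^ 2 + s * t + t ^ 2 + n * (s + t) + m = 0 :=
    mul_left_cancel₀ (sub_ne_zero.2 hst) (by linear_combination hs - ht)
  have hsum : r + s + t = -n :=
    mul_left_cancel₀ (sub_ne_zero.2 hrt) (by linear_combination hrs' - hst')
  obtain rfl : n = -(r + s + t) := by rw [hsum, neg_neg]
  have hmul : r * s + s * t + t * r = m := by linear_combination -hrs'
  subst hmul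
  exact ⟨hsum, rfl, by linear_combination hr⟩

theorem exists_isSpectrum {a : ℤ} (ha : 0 ≤ a) : ∃ r : Fin 3 → ℝ, IsSpectrum a r := by
  have hA : (0 : ℝ) ≤ a := Int.cast_nonneg ha
  let f : ℝ → ℝ := fun x => x ^ 3 + (2 * a + 3) * x ^ 2 + -a * x - 1
  have hf : Continuous f := by fun_prop
  have hf₀ : f (-(2 * a + 4)) < 0 := by simp only [f]; nlinarith
  have hf₁ : 0 < f (-1) := by simp only [f]; linarith
  have hf₂ : f 0 < 0 := by simp [f]
  have hf₃ : 0 < f 1 := by simp only [f]; linarith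
  obtain ⟨x, ⟨-, hx₁⟩, hx⟩ :=
    intermediate_value_Ioo (by linarith : -(2 * a + 4 : ℝ) ≤ -1) hf.continuousOn ⟨hf₀, hf₁⟩
  obtain ⟨y, ⟨hy₁, hy₀⟩, hy⟩ :=
    intermediate_value_Ioo' (by norm_num : (-1 : ℝ) ≤ 0) hf.continuousOn ⟨hf₂, hf₁⟩
  obtain ⟨z, ⟨hz₀, -⟩, hz⟩ :=
    intermediate_value_Ioo (zero_le_one : (0 : ℝ) ≤ 1) hf.continuousOn ⟨hf₂, hf₃⟩
  obtain ⟨hsum, hsum_mul, hmul⟩ :=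
    vieta_of_roots (hx₁.trans hy₁).ne (hy₀.trans hz₀).ne (by linarith) hx hy hz
  exact ⟨![x, y, z], hsum, hsum_mul, hmul, hx₁, hy₁, hy₀, hz₀⟩

namespace IsSpectrum

variable {a : ℤ} {r : Fin 3 → ℝ} (h : IsSpectrum a r)

include h

theorem prod_sub (x : ℝ) :
    (x - r 0) * (x - r 1) * (x - r 2) = x ^ 3 + (2 * a + 3) * x ^ 2 - a * x - 1 := by
  linear_combination -x ^ 2 * h.sum_eq + x * h.sum_mul_eq - h.mul_eq

theorem nonneg : 0 ≤ a := by
  have hval := h.prod_sub (-1)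
  have hpos : 0 < (-1 - r 0) * (-1 - r 1) * (-1 - r 2) :=
    mul_pos_of_neg_of_neg
      (mul_neg_of_pos_of_neg (by linarith [h.apply_zero_lt_neg_one])
        (by linarith [h.neg_one_lt_apply_one]))
      (by linarith [h.apply_two_pos])
  have hA : (0 : ℝ) < 3 * a + 1 := by linarith
  have : 0 < 3 * a + 1 := by exact_mod_cast hA
  omega

theorem cast_nonneg : (0 : ℝ) ≤ a := Int.cast_nonneg h.nonneg

theorem strictMono : StrictMono r :=
  Fin.strictMono_iff_lt_succ.2 <| Fin.forall_fin_two.2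
    ⟨h.apply_zero_lt_neg_one.trans h.neg_one_lt_apply_one, h.apply_one_neg.trans h.apply_two_pos⟩

theorem apply_zero_lt : r 0 < -5 / 2 := by
  have hA := h.cast_nonneg
  have hval := h.prod_sub (-5 / 2)
  have hneg : (-5 / 2 - r 1) * (-5 / 2 - r 2) > 0 :=
    mul_pos_of_neg_of_neg (by linarith [h.neg_one_lt_apply_one]) (by linarith [h.apply_two_pos])
  have hmul : 0 < (-5 / 2 - r 0) * ((-5 / 2 - r 1) * (-5 / 2 - r 2)) := by
    rw [← mul_assoc, hval]
    linarith
  exact sub_pos.1 (pos_of_mul_pos_left hmul hneg.le)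

theorem lt_apply_two : 1 / 2 < r 2 := by
  have hval := h.prod_sub (1 / 2)
  have hpos : 0 < (1 / 2 - r 0) * (1 / 2 - r 1) :=
    mul_pos (by linarith [h.apply_zero_lt_neg_one]) (by linarith [h.apply_one_neg])
  refine sub_neg.1 (neg_of_mul_neg_right (a := (1 / 2 - r 0) * (1 / 2 - r 1)) ?_ hpos.le)
  rw [hval]
  linarith

theorem apply_two_lt : r 2 < 10 / 17 := by
  have hA := h.cast_nonneg
  have hval := h.prod_sub (10 / 17)
  have hpos : 0 < (10 / 17 - r 0) * (10 / 17 - r 1) :=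
    mul_pos (by linarith [h.apply_zero_lt_neg_one]) (by linarith [h.apply_one_neg])
  refine sub_pos.1 (pos_of_mul_pos_right (a := (10 / 17 - r 0) * (10 / 17 - r 1)) ?_ hpos.le)
  rw [hval]
  linarith

theorem apply_one_root : r 1 ^ 3 + (2 * a + 3) * r 1 ^ 2 - a * r 1 - 1 = 0 := by
  rw [← h.prod_sub, sub_self, mul_zero, zero_mul]

theorem neg_one_lt_add_one_mul_apply_one : -1 < (a + 1) * r 1 := by
  have hpos : 0 < (1 - 2 * r 1) * ((a + 1) * r 1 + 1) := by
    calc 0 < r 1 * (r 1 ^ 2 + r 1 - 1) :=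
          mul_pos_of_neg_of_neg h.apply_one_neg
            (by nlinarith [h.apply_one_neg, h.neg_one_lt_apply_one])
      _ = (1 - 2 * r 1) * ((a + 1) * r 1 + 1) := by linear_combination h.apply_one_root
  linarith [pos_of_mul_pos_right hpos (by linarith [h.apply_one_neg])]

theorem add_two_mul_apply_one_lt : (a + 2) * r 1 < -1 := by
  have hneg : (1 - 2 * r 1) * ((a + 2) * r 1 + 1) < 0 := by
    calc (1 - 2 * r 1) * ((a + 2) * r 1 + 1) = r 1 ^ 2 * (r 1 - 1) := by
          linear_combination -h.apply_one_root
      _ < 0 := mul_neg_of_pos_of_neg (sq_pos_of_neg h.apply_one_neg) (by linarith [h.apply_one_neg])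
  linarith [neg_of_mul_neg_right hneg (by linarith [h.apply_one_neg])]

theorem sum_cyc (i : Fin 3) : r i + r (i + 1) + r (i + 2) = -(2 * a + 3) := by
  have := h.sum_eq
  fin_cases i <;> simp <;> linarith

theorem sum_mul_cyc (i : Fin 3) : r i * (r (i + 1) + r (i + 2)) + mu r i = -a := by
  have := h.sum_mul_eq
  fin_cases i <;> simp [mu] <;> linarith

theorem mul_mu (i : Fin 3) : r i * mu r i = 1 := by
  have := h.mul_eq
  fin_cases i <;> simp [mu] <;> linarith

theorem mu_ne_zero (i : Fin 3) : mu r i ≠ 0 := right_ne_zero_of_mul_eq_one (h.mul_mu i)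

theorem mu_root (i : Fin 3) : mu r i ^ 3 + a * mu r i ^ 2 - (2 * a + 3) * mu r i - 1 = 0 := by
  linear_combination mu r i ^ 2 * h.sum_mul_cyc i - mu r i * h.sum_cyc i +
    (1 - mu r i * (r (i + 1) + r (i + 2))) * h.mul_mu i

theorem eigenform_opA_inv (i : Fin 3) : IsEigenform (ell r i) (opA a)⁻¹ (mu r i) := fun p => by
  obtain ⟨h0, h1, h2⟩ := act_opA_inv a p
  rw [ell_apply, ell_apply, h0, h1, h2]
  linear_combination (mu r i * p 1) * h.sum_cyc i - (mu r i * p 0) * h.sum_mul_cyc i +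
    ((r (i + 1) + r (i + 2)) * p 0 - p 1) * h.mul_mu i

theorem eigenform_opA (i : Fin 3) : IsEigenform (ell r i) (opA a) (r i) := by
  rw [eq_inv_of_mul_eq_one_left (h.mul_mu i), ← inv_inv (opA a)]
  exact (h.eigenform_opA_inv i).inv (h.mu_ne_zero i)

theorem eigenform_twoSubInv (i : Fin 3) : IsEigenform (ell r i) (twoSubInv a) (2 - mu r i) :=
  fun p => by
    rw [act_twoSubInv, map_sub, map_smul, h.eigenform_opA_inv i p, smul_eq_mul, sub_mul]

theorem mu_zero_neg : mu r 0 < 0 := mul_neg_of_neg_of_pos h.apply_one_neg h.apply_two_pos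

theorem neg_lt_mu_zero : -(2 / 5) < mu r 0 := by
  nlinarith [h.mul_mu 0, h.apply_zero_lt]

theorem mu_one_lt : mu r 1 < -1 := by
  nlinarith [h.mul_mu 1, h.neg_one_lt_apply_one, h.apply_one_neg]

theorem lt_mu_two : 17 / 10 < mu r 2 := by
  nlinarith [h.mul_mu 2, h.apply_two_lt, h.lt_apply_two]

theorem mu_two_lt : mu r 2 < 2 := by
  nlinarith [h.mul_mu 2, h.lt_apply_two]

theorem two_sub_mu_pos (i : Fin 3) : 0 < 2 - mu r i := by
  have h0 := h.mu_zero_neg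
  have h1 := h.mu_one_lt
  have h2 := h.mu_two_lt
  fin_cases i <;> simp <;> linarith

theorem latUnit_pos (q : ℤ × ℤ) (i : Fin 3) : 0 < latUnit r q i :=
  mul_pos (zpow_pos (sq_pos_of_ne_zero (h.mu_ne_zero i)) _)
    (zpow_pos (inv_pos.2 (h.two_sub_mu_pos i)) _)

theorem latUnit_add (q q' : ℤ × ℤ) (i : Fin 3) :
    latUnit r (q + q') i = latUnit r q i * latUnit r q' i := by
  rw [latUnit, Prod.fst_add, Prod.snd_add, zpow_add₀ (pow_ne_zero _ (h.mu_ne_zero i)),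
    zpow_add₀ (inv_ne_zero (h.two_sub_mu_pos i).ne'), mul_mul_mul_comm, latUnit, latUnit]

theorem latUnit_nsmul (n : ℕ) (q : ℤ × ℤ) (i : Fin 3) :
    latUnit r (n • q) i = latUnit r q i ^ n := by
  induction n with
  | zero => simp [latUnit]
  | succ n ih => rw [succ_nsmul, h.latUnit_add, ih, pow_succ]

theorem eigenform_latOp (q : ℤ × ℤ) (i : Fin 3) :
    IsEigenform (ell r i) (latOp a q) (latUnit r q i) := by
  have hX : IsEigenform (ell r i) (opX a) (mu r i ^ 2) := by
    rw [opX_eq, pow_two]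
    exact (h.eigenform_opA_inv i).mul (h.eigenform_opA_inv i)
  have hY : IsEigenform (ell r i) (opY a) (2 - mu r i)⁻¹ :=
    (h.eigenform_twoSubInv i).inv (h.two_sub_mu_pos i).ne'
  exact (hX.zpow (pow_ne_zero _ (h.mu_ne_zero i)) _).mul
    (hY.zpow (inv_ne_zero (h.two_sub_mu_pos i).ne') _)

theorem ell_eigv_self_ne_zero (i : Fin 3) : ell r i (eigv r i) ≠ 0 := by
  rw [ell_eigv]
  exact mul_ne_zero (sub_ne_zero.2 (h.strictMono.injective.ne (by decide +revert)))
    (sub_ne_zero.2 (h.strictMono.injective.ne (by decide +revert)))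

theorem ext_ell {p q : E3} (hpq : ∀ i, ell r i p = ell r i q) : p = q := by
  have h01 : r 0 - r 1 ≠ 0 := sub_ne_zero.2 (h.strictMono.injective.ne (by decide))
  have h12 : r 1 - r 2 ≠ 0 := sub_ne_zero.2 (h.strictMono.injective.ne (by decide))
  have h02 : r 0 - r 2 ≠ 0 := sub_ne_zero.2 (h.strictMono.injective.ne (by decide))
  have e0 := hpq 0
  have e1 := hpq 1
  have e2 := hpq 2
  simp only [ell_apply, mu, Fin.isValue, Fin.reduceAdd, zero_add] at e0 e1 e2
  have f1 : r 2 * (p 0 - q 0) - (p 1 - q 1) = 0 :=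
    mul_left_cancel₀ h01 (by linear_combination e1 - e0)
  have f2 : r 0 * (p 0 - q 0) - (p 1 - q 1) = 0 :=
    mul_left_cancel₀ h12 (by linear_combination e2 - e1)
  have g0 : p 0 - q 0 = 0 := mul_left_cancel₀ h02 (by linear_combination f2 - f1)
  have g1 : p 1 - q 1 = 0 := by linear_combination -f1 + r 2 * g0
  exact ext_three (sub_eq_zero.1 g0) (sub_eq_zero.1 g1)
    (by linear_combination e0 - r 1 * r 2 * g0 + (r 1 + r 2) * g1)

theorem eq_zero_of_latUnit_eq_one {q : ℤ × ℤ} (hq : ∀ i, latUnit r q i = 1) : q = 0 := by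
  have e0 := hq 0
  have e1 := hq 1
  rw [latUnit, inv_zpow, mul_inv_eq_one₀ (zpow_ne_zero _ (h.two_sub_mu_pos _).ne')] at e0 e1
  have a0 : mu r 0 ^ 2 < 1 := by nlinarith [h.mu_zero_neg, h.neg_lt_mu_zero]
  have a0' : 0 < mu r 0 ^ 2 := sq_pos_of_neg h.mu_zero_neg
  have a1 : 1 < mu r 1 ^ 2 := by nlinarith [h.mu_one_lt]
  have c0 : 1 < 2 - mu r 0 := by linarith [h.mu_zero_neg]
  have c1 : 1 < 2 - mu r 1 := by linarith [h.mu_one_lt]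
  -- `μ₀ ^ 2 < 1 < μ₁ ^ 2`, while `2 - μ₀` and `2 - μ₁` are both greater than one
  have hfst : q.1 = 0 := by
    rcases lt_trichotomy q.1 0 with hlt | heq | hgt
    · have h0 := one_lt_zpow_of_neg₀ a0' a0 hlt
      have h1 := zpow_lt_one_of_neg₀ a1 hlt
      rw [e0, one_lt_zpow_iff_right₀ c0] at h0
      rw [e1, zpow_lt_one_iff_right₀ c1] at h1
      exact absurd h0 h1.not_gt
    · exact heq
    · have h0 := zpow_lt_one₀ a0' a0 hgt
      have h1 := one_lt_zpow₀ a1 hgt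
      rw [e0, zpow_lt_one_iff_right₀ c0] at h0
      rw [e1, one_lt_zpow_iff_right₀ c1] at h1
      exact absurd h0 h1.not_gt
  rw [hfst, zpow_zero, eq_comm, zpow_eq_one_iff_right₀ (by linarith) c0.ne'] at e0
  exact Prod.ext hfst e0

theorem exists_contracting (i : Fin 3) : ∃ e : ℤ × ℤ, ∀ j, j ≠ i → latUnit r e j < 1 := by
  have h0 := h.mu_zero_neg
  have h0' := h.neg_lt_mu_zero
  have h1 := h.mu_one_lt
  have h2 := h.lt_mu_two
  have h2' := h.mu_two_lt
  have hX₁ : 1 < mu r 1 ^ 2 := by nlinarith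
  have hX₂ : 1 < mu r 2 ^ 2 := by nlinarith
  have hXY₀ : mu r 0 ^ 2 * (2 - mu r 0) < 1 := by nlinarith
  have hXY₂ : mu r 2 ^ 2 * (2 - mu r 2) < 1 := by nlinarith [mul_pos (sub_pos.2 h2) (sub_pos.2 h2')]
  have hY₀ : 1 < 2 - mu r 0 := by linarith
  have hY₁ : 1 < 2 - mu r 1 := by linarith
  fin_cases i
  · have hX := fun j => inv_lt_one_of_one_lt₀ (a := mu r j ^ 2)
    exact ⟨(-1, 0), by simpa [Fin.forall_fin_succ, latUnit] using ⟨hX 1 hX₁, hX 2 hX₂⟩⟩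
  · exact ⟨(1, -1), by simpa [Fin.forall_fin_succ, latUnit] using ⟨hXY₀, hXY₂⟩⟩
  · have hY := fun j => inv_lt_one_of_one_lt₀ (a := 2 - mu r j)
    exact ⟨(0, 1), by simpa [Fin.forall_fin_succ, latUnit] using ⟨hY 0 hY₀, hY 1 hY₁⟩⟩

end IsSpectrum

/-! ### The orthant of positive eigenforms -/

/-- The open orthant on which all eigenforms are positive. -/
def orthant (r : Fin 3 → ℝ) : Set E3 := {p | ∀ i, 0 < ell r i p}

/-- The integer points generating the hull of an orthant. -/
def generators (O : Set E3) : Set E3 := (closure O ∩ integerPoints) \ {0}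

/-- The form `f` is a combination of the eigenforms with positive coefficients. -/
def IsPositive (r : Fin 3 → ℝ) (f : E3 →ₗ[ℝ] ℝ) : Prop :=
  ∃ w : Fin 3 → ℝ, (∀ i, 0 < w i) ∧ ∀ p, f p = ∑ i, w i * ell r i p

theorem isOpen_orthant (r : Fin 3 → ℝ) : IsOpen (orthant r) := by
  simp only [orthant, Set.ofPred_forall]
  exact isOpen_iInter_of_finite fun i =>
    isOpen_lt continuous_const (ell r i).continuous_of_finiteDimensional

section

variable {r : Fin 3 → ℝ} {p : E3}

theorem ell_nonneg_of_mem_closure (hp : p ∈ closure (orthant r)) (i : Fin 3) : 0 ≤ ell r i p :=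
  closure_minimal (fun _ hq => (hq i).le)
    (isClosed_le continuous_const (ell r i).continuous_of_finiteDimensional) hp

theorem ptA_mem_orthant (r : Fin 3 → ℝ) : ptA ∈ orthant r := fun i =>
  (ell_ptA r i).symm ▸ zero_lt_one

theorem ne_zero_of_mem_orthant (hp : p ∈ orthant r) : p ≠ 0 := by
  rintro rfl
  exact (hp 0).ne' (map_zero _)

theorem mem_generators (hp : p ∈ orthant r) (hp' : p ∈ integerPoints) :
    p ∈ generators (orthant r) :=
  ⟨⟨subset_closure hp, hp'⟩, ne_zero_of_mem_orthant hp⟩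

theorem natCast_smul_mem_generators (hp : p ∈ generators (orthant r)) {n : ℕ} (hn : n ≠ 0) :
    (n : ℝ) • p ∈ generators (orthant r) := by
  have hn' : (0 : ℝ) < n := Nat.cast_pos.2 (Nat.pos_of_ne_zero hn)
  refine ⟨⟨map_mem_closure (continuous_const_smul (n : ℝ)) hp.1.1 fun x hx i => ?_, fun i => ?_⟩,
    smul_ne_zero hn'.ne' hp.2⟩
  · rw [map_smul]
    exact mul_pos hn' (hx i)
  · obtain ⟨k, hk⟩ := hp.1.2 i
    exact ⟨n * k, by simp [hk]⟩

theorem mem_orthant_of_eigenform {g : SL3Z} {u : Fin 3 → ℝ}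
    (hg : ∀ i, IsEigenform (ell r i) g (u i)) (hu : ∀ i, 0 < u i) (hp : p ∈ orthant r) :
    act g p ∈ orthant r := fun i => by
  rw [hg i p]
  exact mul_pos (hu i) (hp i)

theorem IsPositive.apply_pos {f : E3 →ₗ[ℝ] ℝ} (hf : IsPositive r f) (hp : p ∈ orthant r) :
    0 < f p := by
  obtain ⟨w, hw, hf⟩ := hf
  rw [hf]
  exact Finset.sum_pos (fun i _ => mul_pos (hw i) (hp i)) Finset.univ_nonempty

end

theorem finite_setOf_intForm_le (p : E3) {ε : ℝ} (hε : 0 < ε) (C : ℝ) :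
    {c : Fin 3 → ℤ | (∀ x ∈ Metric.ball p ε, 0 < intForm c x) ∧
      ∃ p' ∈ Metric.ball p (ε / 2), intForm c p' ≤ C}.Finite := by
  have hε' : 0 < ε / 2 := half_pos hε
  set N : ℤ := ⌈C / (ε / 2)⌉
  refine (Set.finite_Icc (fun _ => -N) fun _ => N).subset ?_
  rintro c ⟨hpos, p', hp', hC⟩
  have hmove (k : Fin 3) (s : ℝ) (hs : |s| = ε / 2) : 0 ≤ C + s * (c k : ℝ) := by
    have hx : p' + s • EuclideanSpace.single k (1 : ℝ) ∈ Metric.ball p ε := by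
      calc dist (p' + s • EuclideanSpace.single k (1 : ℝ)) p
          ≤ dist (p' + s • EuclideanSpace.single k (1 : ℝ)) p' + dist p' p := dist_triangle _ _ _
        _ < ε / 2 + ε / 2 := add_lt_add_of_le_of_lt (by simp [norm_smul, hs]) hp'
        _ = ε := add_halves ε
    have hsingle : intForm c (EuclideanSpace.single k (1 : ℝ)) = c k := by
      fin_cases k <;> simp [intForm_apply]
    have := hpos _ hx
    rw [map_add, map_smul, hsingle, smul_eq_mul] at this
    linarith
  have hceil {n : ℤ} (hn : n * (ε / 2) ≤ C) : n ≤ N :=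
    Int.cast_le.1 (((le_div_iff₀ hε').2 hn).trans (Int.le_ceil _))
  refine ⟨fun k => neg_le.1 (hceil ?_), fun k => hceil ?_⟩
  · push_cast
    linarith [hmove k (ε / 2) (abs_of_pos hε')]
  · linarith [hmove k (-(ε / 2)) (by rw [abs_neg, abs_of_pos hε'])]

namespace IsSpectrum

variable {a : ℤ} {r : Fin 3 → ℝ} (h : IsSpectrum a r) {f : E3 →ₗ[ℝ] ℝ} {p : E3}

include h

theorem act_latOp_mem_orthant (q : ℤ × ℤ) (hp : p ∈ orthant r) : act (latOp a q) p ∈ orthant r :=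
  mem_orthant_of_eigenform (h.eigenform_latOp q) (h.latUnit_pos q) hp

theorem ell_ptE (i : Fin 3) : ell r i ptE = mu r i ^ 2 * (2 + a + mu r i) := by
  simp only [ell_apply, ptE, pt_apply_zero, pt_apply_one, pt_apply_two]
  push_cast
  have hr : r (i + 1) + r (i + 2) = -(mu r i) * (a + mu r i) := by
    linear_combination mu r i * h.sum_mul_cyc i - (r (i + 1) + r (i + 2)) * h.mul_mu i
  linear_combination -2 * hr - h.mu_root i

theorem ptE_mem_orthant : ptE ∈ orthant r := fun i => by
  rw [h.ell_ptE]
  refine mul_pos (sq_pos_of_ne_zero (h.mu_ne_zero i)) ?_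
  have hA := h.cast_nonneg
  have h0 : 0 < 2 + a + mu r 0 := by linarith [h.neg_lt_mu_zero]
  have h1 : 0 < 2 + a + mu r 1 := pos_of_mul_neg_right (a := r 1)
    (by linarith [h.mul_mu 1, h.add_two_mul_apply_one_lt]) h.apply_one_neg.le
  have h2 : 0 < 2 + a + mu r 2 := by linarith [h.lt_mu_two]
  fin_cases i <;> assumption

theorem sum_smul_eigv (p : E3) :
    ∑ i, (ell r i p / ell r i (eigv r i)) • eigv r i = p := by
  refine h.ext_ell fun j => ?_
  rw [map_sum, Finset.sum_eq_single j (fun i _ hi => by rw [map_smul, ell_eigv_of_ne hi, smul_zero])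
    (by simp), map_smul, smul_eq_mul, div_mul_cancel₀ _ (h.ell_eigv_self_ne_zero j)]

theorem isPositive (h0 : 0 < f (eigv r 0)) (h1 : f (eigv r 1) < 0) (h2 : 0 < f (eigv r 2)) :
    IsPositive r f := by
  have h01 : r 0 < r 1 := h.strictMono (by decide)
  have h12 : r 1 < r 2 := h.strictMono (by decide)
  refine ⟨fun i => f (eigv r i) / ell r i (eigv r i), Fin.forall_fin_succ.2
    ⟨?_, Fin.forall_fin_two.2 ⟨?_, ?_⟩⟩, fun p => ?_⟩
  · exact div_pos h0 (ell_eigv r 0 0 ▸ mul_pos_of_neg_of_neg (sub_neg.2 h01)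
      (sub_neg.2 (h01.trans h12)))
  · exact div_pos_of_neg_of_neg h1 (ell_eigv r 1 1 ▸ mul_neg_of_neg_of_pos (sub_neg.2 h12)
      (sub_pos.2 h01))
  · exact div_pos h2 (ell_eigv r 2 2 ▸ mul_pos (sub_pos.2 (h01.trans h12)) (sub_pos.2 h12))
  · conv_lhs => rw [← h.sum_smul_eigv p, map_sum]
    exact Finset.sum_congr rfl fun i _ => by rw [map_smul, smul_eq_mul]; ring

theorem mem_orthant_of_forall_le (hf : IsPositive r f) {d : ℝ} (hd : 0 < d)
    (hp : ∀ q, d ≤ f (act (latOp a q) p)) : p ∈ orthant r := by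
  obtain ⟨w, hw, hf⟩ := hf
  intro i
  by_contra! hi
  -- a nonpositive eigenform is compensated by the two other ones, which an operator contracts
  obtain ⟨e, he⟩ := h.exists_contracting i
  have hlim : Filter.Tendsto (fun n : ℕ => ∑ j ∈ Finset.univ.erase i,
      w j * (latUnit r e j ^ n * ell r j p)) Filter.atTop (nhds 0) := by
    rw [show (0 : ℝ) = ∑ j ∈ Finset.univ.erase i, w j * (0 * ell r j p) by simp]
    exact tendsto_finsetSum _ fun j hj => ((tendsto_pow_atTop_nhds_zero_of_lt_one
      (h.latUnit_pos e j).le (he j (Finset.ne_of_mem_erase hj))).mul_const _).const_mul _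
  obtain ⟨n, hn⟩ := (hlim.eventually (gt_mem_nhds hd)).exists
  have hle : w i * (latUnit r e i ^ n * ell r i p) ≤ 0 :=
    mul_nonpos_of_nonneg_of_nonpos (hw i).le
      (mul_nonpos_of_nonneg_of_nonpos (pow_pos (h.latUnit_pos e i) n).le hi)
  have hge := hp (n • e)
  rw [hf, ← Finset.add_sum_erase _ _ (Finset.mem_univ i)] at hge
  simp only [h.eigenform_latOp _ _ p, h.latUnit_nsmul] at hge
  linarith

theorem translate_injective (hf : IsPositive r f) :
    Function.Injective fun q => f ∘ₗ act (latOp a q) := by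
  obtain ⟨w, hw, hf⟩ := hf
  intro q q' hq
  have hval (q : ℤ × ℤ) (i : Fin 3) : f (act (latOp a q) (eigv r i)) =
      w i * (latUnit r q i * ell r i (eigv r i)) := by
    rw [hf, Finset.sum_eq_single i (fun j _ hj => by
      rw [h.eigenform_latOp, ell_eigv_of_ne hj.symm, mul_zero, mul_zero]) (by simp),
      h.eigenform_latOp]
  have hunit (i : Fin 3) : latUnit r q i = latUnit r q' i := by
    have := LinearMap.congr_fun hq (eigv r i)
    simp only [LinearMap.comp_apply, hval] at this
    exact mul_right_cancel₀ (h.ell_eigv_self_ne_zero i) (mul_left_cancel₀ (hw i).ne' this)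
  refine sub_eq_zero.1 (h.eq_zero_of_latUnit_eq_one fun i => ?_)
  refine (mul_eq_right₀ (h.latUnit_pos q' i).ne').1 ?_
  rw [← h.latUnit_add, sub_add_cancel, hunit]

theorem exists_nhds_finite_translates {c : Fin 3 → ℤ} (hc : IsPositive r (intForm c))
    (hp : p ∈ orthant r) (C : ℝ) :
    ∃ U ∈ nhds p, {q | ∃ p' ∈ U, intForm c (act (latOp a q) p') ≤ C}.Finite := by
  obtain ⟨ε, hε, hball⟩ := Metric.isOpen_iff.1 (isOpen_orthant r) p hp
  let m : ℤ × ℤ → Fin 3 → ℤ := fun q => Matrix.vecMul c (latOp a q : Matrix (Fin 3) (Fin 3) ℤ)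
  have hm (q : ℤ × ℤ) (x : E3) : intForm (m q) x = intForm c (act (latOp a q) x) :=
    (intForm_act _ _ _).symm
  have hinj : Function.Injective m := fun q q' hq => h.translate_injective hc <|
    LinearMap.ext fun x => by simp only [LinearMap.comp_apply, ← hm, hq]
  refine ⟨Metric.ball p (ε / 2), Metric.ball_mem_nhds _ (half_pos hε),
    ((finite_setOf_intForm_le p hε C).preimage hinj.injOn).subset ?_⟩
  rintro q ⟨p', hp', hC⟩
  exact ⟨fun x hx => (hm q x).symm ▸ hc.apply_pos (h.act_latOp_mem_orthant q (hball hx)),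
    p', hp', (hm q p').symm ▸ hC⟩

theorem one_le_of_isPositive {c : Fin 3 → ℤ} (hc : IsPositive r (intForm c)) {x y z : ℤ}
    (hp : ∀ i, 0 ≤ ell r i (pt x y z)) (hne : pt x y z ≠ 0) :
    1 ≤ c 0 * x + c 1 * y + c 2 * z := by
  obtain ⟨w, hw, hf⟩ := hc
  obtain ⟨i, hi⟩ : ∃ i, ell r i (pt x y z) ≠ 0 := by
    by_contra! hz
    exact hne (h.ext_ell fun i => by rw [hz i, map_zero])
  have hpos : 0 < intForm c (pt x y z) := by
    rw [hf]
    exact Finset.sum_pos' (fun j _ => mul_nonneg (hw j).le (hp j))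
      ⟨i, Finset.mem_univ _, mul_pos (hw i) ((hp i).lt_of_ne' hi)⟩
  rw [intForm_pt] at hpos
  exact Int.cast_pos.1 hpos

end IsSpectrum

/-! ### Orbits of labelled triangles -/

/-- Labels of the vertices: the class of a vertex (`false` for the class of `A`, `true` for the
class of `E`) together with the exponents of the operator that maps `A` or `E` to it. -/
abbrev Label : Type := Bool × ℤ × ℤ

/-- The representative of a class of vertices. -/
noncomputable def baseVertex (c : Bool) : E3 := bif c then ptE else ptA

/-- The vertex with the given label. -/
noncomputable def vert (a : ℤ) (v : Label) : E3 := act (latOp a v.2) (baseVertex v.1)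

/-- Translation of labels. -/
def shift (q : ℤ × ℤ) (v : Label) : Label := (v.1, v.2 + q)

theorem act_latOp_vert (a : ℤ) (q : ℤ × ℤ) (v : Label) :
    act (latOp a q) (vert a v) = vert a (shift q v) := by
  rw [vert, vert, shift, ← act_mul_apply, ← latOp_add, add_comm]

theorem shift_zero (v : Label) : shift 0 v = v := by simp [shift]

theorem shift_shift (q q' : ℤ × ℤ) (v : Label) : shift q (shift q' v) = shift (q' + q) v := by
  simp [shift, add_assoc]

theorem vert_mem_integerPoints (a : ℤ) (v : Label) : vert a v ∈ integerPoints := by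
  refine act_mem_integerPoints _ ?_
  rcases v with ⟨_ | _, -⟩ <;> exact pt_mem _ _ _

/-- The matrix of an operator commuting with `A_{m,n}⁻¹` is determined by its last column. For the
column `E` its determinant is `a + 3`. -/
theorem act_ptA_ne_ptE {a : ℤ} (ha : a ≠ -2) {g : SL3Z} (hg : Commute g (opA a)) :
    act g ptA ≠ ptE := by
  intro hE
  have hcol (i : Fin 3) : (g i 2 : ℝ) = ptE i := by
    simp only [← hE, act_apply, ptA, pt_apply_zero, pt_apply_one, pt_apply_two]
    simp
  have e02 : g 0 2 = 3 := Int.cast_injective (hcol 0)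
  have e12 : g 1 2 = 2 := Int.cast_injective (hcol 1)
  have e22 : g 2 2 = 1 := Int.cast_injective (hcol 2)
  have hcomm (i j : Fin 3) := congrFun (congrFun (congrArg Subtype.val hg.inv_right.eq) i) j
  simp only [Matrix.SpecialLinearGroup.coe_mul, opA_inv_coe, Matrix.mul_apply,
    Fin.sum_univ_three] at hcomm
  have e00 : g 0 0 = a + 7 := by
    have := hcomm 0 2
    simp [e02, e12, e22] at this
    linarith
  have e10 : g 1 0 = 3 := by simpa [e02] using hcomm 1 2
  have e20 : g 2 0 = 2 := by simpa [e12] using hcomm 2 2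
  have e01 : g 0 1 = 6 * a + 11 := by
    have := hcomm 1 1
    simp [e10, e12] at this
    linarith
  have e11 : g 1 1 = 4 * a + 7 := by
    have := hcomm 2 1
    simp [e20, e22] at this
    linarith
  have e21 : g 2 1 = 2 * a + 3 := by
    have := hcomm 2 0
    simp [e20, e10] at this
    linarith
  have hdet := g.det_coe
  rw [Matrix.det_fin_three, e00, e01, e02, e10, e11, e12, e20, e21, e22] at hdet
  exact ha (by linarith)

namespace IsSpectrum

variable {a : ℤ} {r : Fin 3 → ℝ} (h : IsSpectrum a r)

include h

theorem vert_mem_orthant (v : Label) : vert a v ∈ orthant r := by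
  refine h.act_latOp_mem_orthant _ ?_
  rcases v with ⟨_ | _, -⟩
  exacts [ptA_mem_orthant r, h.ptE_mem_orthant]

theorem eq_zero_of_act_latOp_eq {q : ℤ × ℤ} {p : E3} (hp : p ∈ orthant r)
    (hq : act (latOp a q) p = p) : q = 0 :=
  h.eq_zero_of_latUnit_eq_one fun i => (mul_eq_right₀ (hp i).ne').1 <| by
    rw [← h.eigenform_latOp q i p, hq]

theorem vert_injective : Function.Injective (vert a) := by
  have hA : a ≠ -2 := by have := h.nonneg; omega
  have hAE (q q' : ℤ × ℤ) : vert a (false, q) ≠ vert a (true, q') := fun hv => by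
    refine act_ptA_ne_ptE hA (commute_opA_latOp a (-q' + q)).symm ?_
    rw [latOp_add, act_mul_apply]
    refine (congrArg (act (latOp a (-q'))) hv).trans ?_
    rw [vert, ← act_mul_apply, ← latOp_add, neg_add_cancel, latOp_zero, act_one_apply]
    rfl
  have hsame (c : Bool) (q q' : ℤ × ℤ) (hv : vert a (c, q) = vert a (c, q')) : q = q' := by
    refine sub_eq_zero.1 (h.eq_zero_of_act_latOp_eq (h.vert_mem_orthant (c, q')) ?_)
    rw [act_latOp_vert, ← hv, shift, add_sub_cancel]
  rintro ⟨_ | _, q⟩ ⟨_ | _, q'⟩ hv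
  · rw [hsame _ q q' hv]
  · exact absurd hv (hAE _ _)
  · exact absurd hv.symm (hAE _ _)
  · rw [hsame _ q q' hv]

end IsSpectrum

/-- Triangles with labelled vertices, in the planes `f = d`, which together with their translates
support the hull and meet at convex angles. -/
structure IsFundamentalData {T : Type*} (a : ℤ) (r : Fin 3 → ℝ) (lab : T → Fin 3 → Label)
    (f : T → Fin 3 → ℤ) (d : T → ℤ) : Prop where
  pos : ∀ t, 0 < d t
  isPositive : ∀ t, IsPositive r (intForm (f t))
  le : ∀ t (x y z : ℤ), (∀ i, 0 ≤ ell r i (pt x y z)) → pt x y z ≠ 0 →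
    d t ≤ f t 0 * x + f t 1 * y + f t 2 * z
  height : ∀ t k, intForm (f t) (vert a (lab t k)) = d t
  adjacent : ∀ t k, ∃ t' q, (∀ l, l ≠ k → intForm (f t') (vert a (shift q (lab t l))) = d t') ∧
    d t' < intForm (f t') (vert a (shift q (lab t k)))
  linearIndependent : ∀ t, LinearIndependent ℝ (fun k => vert a (lab t k))

/-- The vertices of the translates of the triangles. -/
def shiftVtx {T : Type*} (lab : T → Fin 3 → Label) (τ : T × ℤ × ℤ) (k : Fin 3) : Label :=
  shift τ.2 (lab τ.1 k)

/-- The form that is equal to one on a translate of a triangle. -/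
noncomputable def heightForm {T : Type*} (a : ℤ) (f : T → Fin 3 → ℤ) (d : T → ℤ) (τ : T × ℤ × ℤ) :
    E3 →ₗ[ℝ] ℝ :=
  ((d τ.1 : ℝ)⁻¹) • (intForm (f τ.1) ∘ₗ act (latOp a (-τ.2)))

theorem heightForm_apply {T : Type*} (a : ℤ) (f : T → Fin 3 → ℤ) (d : T → ℤ) (τ : T × ℤ × ℤ)
    (p : E3) : heightForm a f d τ p = intForm (f τ.1) (act (latOp a (-τ.2)) p) / d τ.1 :=
  (div_eq_inv_mul _ _).symm

theorem heightForm_vert {T : Type*} (a : ℤ) (f : T → Fin 3 → ℤ) (d : T → ℤ) (τ : T × ℤ × ℤ)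
    (v : Label) : heightForm a f d τ (vert a v) =
      intForm (f τ.1) (vert a (shift (-τ.2) v)) / d τ.1 := by
  rw [heightForm_apply, act_latOp_vert]

namespace IsFundamentalData

variable {T : Type*} {a : ℤ} {r : Fin 3 → ℝ} {lab : T → Fin 3 → Label} {f : T → Fin 3 → ℤ}
  {d : T → ℤ} (hF : IsFundamentalData a r lab f d)

include hF

theorem cast_pos (t : T) : (0 : ℝ) < d t := Int.cast_pos.2 (hF.pos t)

theorem linearIndependent_shiftVtx (τ : T × ℤ × ℤ) :
    LinearIndependent ℝ fun k => vert a (shiftVtx lab τ k) := by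
  have := (hF.linearIndependent τ.1).map' (act (latOp a τ.2))
    (LinearMap.ker_eq_bot.2 (Function.LeftInverse.injective (act_inv_act _)))
  simpa only [Function.comp_def, act_latOp_vert, shiftVtx] using this

theorem exists_adjacent_shiftVtx (τ : T × ℤ × ℤ) (k : Fin 3) : ∃ τ',
    (∀ l, l ≠ k → heightForm a f d τ' (vert a (shiftVtx lab τ l)) = 1) ∧
      1 < heightForm a f d τ' (vert a (shiftVtx lab τ k)) := by
  obtain ⟨t', q, heq, hlt⟩ := hF.adjacent τ.1 k
  refine ⟨(t', τ.2 - q), fun l hl => ?_, ?_⟩ <;>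
    simp only [heightForm_vert, shiftVtx, shift_shift, neg_sub, add_sub_cancel]
  · rw [heq l hl, div_self (hF.cast_pos t').ne']
  · exact (one_lt_div (hF.cast_pos t')).2 hlt

variable (h : IsSpectrum a r)

include h

theorem one_le_heightForm {p : E3} (hp : p ∈ generators (orthant r)) (τ : T × ℤ × ℤ) :
    1 ≤ heightForm a f d τ p := by
  obtain ⟨x, y, z, hxyz⟩ := exists_eq_pt (act_mem_integerPoints (latOp a (-τ.2)) hp.1.2)
  rw [heightForm_apply, one_le_div (hF.cast_pos τ.1), hxyz, intForm_pt]
  refine Int.cast_le.2 (hF.le τ.1 x y z (fun i => ?_) fun h0 => hp.2 ?_)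
  · rw [← hxyz, h.eigenform_latOp]
    exact mul_nonneg (h.latUnit_pos _ i).le (ell_nonneg_of_mem_closure hp.1.1 i)
  · rw [Set.mem_singleton_iff, ← act_inv_act (latOp a (-τ.2)) p, hxyz, h0, map_zero]

theorem heightForm_pos (τ : T × ℤ × ℤ) {p : E3} (hp : p ∈ orthant r) :
    0 < heightForm a f d τ p := by
  rw [heightForm_apply]
  exact div_pos ((hF.isPositive _).apply_pos (h.act_latOp_mem_orthant _ hp)) (hF.cast_pos _)

theorem mem_orthant_of_forall_one_le [Nonempty T] {p : E3}
    (hp : ∀ τ, 1 ≤ heightForm a f d τ p) : p ∈ orthant r := by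
  obtain ⟨t⟩ := ‹Nonempty T›
  refine h.mem_orthant_of_forall_le (hF.isPositive t) (hF.cast_pos t) fun q => ?_
  simpa only [heightForm_apply, neg_neg, one_le_div (hF.cast_pos t)] using hp (t, -q)

theorem locallyFinite_heightForm [Finite T] {p : E3} (hp : p ∈ orthant r) (C : ℝ) :
    ∃ U ∈ nhds p, {τ | ∃ p' ∈ U, heightForm a f d τ p' ≤ C}.Finite := by
  choose U hU hfin using fun t =>
    h.exists_nhds_finite_translates (hF.isPositive t) hp (C * d t)
  refine ⟨⋂ t, U t, Filter.iInter_mem.2 hU,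
    (Set.finite_iUnion fun t => (hfin t).image fun q => ((t, -q) : T × ℤ × ℤ)).subset ?_⟩
  rintro ⟨t, q⟩ ⟨p', hp', hC⟩
  rw [heightForm_apply, div_le_iff₀ (hF.cast_pos t)] at hC
  exact Set.mem_iUnion.2 ⟨t, -q, ⟨p', Set.mem_iInter.1 hp' t, hC⟩, by simp⟩

theorem isConvexTriangulation [Finite T] [Nonempty T] :
    IsConvexTriangulation (vert a) (shiftVtx lab) (heightForm a f d) (generators (orthant r))
      (orthant r) where
  nonempty := inferInstance
  linearIndependent := hF.linearIndependent_shiftVtx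
  card_eq_finrank := by simp
  injOn_vertices _ _ _ _ hv := h.vert_injective hv
  vertex_mem _ _ := mem_generators (h.vert_mem_orthant _) (vert_mem_integerPoints a _)
  apply_vertex τ k := by
    rw [heightForm_vert, shiftVtx, shift_shift, add_neg_cancel, shift_zero, hF.height,
      div_self (hF.cast_pos _).ne']
  exists_adjacent := hF.exists_adjacent_shiftVtx
  one_le _ hp τ := hF.one_le_heightForm h hp τ
  natCast_smul_mem _ hp _ hn := natCast_smul_mem_generators hp hn
  isOpen := isOpen_orthant r
  mem_of_forall_one_le _ hp := hF.mem_orthant_of_forall_one_le h hp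
  pos τ _ hp := hF.heightForm_pos h τ hp
  locallyFinite _ hp C := hF.locallyFinite_heightForm h hp C

end IsFundamentalData

/-! ### The two triangulations -/

theorem act_twoSubInv_pt (a x y z : ℤ) :
    act (twoSubInv a) (pt x y z) =
      pt ((2 + a) * x - (2 * a + 3) * y - z) (2 * y - x) (2 * z - y) := by
  rw [act_twoSubInv, act_opA_inv_pt]
  apply ext_three <;> simp only [PiLp.sub_apply, PiLp.smul_apply, pt_apply_zero, pt_apply_one,
    pt_apply_two, smul_eq_mul] <;> push_cast <;> ring

theorem act_opX_pt (a x y z : ℤ) :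
    act (opX a) (pt x y z) =
      pt (-a * (-a * x + (2 * a + 3) * y + z) + (2 * a + 3) * x + y)
        (-a * x + (2 * a + 3) * y + z) x := by
  rw [opX_eq, act_mul_apply, act_opA_inv_pt, act_opA_inv_pt]

theorem act_opX_inv_pt (a x y z : ℤ) :
    act (opX a)⁻¹ (pt x y z) =
      pt z (x + a * y - (2 * a + 3) * z)
        (y + a * z - (2 * a + 3) * (x + a * y - (2 * a + 3) * z)) := by
  rw [opX_inv_eq, act_mul_apply, act_opA_pt, act_opA_pt]

theorem act_opY_pt (a x y z : ℤ) :
    act (opY a) (pt x y z) =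
      pt (4 * x + (4 * a + 7) * y + 2 * z) (2 * x + (2 * a + 4) * y + z)
        (x + (a + 2) * y + z) := by
  rw [act_opY_eq_iff, act_twoSubInv_pt]
  congr 1 <;> ring

theorem act_opX_ptA (a : ℤ) : act (opX a) ptA = ptD a := by
  rw [ptA, act_opX_pt, ptD]; congr 1 <;> ring

theorem act_opX_ptB (a : ℤ) : act (opX a) ptB = ptC := by
  rw [ptB, act_opX_pt, ptC]; congr 1 <;> ring

theorem act_opY_ptA (a : ℤ) : act (opY a) ptA = ptB := by
  rw [ptA, act_opY_pt, ptB]; congr 1 <;> ring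

theorem act_opY_ptD (a : ℤ) : act (opY a) (ptD a) = ptC := by
  rw [ptD, act_opY_pt, ptC]; congr 1 <;> ring

theorem vert_add_left (a : ℤ) (c : Bool) (i j : ℤ) :
    vert a (c, i + 1, j) = act (opX a) (vert a (c, i, j)) := by
  rw [show opX a = latOp a (1, 0) by simp [latOp], act_latOp_vert, shift, Prod.mk_add_mk, add_zero]

theorem vert_add_right (a : ℤ) (c : Bool) (i j : ℤ) :
    vert a (c, i, j + 1) = act (opY a) (vert a (c, i, j)) := by
  rw [show opY a = latOp a (0, 1) by simp [latOp], act_latOp_vert, shift, Prod.mk_add_mk, add_zero]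

theorem vert_sub_left (a : ℤ) (c : Bool) (i j : ℤ) :
    vert a (c, i - 1, j) = act (opX a)⁻¹ (vert a (c, i, j)) := by
  rw [← sub_add_cancel i 1, vert_add_left, act_inv_act, sub_add_cancel]

theorem vert_sub_right (a : ℤ) (c : Bool) (i j : ℤ) :
    vert a (c, i, j - 1) = act (twoSubInv a) (vert a (c, i, j)) := by
  rw [← sub_add_cancel j 1, vert_add_right, opY, act_act_inv, sub_add_cancel]

theorem vert_A (a : ℤ) : vert a (false, 0, 0) = ptA := by
  simp [vert, baseVertex, latOp, act_one_apply]

theorem vert_E (a : ℤ) : vert a (true, 0, 0) = ptE := by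
  simp [vert, baseVertex, latOp, act_one_apply]

theorem vert_B (a : ℤ) : vert a (false, 0, 1) = ptB := by
  rw [← zero_add (1 : ℤ), vert_add_right, vert_A, act_opY_ptA]

theorem vert_D (a : ℤ) : vert a (false, 1, 0) = ptD a := by
  rw [← zero_add (1 : ℤ), vert_add_left, vert_A, act_opX_ptA]

theorem vert_C (a : ℤ) : vert a (false, 1, 1) = ptC := by
  rw [show ((1, 1) : ℤ × ℤ) = (1, 0 + 1) from rfl, vert_add_right, vert_D, act_opY_ptD]

theorem vert_XD (a : ℤ) : vert a (false, 2, 0) =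
    pt (-a * (a * a + 2 * a + 3) - (2 * a + 3) * a + 1) (a * a + 2 * a + 3) (-a) := by
  rw [show ((2, 0) : ℤ × ℤ) = (1 + 1, 0) from rfl, vert_add_left, vert_D, ptD, act_opX_pt]
  congr 1 <;> ring

theorem vert_YB (a : ℤ) : vert a (false, 0, 2) = pt (4 * a + 17) (2 * a + 9) (a + 5) := by
  rw [show ((0, 2) : ℤ × ℤ) = (0, 1 + 1) from rfl, vert_add_right, vert_B, ptB, act_opY_pt]
  congr 1 <;> ring

theorem vert_E_left (a : ℤ) : vert a (true, -1, 0) = pt 1 0 (a + 2) := by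
  rw [← zero_sub (1 : ℤ), vert_sub_left, vert_E, ptE, act_opX_inv_pt]
  congr 1 <;> ring

theorem vert_E_right (a : ℤ) : vert a (true, 0, -1) = pt (-a - 1) 1 0 := by
  rw [← zero_sub (1 : ℤ), vert_sub_right, vert_E, ptE, act_twoSubInv_pt]
  congr 1
  ring

theorem vert_B_left (a : ℤ) : vert a (false, -1, 1) =
    pt 1 (-a - 1) (1 + a + (2 * a + 3) * (a + 1)) := by
  rw [show ((-1, 1) : ℤ × ℤ) = (0 - 1, 1) from rfl, vert_sub_left, vert_B, ptB, act_opX_inv_pt]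
  congr 1 <;> ring

theorem vert_D_right (a : ℤ) : vert a (false, 1, -1) =
    pt (-(2 + a) * a - (2 * a + 3)) (a + 2) (-1) := by
  rw [← zero_sub (1 : ℤ), vert_sub_right, vert_D, ptD, act_twoSubInv_pt]
  congr 1 <;> ring

theorem linearIndependent_of_det_ne_zero {P : Fin 3 → E3}
    (hP : (Matrix.of fun i j => P i j).det ≠ 0) : LinearIndependent ℝ P := by
  have hrow : LinearIndependent ℝ (Matrix.of fun i j => P i j).row :=
    Matrix.linearIndependent_rows_iff_isUnit.2
      ((Matrix.isUnit_iff_isUnit_det _).2 (isUnit_iff_ne_zero.2 hP))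
  exact LinearIndependent.of_comp (WithLp.linearEquiv 2 ℝ (Fin 3 → ℝ)).toLinearMap hrow

/-- The labels of the triangles `ABD`, `BCD`. -/
def labTwo : Fin 2 → Fin 3 → Label :=
  ![![(false, 0, 0), (false, 0, 1), (false, 1, 0)], ![(false, 0, 1), (false, 1, 1), (false, 1, 0)]]

/-- The labels of the triangles `ABD`, `BDE`, `BCE`, `CED`. -/
def labFour : Fin 4 → Fin 3 → Label :=
  ![![(false, 0, 0), (false, 0, 1), (false, 1, 0)], ![(false, 0, 1), (false, 1, 0), (true, 0, 0)],
    ![(false, 0, 1), (false, 1, 1), (true, 0, 0)], ![(false, 1, 1), (true, 0, 0), (false, 1, 0)]]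

/-- The integer covectors of the planes of `ABD`, `BDE`, `BCE`, `CED`. -/
def covFour (a : ℤ) : Fin 4 → Fin 3 → ℤ :=
  ![![-1, 2, a + 2], ![-1, 1, a + 2], ![-1, 1, 2], ![-1, 1 - a, 2 * a + 2]]

/-- The integer distances of the planes of `ABD`, `BDE`, `BCE`, `CED` from the origin. -/
def heightFour (a : ℤ) : Fin 4 → ℤ := ![a + 2, a + 1, 1, 1]

/-- The integer covectors of the planes of `ABD`, `BCD` for `a = 0`, when `BCE` and `CED` lie in the
plane of `BCD`. -/
def covTwo (t : Fin 2) : Fin 3 → ℤ := covFour 0 (![0, 2] t)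

/-- The integer distances of the planes of `ABD`, `BCD` from the origin for `a = 0`. -/
def heightTwo (t : Fin 2) : ℤ := heightFour 0 (![0, 2] t)

/-- The triangle opposite to a vertex, and the translation bringing it to one of the four. -/
def nbrFour : Fin 4 → Fin 3 → Fin 4 × ℤ × ℤ :=
  ![![(1, 0, 0), (2, 0, 1), (3, 1, 0)], ![(3, 0, 0), (2, 0, 0), (0, 0, 0)],
    ![(3, 0, 0), (1, 0, 0), (0, 0, -1)], ![(1, 0, 0), (0, -1, 0), (2, 0, 0)]]

/-- The triangle opposite to a vertex, and the translation bringing it to one of the two. -/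
def nbrTwo : Fin 2 → Fin 3 → Fin 2 × ℤ × ℤ :=
  ![![(1, 0, 0), (1, 0, 1), (1, 1, 0)], ![(0, -1, 0), (0, 0, 0), (0, 0, -1)]]

theorem heightFour_pos {a : ℤ} (ha : -1 < a) (t : Fin 4) : 0 < heightFour a t := by
  fin_cases t <;> simp [heightFour] <;> omega

theorem intForm_covFour_vert (a : ℤ) (t : Fin 4) (k : Fin 3) :
    intForm (covFour a t) (vert a (labFour t k)) = heightFour a t := by
  fin_cases t <;> fin_cases k <;>
    simp [labFour, covFour, heightFour, vert_A, vert_B, vert_C, vert_D, vert_E, intForm_pt,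
      ptA, ptB, ptC, ptD, ptE] <;> ring

theorem intForm_covTwo_vert (t : Fin 2) (k : Fin 3) :
    intForm (covTwo t) (vert 0 (labTwo t k)) = heightTwo t := by
  fin_cases t <;> fin_cases k <;>
    simp [labTwo, covTwo, covFour, heightTwo, heightFour, vert_A, vert_B, vert_C, vert_D,
      intForm_pt, ptA, ptB, ptC, ptD]

theorem intForm_covFour_nbrFour {a : ℤ} (t : Fin 4) {k l : Fin 3} (hl : l ≠ k) :
    intForm (covFour a (nbrFour t k).1) (vert a (shift (nbrFour t k).2 (labFour t l))) =
      heightFour a (nbrFour t k).1 := by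
  fin_cases t <;> fin_cases k <;> fin_cases l <;> simp at hl <;>
    simp [nbrFour, shift, labFour, covFour, heightFour, vert_A, vert_B, vert_C, vert_D, vert_E,
      intForm_pt, ptA, ptB, ptC, ptD, ptE] <;> ring

theorem lt_intForm_covFour_nbrFour {a : ℤ} (ha : 0 < a) (t : Fin 4) (k : Fin 3) :
    heightFour a (nbrFour t k).1 <
      intForm (covFour a (nbrFour t k).1) (vert a (shift (nbrFour t k).2 (labFour t k))) := by
  have hA : (0 : ℝ) < a := Int.cast_pos.2 ha
  fin_cases t <;> fin_cases k <;>
    simp [nbrFour, shift, labFour, covFour, heightFour, vert_A, vert_B, vert_C, vert_D, vert_E,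
      vert_XD, vert_YB, vert_E_left, vert_E_right, intForm_pt, ptA, ptB, ptC, ptD, ptE] <;>
    nlinarith

theorem intForm_covTwo_nbrTwo (t : Fin 2) {k l : Fin 3} (hl : l ≠ k) :
    intForm (covTwo (nbrTwo t k).1) (vert 0 (shift (nbrTwo t k).2 (labTwo t l))) =
      heightTwo (nbrTwo t k).1 := by
  fin_cases t <;> fin_cases k <;> fin_cases l <;> simp at hl <;>
    simp [nbrTwo, shift, labTwo, covTwo, covFour, heightTwo, heightFour, vert_A, vert_B, vert_C,
      vert_D, intForm_pt, ptA, ptB, ptC, ptD]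

theorem lt_intForm_covTwo_nbrTwo (t : Fin 2) (k : Fin 3) :
    heightTwo (nbrTwo t k).1 <
      intForm (covTwo (nbrTwo t k).1) (vert 0 (shift (nbrTwo t k).2 (labTwo t k))) := by
  fin_cases t <;> fin_cases k <;>
    simp [nbrTwo, shift, labTwo, covTwo, covFour, heightTwo, heightFour, vert_A, vert_C,
      vert_XD, vert_YB, vert_B_left, vert_D_right, intForm_pt, ptA, ptC] <;>
    norm_num

theorem linearIndependent_labFour {a : ℤ} (ha : 0 ≤ a) (t : Fin 4) :
    LinearIndependent ℝ fun k => vert a (labFour t k) := by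
  have hA : (0 : ℝ) ≤ a := Int.cast_nonneg ha
  apply linearIndependent_of_det_ne_zero
  rw [Matrix.det_fin_three]
  fin_cases t <;> simp [labFour, vert_A, vert_B, vert_C, vert_D, vert_E, ptA, ptB, ptC, ptD, ptE]
  all_goals
    ring_nf
    first | exact ne_of_lt (by linarith) | exact ne_of_gt (by linarith)

theorem linearIndependent_labTwo (t : Fin 2) :
    LinearIndependent ℝ fun k => vert 0 (labTwo t k) := by
  apply linearIndependent_of_det_ne_zero
  rw [Matrix.det_fin_three]
  fin_cases t <;> simp [labTwo, vert_A, vert_B, vert_C, vert_D, ptA, ptB, ptC, ptD]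
  norm_num

namespace IsSpectrum

variable {a : ℤ} {r : Fin 3 → ℝ} (h : IsSpectrum a r)

include h

theorem isPositive_intForm {c : Fin 3 → ℤ} (h0 : 0 < c 0 + c 1 * r 0 + c 2 * r 0 ^ 2)
    (h1 : c 0 + c 1 * r 1 + c 2 * r 1 ^ 2 < 0) (h2 : 0 < c 0 + c 1 * r 2 + c 2 * r 2 ^ 2) :
    IsPositive r (intForm c) :=
  h.isPositive ((form_eigv _ _ _).symm ▸ h0) ((form_eigv _ _ _).symm ▸ h1)
    ((form_eigv _ _ _).symm ▸ h2)

theorem isPositive_covFour (t : Fin 4) : IsPositive r (intForm (covFour a t)) := by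
  have b0 := h.apply_zero_lt
  have b1 := h.apply_one_neg
  have b1' := h.neg_one_lt_apply_one
  have b1'' := h.neg_one_lt_add_one_mul_apply_one
  have b2 := h.lt_apply_two
  have hA := h.cast_nonneg
  have s0 : 0 ≤ (a : ℝ) * r 0 ^ 2 := by positivity
  have s1 : (a + 1 : ℝ) * r 1 ^ 2 < -r 1 := by nlinarith
  have s2 : 0 ≤ (a : ℝ) * r 2 ^ 2 := by positivity
  refine h.isPositive_intForm ?_ ?_ ?_ <;> fin_cases t <;> simp [covFour] <;> nlinarith

/-- The planes of `ABD` and `BDE` support the hull because the integer forms `y + z` and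
`-x + 2y + z` are positive as well. -/
theorem heightFour_le {x y z : ℤ} (hp : ∀ i, 0 ≤ ell r i (pt x y z)) (hne : pt x y z ≠ 0)
    (t : Fin 4) : heightFour a t ≤ covFour a t 0 * x + covFour a t 1 * y + covFour a t 2 * z := by
  have b0 := h.apply_zero_lt
  have b1 := h.apply_one_neg
  have b1' := h.neg_one_lt_apply_one
  have b2 := h.lt_apply_two
  have hA := h.nonneg
  have c2 : 1 ≤ (-1) * x + 1 * y + 2 * z := h.one_le_of_isPositive (h.isPositive_covFour 2) hp hne
  have c3 : 1 ≤ (-1) * x + (1 - a) * y + (2 * a + 2) * z :=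
    h.one_le_of_isPositive (h.isPositive_covFour 3) hp hne
  have c4 : 1 ≤ 0 * x + 1 * y + 1 * z :=
    h.one_le_of_isPositive (c := ![0, 1, 1]) (h.isPositive_intForm (by simp; nlinarith)
      (by simp; nlinarith) (by simp; nlinarith)) hp hne
  have c5 : 1 ≤ (-1) * x + 2 * y + 1 * z :=
    h.one_le_of_isPositive (c := ![-1, 2, 1]) (h.isPositive_intForm (by simp; nlinarith)
      (by simp; nlinarith) (by simp; nlinarith)) hp hne
  have c1 : a + 1 ≤ -x + y + (a + 2) * z := by
    rcases le_or_gt 1 z with hz | hz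
    · nlinarith
    · nlinarith [show z + 1 ≤ y by omega]
  have c0 : a + 2 ≤ -x + 2 * y + (a + 2) * z := by
    rcases le_or_gt 1 z with hz | hz
    · nlinarith
    · linarith [show 1 ≤ y by omega]
  fin_cases t <;> simp [heightFour, covFour] <;> linarith

theorem isFundamentalData_four (ha : 0 < a) :
    IsFundamentalData a r labFour (covFour a) (heightFour a) where
  pos := heightFour_pos (by omega)
  isPositive := h.isPositive_covFour
  le t _ _ _ hp hne := h.heightFour_le hp hne t
  height := intForm_covFour_vert a
  adjacent t k := ⟨_, _, fun _ hl => intForm_covFour_nbrFour t hl,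
    lt_intForm_covFour_nbrFour ha t k⟩
  linearIndependent := linearIndependent_labFour ha.le

omit h in
theorem isFundamentalData_two (h : IsSpectrum 0 r) :
    IsFundamentalData 0 r labTwo covTwo heightTwo where
  pos _ := heightFour_pos (by decide) _
  isPositive _ := h.isPositive_covFour _
  le _ _ _ _ hp hne := h.heightFour_le hp hne _
  height := intForm_covTwo_vert
  adjacent t k := ⟨_, _, fun _ hl => intForm_covTwo_nbrTwo t hl, lt_intForm_covTwo_nbrTwo t k⟩
  linearIndependent := linearIndependent_labTwo

end IsSpectrum

/-! ### The period group and the faces of the sail -/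

/-- The operator as a linear automorphism. -/
noncomputable def actEquiv (g : SL3Z) : E3 ≃ₗ[ℝ] E3 :=
  LinearEquiv.ofLinearMap (act g) (act g⁻¹) (LinearMap.ext (act_act_inv g))
    (LinearMap.ext (act_inv_act g))

/-- The operator as a homeomorphism. -/
noncomputable def actHomeo (g : SL3Z) : E3 ≃ₜ E3 :=
  (actEquiv g).toContinuousLinearEquiv.toHomeomorph

theorem coe_actEquiv (g : SL3Z) : (actEquiv g : E3 → E3) = act g := rfl

theorem coe_actHomeo (g : SL3Z) : (actHomeo g : E3 → E3) = act g := rfl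

theorem linearMap_apply (f : E3 →ₗ[ℝ] ℝ) (p : E3) :
    f p = p 0 * f (pt 1 0 0) + p 1 * f (pt 0 1 0) + p 2 * f (pt 0 0 1) := by
  simp only [← smul_eq_mul, ← map_smul, ← map_add]
  congr 1
  apply ext_three <;> simp

theorem act_injective {g g' : SL3Z} (hg : ∀ p, act g p = act g' p) : g = g' := by
  ext i j
  have hij := congrArg (fun p : E3 => p i) (hg (EuclideanSpace.single j 1))
  simp only [act_apply] at hij
  exact Int.cast_injective (α := ℝ) (by fin_cases j <;> simpa using hij)

section

variable {g : SL3Z} {O : Set E3}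

theorem act_inv_image (hg : act g '' O = O) : act g⁻¹ '' O = O := by
  conv_lhs => rw [← hg, ← Set.image_comp]
  exact (Set.image_congr fun p _ => act_inv_act g p).trans (Set.image_id O)

theorem act_image_generators_subset (hg : act g '' closure O = closure O) :
    act g '' generators O ⊆ generators O := by
  rintro _ ⟨p, ⟨⟨hp, hpi⟩, hp0⟩, rfl⟩
  refine ⟨⟨hg ▸ Set.mem_image_of_mem _ hp, act_mem_integerPoints g hpi⟩, fun h0 => hp0 ?_⟩
  rw [Set.mem_singleton_iff] at h0 ⊢
  rw [← act_inv_act g p, h0, map_zero]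

theorem act_image_generators (hg : act g '' O = O) : act g '' generators O = generators O := by
  have hcl : act g '' closure O = closure O := by
    rw [← coe_actHomeo, Homeomorph.image_closure, coe_actHomeo, hg]
  exact (act_image_generators_subset hcl).antisymm fun p hp => ⟨act g⁻¹ p,
    act_image_generators_subset (act_inv_image hcl) ⟨p, hp, rfl⟩, act_act_inv g p⟩

theorem act_image_sailHull (hg : act g '' O = O) : act g '' sailHull O = sailHull O :=
  (LinearMap.image_convexHull _ _).trans (congrArg (convexHull ℝ) (act_image_generators hg))

theorem act_image_sail (hg : act g '' O = O) : act g '' sail O = sail O := by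
  rw [sail, ← coe_actHomeo, Homeomorph.image_frontier, coe_actHomeo, act_image_sailHull hg]

theorem act_mem_extremePoints (hg : act g '' O = O) {p : E3}
    (hp : p ∈ (sailHull O).extremePoints ℝ) : act g p ∈ (sailHull O).extremePoints ℝ := by
  have himage := image_extremePoints (actEquiv g) (sailHull O)
  rw [coe_actEquiv, act_image_sailHull hg] at himage
  exact himage ▸ Set.mem_image_of_mem _ hp

end

/-- The point `(0, 0, 1)` is a cyclic vector. -/
theorem IsEigenform.eq_zero {a : ℤ} {f : E3 →ₗ[ℝ] ℝ} {c : ℝ} (hf : IsEigenform f (opA a) c)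
    (hA : f ptA = 0) (p : E3) : f p = 0 := by
  rw [ptA] at hA
  have h1 : f (pt 0 1 0) = 0 := by
    have := hf (pt 0 0 1)
    rw [act_opA_pt, linearMap_apply] at this
    simpa [hA] using this
  have h0 : f (pt 1 0 0) = 0 := by
    have := hf (pt 0 1 0)
    rw [act_opA_pt, linearMap_apply] at this
    simpa [hA, h1] using this
  rw [linearMap_apply, h0, h1, hA]
  ring

namespace IsSpectrum

variable {a : ℤ} {r : Fin 3 → ℝ} (h : IsSpectrum a r) {g : SL3Z}

include h

theorem isEigenform_of_commute (hg : Commute g (opA a)) (i : Fin 3) :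
    IsEigenform (ell r i) g (ell r i (act g ptA)) := by
  let f : E3 →ₗ[ℝ] ℝ := ell r i ∘ₗ act g - ell r i (act g ptA) • ell r i
  have hf (p : E3) : f p = ell r i (act g p) - ell r i (act g ptA) * ell r i p := rfl
  have heigen : IsEigenform f (opA a) (r i) := fun p => by
    rw [hf, hf, ← act_mul_apply, hg.eq, act_mul_apply, h.eigenform_opA i, h.eigenform_opA i]
    ring
  exact fun p => sub_eq_zero.1 (heigen.eq_zero (by rw [hf, ell_ptA, mul_one, sub_self]) p)

theorem eq_one_of_act_ptA (hg : Commute g (opA a)) (hA : act g ptA = ptA) : g = 1 :=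
  act_injective fun p => h.ext_ell fun i => by
    rw [h.isEigenform_of_commute hg, hA, ell_ptA, one_mul, act_one_apply]

theorem act_image_orthant (hg : Commute g (opA a)) (hA : act g ptA ∈ orthant r) :
    act g '' orthant r = orthant r := by
  refine Set.Subset.antisymm ?_ fun p hp => ⟨act g⁻¹ p, ?_, act_act_inv g p⟩
  · rintro _ ⟨p, hp, rfl⟩
    exact mem_orthant_of_eigenform (h.isEigenform_of_commute hg) hA hp
  · exact mem_orthant_of_eigenform (fun i => (h.isEigenform_of_commute hg i).inv (hA i).ne')
      (fun i => inv_pos.2 (hA i)) hp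

theorem latOp_mem_periodGroup (q : ℤ × ℤ) : latOp a q ∈ periodGroup (opA a) (orthant r) :=
  ⟨(commute_opA_latOp a q).symm.eq, act_image_sail <|
    h.act_image_orthant (commute_opA_latOp a q).symm
      (h.act_latOp_mem_orthant q (ptA_mem_orthant r))⟩

end IsSpectrum

section

variable {Λ V : Type*} [AddCommGroup V] [Module ℝ V]

theorem cell_singleton (P : Λ → V) (v : Λ) : cell P {v} = {P v} := by
  simp [cell]

theorem cell_pair [DecidableEq Λ] (P : Λ → V) (v w : Λ) :
    cell P {v, w} = segment ℝ (P v) (P w) := by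
  simp [cell, Set.image_pair]

theorem cell_nonempty (P : Λ → V) {σ : Finset Λ} (hσ : σ.Nonempty) : (cell P σ).Nonempty :=
  ((Finset.coe_nonempty.2 hσ).image P).mono (subset_convexHull ℝ _)

end

theorem cell_triple {Λ : Type*} {V : Type} [DecidableEq Λ] [AddCommGroup V] [Module ℝ V]
    (P : Λ → V) (u v w : Λ) : cell P {u, v, w} = tri (P u) (P v) (P w) := by
  simp [cell, tri, Set.image_insert_eq]

theorem act_latOp_image_cell (a : ℤ) (q : ℤ × ℤ) (σ : Finset Label) :
    act (latOp a q) '' cell (vert a) σ = cell (vert a) (σ.image (shift q)) := by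
  rw [cell, cell, LinearMap.image_convexHull, ← Set.image_comp, Finset.coe_image, ← Set.image_comp]
  exact congrArg _ (Set.image_congr fun v _ => act_latOp_vert a q v)

theorem image_shift_zero (σ : Finset Label) : σ.image (shift 0) = σ :=
  (congrArg σ.image (funext shift_zero)).trans Finset.image_id

theorem image_shift_image_shift (σ : Finset Label) (q q' : ℤ × ℤ) :
    (σ.image (shift q)).image (shift q') = σ.image (shift (q + q')) :=
  Finset.image_image.trans (congrArg σ.image (funext fun v => shift_shift q' q v))

theorem image_shiftVtx {T : Type*} (lab : T → Fin 3 → Label) (τ : T × ℤ × ℤ)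
    (s : Finset (Fin 3)) : s.image (shiftVtx lab τ) = (s.image (lab τ.1)).image (shift τ.2) :=
  Finset.image_image.symm

/-- A system of representatives of the simplices of a periodic triangulation: `R k` holds one
`k`-dimensional simplex from each class under translations. -/
structure IsTransversal {T : Type*} (lab : T → Fin 3 → Label) (R : ℕ → Finset (Finset Label)) :
    Prop where
  base : ∃ t k, lab t k = (false, 0, 0)
  simplex : ∀ k, ∀ σ ∈ R k, ∃ t, ∃ s : Finset (Fin 3), s.card = k + 1 ∧ σ = s.image (lab t)
  exists_mem : ∀ t (s : Finset (Fin 3)), s.Nonempty →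
    ∃ σ ∈ R (s.card - 1), ∃ q, s.image (lab t) = σ.image (shift q)
  unique : ∀ k, ∀ σ ∈ R k, ∀ σ' ∈ R k, ∀ v ∈ σ, ∀ w ∈ σ',
    σ' = σ.image (shift (w.2 - v.2)) → σ = σ'

/-- The cells of the representatives. -/
def cells {V : Type*} [AddCommGroup V] [Module ℝ V] (P : Label → V)
    (R : ℕ → Finset (Finset Label)) (k : ℕ) : Set (Set V) :=
  cell P '' (R k : Set (Finset Label))

theorem IsTransversal.eq_of_image_shift_eq {T : Type*} {lab : T → Fin 3 → Label}
    {R : ℕ → Finset (Finset Label)} (hR : IsTransversal lab R) {k : ℕ} {σ σ' : Finset Label}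
    (hσ : σ ∈ R k) (hσ' : σ' ∈ R k) {q q' : ℤ × ℤ}
    (heq : σ.image (shift q) = σ'.image (shift q')) : σ = σ' := by
  have hσσ' : σ' = σ.image (shift (q - q')) := by
    rw [sub_eq_add_neg, ← image_shift_image_shift, heq, image_shift_image_shift, add_neg_cancel,
      image_shift_zero]
  obtain ⟨v, hv⟩ : σ.Nonempty := by
    obtain ⟨t, s, hs, rfl⟩ := hR.simplex k σ hσ
    exact (Finset.card_pos.1 (by omega)).image _
  refine hR.unique k σ hσ σ' hσ' v hv (shift (q - q') v)
    (hσσ' ▸ Finset.mem_image_of_mem _ hv) ?_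
  rwa [shift, add_sub_cancel_left]

namespace IsFundamentalData

variable {T : Type*} [Finite T] [Nonempty T] {a : ℤ} {r : Fin 3 → ℝ} {lab : T → Fin 3 → Label}
  {f : T → Fin 3 → ℤ} {d : T → ℤ} {R : ℕ → Finset (Finset Label)}
  (hF : IsFundamentalData a r lab f d) (h : IsSpectrum a r) (hR : IsTransversal lab R)

include hF h

theorem vert_mem_sail (t : T) (k : Fin 3) : vert a (lab t k) ∈ sail (orthant r) := by
  have hvtx := (hF.isConvexTriangulation h).mem_extremePoints_iff.2 ⟨(t, 0), k, rfl⟩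
  rw [shiftVtx, shift_zero] at hvtx
  exact hvtx.2

theorem isFace_cell {t : T} {q : ℤ × ℤ} {s : Finset (Fin 3)} {k : ℕ} (hs : s.card = k + 1) :
    IsFace (orthant r) k (cell (vert a) ((s.image (lab t)).image (shift q))) := by
  have hC := hF.isConvexTriangulation h
  have hne : s.Nonempty := Finset.card_pos.1 (by omega)
  rw [← image_shiftVtx lab (t, q)]
  have hdim := hC.finrank_vectorSpan_cell (τ := (t, q)) hne
  exact ⟨cell_nonempty _ (hne.image _), hC.cell_subset_frontier, hC.isExposed_cell, by omega⟩

theorem subset_of_cell_subset {t t' : T} {q q' : ℤ × ℤ} {s s' : Finset (Fin 3)}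
    (hsub : cell (vert a) ((s.image (lab t)).image (shift q)) ⊆
      cell (vert a) ((s'.image (lab t')).image (shift q'))) :
    (s.image (lab t)).image (shift q) ⊆ (s'.image (lab t')).image (shift q') := by
  rw [← image_shiftVtx lab (t, q), ← image_shiftVtx lab (t', q')] at hsub ⊢
  intro v hv
  obtain ⟨k, -, rfl⟩ := Finset.mem_image.1 hv
  exact (hF.isConvexTriangulation h).mem_of_vertex_mem_cell
    (hsub (subset_convexHull ℝ _ ⟨_, hv, rfl⟩))

include hR

theorem exists_act_ptA_eq_vert {g : SL3Z} (hg : g ∈ periodGroup (opA a) (orthant r)) :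
    ∃ v, act g ptA = vert a v := by
  obtain ⟨hcomm, hsail⟩ := hg
  have hC := hF.isConvexTriangulation h
  obtain ⟨t, k, htk⟩ := hR.base
  obtain ⟨hextreme, hptA⟩ := hC.mem_extremePoints_iff.2 ⟨(t, 0), k, rfl⟩
  rw [shiftVtx, shift_zero, htk, vert_A] at hextreme hptA
  have hgs : act g ptA ∈ sail (orthant r) := hsail ▸ Set.mem_image_of_mem _ hptA
  have hgO := h.act_image_orthant hcomm (hC.hull_subset (hC.frontier_subset_hull hgs))
  obtain ⟨τ, l, hl⟩ := hC.mem_extremePoints_iff.1 ⟨act_mem_extremePoints hgO hextreme, hgs⟩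
  exact ⟨_, hl⟩

theorem exists_eq_latOp {g : SL3Z} (hg : g ∈ periodGroup (opA a) (orthant r)) :
    ∃ q, g = latOp a q := by
  obtain ⟨⟨c, q⟩, hv⟩ := hF.exists_act_ptA_eq_vert h hR hg
  have hcomm : Commute ((latOp a q)⁻¹ * g) (opA a) :=
    (commute_opA_latOp a q).symm.inv_left.mul_left hg.1
  have hbase : act ((latOp a q)⁻¹ * g) ptA = baseVertex c := by
    rw [act_mul_apply, hv, vert, act_inv_act]
  cases c
  · exact ⟨q, (inv_mul_eq_one.1 (h.eq_one_of_act_ptA hcomm hbase)).symm⟩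
  · exact absurd hbase (act_ptA_ne_ptE (by have := h.nonneg; omega) hcomm)

theorem periodGroup_eq_closure :
    periodGroup (opA a) (orthant r) = Subgroup.closure {opX a, opY a} := by
  refine le_antisymm (fun g hg => ?_) ((Subgroup.closure_le _).2 ?_)
  · obtain ⟨q, rfl⟩ := hF.exists_eq_latOp h hR hg
    exact latOp_mem_closure a q
  · rintro g (rfl | rfl)
    · simpa [latOp] using h.latOp_mem_periodGroup (1, 0)
    · simpa [latOp] using h.latOp_mem_periodGroup (0, 1)

theorem isFace_iff {k : ℕ} {F : Set E3} : IsFace (orthant r) k F ↔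
    ∃ σ ∈ R k, ∃ q, F = cell (vert a) (σ.image (shift q)) := by
  have hC := hF.isConvexTriangulation h
  constructor
  · rintro ⟨hne, hsub, hexp, hdim⟩
    obtain ⟨⟨t, q⟩, s, hs, rfl⟩ := hC.exists_eq_cell hne hexp hsub
    have hcard := hC.finrank_vectorSpan_cell (τ := (t, q)) hs
    obtain ⟨σ, hσ, q', hq'⟩ := hR.exists_mem t s hs
    rw [← hcard, hdim, Nat.add_sub_cancel] at hσ
    exact ⟨σ, hσ, q' + q, by rw [image_shiftVtx, hq', image_shift_image_shift]⟩
  · rintro ⟨σ, hσ, q, rfl⟩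
    obtain ⟨t, s, hs, rfl⟩ := hR.simplex k σ hσ
    exact hF.isFace_cell h hs

theorem isFundamentalFamily :
    IsFundamentalFamily (opA a) (orthant r) (cells (vert a) R) := by
  refine ⟨?_, fun k F hFace => ?_⟩
  · rintro k _ ⟨σ, hσ, rfl⟩
    exact (hF.isFace_iff h hR).2 ⟨σ, hσ, 0, by rw [image_shift_zero]⟩
  obtain ⟨σ, hσ, q, rfl⟩ := (hF.isFace_iff h hR).1 hFace
  refine ⟨cell (vert a) σ, ⟨⟨σ, hσ, rfl⟩, latOp a q, h.latOp_mem_periodGroup q,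
    act_latOp_image_cell a q σ⟩, ?_⟩
  rintro _ ⟨⟨σ', hσ', rfl⟩, g, hg, hgF⟩
  obtain ⟨q', rfl⟩ := hF.exists_eq_latOp h hR hg
  rw [act_latOp_image_cell] at hgF
  have heq : σ'.image (shift q') = σ.image (shift q) := by
    obtain ⟨t, s, -, rfl⟩ := hR.simplex k σ hσ
    obtain ⟨t', s', -, rfl⟩ := hR.simplex k σ' hσ'
    exact (hF.subset_of_cell_subset h hgF.subset).antisymm
      (hF.subset_of_cell_subset h hgF.symm.subset)
  rw [hR.eq_of_image_shift_eq hσ' hσ heq]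

end IsFundamentalData

/-! ### The developing map to the torus -/

/-- An integer vector of the plane. -/
def planeVec (q : ℤ × ℤ) : ℝ × ℝ := (q.1, q.2)

theorem planeVec_add (q q' : ℤ × ℤ) : planeVec (q + q') = planeVec q + planeVec q' :=
  Prod.ext (Int.cast_add _ _) (Int.cast_add _ _)

/-- The point of the model plane with the given label: the class of `A` goes to the integer points
and the class of `E` to the translates of `E'`. -/
noncomputable def modelVert (v : Label) : ℝ × ℝ :=
  (bif v.1 then (2 / 3, 2 / 3) else 0) + planeVec v.2

theorem modelVert_shift (q : ℤ × ℤ) (v : Label) :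
    modelVert (shift q v) = modelVert v + planeVec q := by
  rw [modelVert, modelVert, shift, planeVec_add, add_assoc]

theorem toTorus_add_planeVec (z : ℝ × ℝ) (q : ℤ × ℤ) : toTorus (z + planeVec q) = toTorus z := by
  have hadd (x : ℝ) (n : ℤ) : ((x + n : ℝ) : UnitAddCircle) = x := by
    rw [AddCircle.coe_add, (AddCircle.coe_eq_zero_iff (1 : ℝ) (x := n)).2 ⟨n, zsmul_one n⟩,
      add_zero]
  exact Prod.ext (hadd _ _) (hadd _ _)

theorem exists_eq_add_of_toTorus_eq {z z' : ℝ × ℝ} (hz : toTorus z = toTorus z') :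
    ∃ q, z = z' + planeVec q := by
  have hsub (x y : ℝ) (hxy : (x : UnitAddCircle) = y) : ∃ n : ℤ, x = y + n := by
    obtain ⟨n, hn⟩ := (AddCircle.coe_eq_zero_iff 1).1
      ((AddCircle.coe_sub 1 x y).trans (sub_eq_zero.2 hxy))
    exact ⟨n, by rw [← zsmul_one, hn, add_sub_cancel]⟩
  obtain ⟨m, hm⟩ := hsub _ _ (congrArg Prod.fst hz)
  obtain ⟨n, hn⟩ := hsub _ _ (congrArg Prod.snd hz)
  exact ⟨(m, n), Prod.ext hm hn⟩

theorem continuous_toTorus : Continuous toTorus :=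
  ((AddCircle.continuous_mk' 1).comp continuous_fst).prodMk
    ((AddCircle.continuous_mk' 1).comp continuous_snd)

theorem exists_toTorus_eq (u : StdTorus) :
    ∃ z : ℝ × ℝ, z ∈ Set.Icc (0 : ℝ) 1 ×ˢ Set.Icc (0 : ℝ) 1 ∧ toTorus z = u := by
  obtain ⟨u, v⟩ := u
  obtain ⟨x, rfl⟩ := QuotientAddGroup.mk_surjective u
  obtain ⟨y, rfl⟩ := QuotientAddGroup.mk_surjective v
  refine ⟨(Int.fract x, Int.fract y), ⟨⟨Int.fract_nonneg x, (Int.fract_lt_one x).le⟩,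
    Int.fract_nonneg y, (Int.fract_lt_one y).le⟩, ?_⟩
  rw [← toTorus_add_planeVec _ (⌊x⌋, ⌊y⌋)]
  exact congrArg₂ (fun x y : ℝ => toTorus (x, y)) (Int.fract_add_floor x) (Int.fract_add_floor y)

open scoped Pointwise in
theorem toTorus_image_cell_shift (σ : Finset Label) (q : ℤ × ℤ) :
    toTorus '' cell modelVert (σ.image (shift q)) = toTorus '' cell modelVert σ := by
  have htranslate : cell modelVert (σ.image (shift q)) = (· + planeVec q) '' cell modelVert σ := by
    have himage : modelVert '' (σ.image (shift q) : Finset Label) =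
        planeVec q +ᵥ modelVert '' (σ : Set Label) := by
      rw [Finset.coe_image, ← Set.image_comp, ← Set.image_vadd, ← Set.image_comp]
      exact Set.image_congr fun v _ => (modelVert_shift q v).trans (add_comm _ _)
    rw [cell, himage, convexHull_vadd]
    exact Set.image_congr fun z _ => add_comm _ _
  rw [htranslate, ← Set.image_comp]
  exact Set.image_congr fun z _ => toTorus_add_planeVec z q

/-- The piecewise linear map of the unit square onto the fundamental region of the sail, which is
linear on the triangle `A'B'D'` and on the three triangles into which `E'` divides `B'C'D'`. -/
noncomputable def squareMap (a : ℤ) (z : ℝ × ℝ) : E3 :=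
  ptA + z.1 • (ptD a - ptA) + z.2 • (ptB - ptA) +
    max 0 (z.1 + z.2 - 1) • (ptC - ptB - ptD a + ptA) +
    (3 * max 0 (min (1 - z.1) (min (1 - z.2) (z.1 + z.2 - 1)))) •
      (ptE - (1 / 3 : ℝ) • (ptB + ptC + ptD a))

/-- The periodic extension of `squareMap`. -/
noncomputable def planeMap (a : ℤ) (z : ℝ × ℝ) : E3 :=
  act (latOp a (⌊z.1⌋, ⌊z.2⌋)) (squareMap a (Int.fract z.1, Int.fract z.2))

theorem planeMap_add_planeVec (a : ℤ) (z : ℝ × ℝ) (q : ℤ × ℤ) :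
    planeMap a (z + planeVec q) = act (latOp a q) (planeMap a z) := by
  have hfloor : q + (⌊z.1⌋, ⌊z.2⌋) = (⌊(z + planeVec q).1⌋, ⌊(z + planeVec q).2⌋) := by
    ext <;> simp [planeVec, add_comm]
  rw [planeMap, planeMap, ← act_mul_apply, ← latOp_add, hfloor]
  simp [planeVec]

theorem squareMap_of_add_le_one (a : ℤ) {z : ℝ × ℝ} (hz : z.1 + z.2 ≤ 1) :
    squareMap a z = ptA + z.1 • (ptD a - ptA) + z.2 • (ptB - ptA) := by
  have hz' : z.1 + z.2 - 1 ≤ 0 := sub_nonpos.2 hz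
  rw [squareMap, max_eq_left hz',
    max_eq_left ((min_le_right _ _).trans ((min_le_right _ _).trans hz'))]
  simp

theorem squareMap_of_one_le_add (a : ℤ) {z : ℝ × ℝ} (hz : 1 ≤ z.1 + z.2) {m : ℝ} (h0 : 0 ≤ m)
    (hm : min (1 - z.1) (min (1 - z.2) (z.1 + z.2 - 1)) = m) :
    squareMap a z = ptC + (1 - z.1) • (ptB - ptC) + (1 - z.2) • (ptD a - ptC) +
      (3 * m) • (ptE - (1 / 3 : ℝ) • (ptB + ptC + ptD a)) := by
  rw [squareMap, max_eq_right (sub_nonneg.2 hz), hm, max_eq_right h0]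
  module

theorem act_opX_squareMap (a : ℤ) {y : ℝ} (hy : y ∈ Set.Icc (0 : ℝ) 1) :
    act (opX a) (squareMap a (0, y)) = squareMap a (1, y) := by
  have hm : min (1 - (1 : ℝ)) (min (1 - y) (1 + y - 1)) = 0 := by
    rw [sub_self]
    exact min_eq_left (le_min (by linarith [hy.2]) (by linarith [hy.1]))
  rw [squareMap_of_add_le_one a (by simpa using hy.2),
    squareMap_of_one_le_add a (by simpa using hy.1) le_rfl hm]
  simp only [map_add, map_smul, map_sub, act_opX_ptA, act_opX_ptB, zero_smul, add_zero]
  module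

theorem act_opY_squareMap (a : ℤ) {x : ℝ} (hx : x ∈ Set.Icc (0 : ℝ) 1) :
    act (opY a) (squareMap a (x, 0)) = squareMap a (x, 1) := by
  have hm : min (1 - x) (min (1 - (1 : ℝ)) (x + 1 - 1)) = 0 := by
    rw [sub_self, add_sub_cancel_right, min_eq_left hx.1, min_eq_right (by linarith [hx.2])]
  rw [squareMap_of_add_le_one a (by simpa using hx.2),
    squareMap_of_one_le_add a (by simpa using hx.1) le_rfl hm]
  simp only [map_add, map_smul, map_sub, act_opY_ptA, act_opY_ptD, zero_smul, add_zero]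
  module

theorem planeMap_eq_squareMap (a : ℤ) {z : ℝ × ℝ}
    (hz : z ∈ Set.Icc (0 : ℝ) 1 ×ˢ Set.Icc (0 : ℝ) 1) : planeMap a z = squareMap a z := by
  obtain ⟨x, y⟩ := z
  obtain ⟨hx, hy⟩ := hz
  have hfloor (t : ℝ) (ht : t ∈ Set.Icc (0 : ℝ) 1) :
      (⌊t⌋ = 0 ∧ Int.fract t = t) ∨ (t = 1 ∧ ⌊t⌋ = 1 ∧ Int.fract t = 0) := by
    rcases ht.2.lt_or_eq with h | rfl
    · exact Or.inl ⟨Int.floor_eq_zero_iff.2 ⟨ht.1, h⟩, Int.fract_eq_self.2 ⟨ht.1, h⟩⟩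
    · exact Or.inr ⟨rfl, Int.floor_one, Int.fract_one⟩
  have h0 : (0 : ℝ) ∈ Set.Icc (0 : ℝ) 1 := ⟨le_rfl, zero_le_one⟩
  have h1 : (1 : ℝ) ∈ Set.Icc (0 : ℝ) 1 := ⟨zero_le_one, le_rfl⟩
  have hlat (i j : ℤ) : latOp a (i, j) = opX a ^ i * opY a ^ j := rfl
  simp only [planeMap, hlat]
  rcases hfloor x hx with ⟨e1, e2⟩ | ⟨rfl, e1, e2⟩ <;>
    rcases hfloor y hy with ⟨e3, e4⟩ | ⟨rfl, e3, e4⟩ <;>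
    simp only [e1, e2, e3, e4, zpow_zero, zpow_one, mul_one, one_mul, act_mul_apply]
  · exact act_one_apply _
  · exact act_opY_squareMap a hx
  · exact act_opX_squareMap a hy
  · rw [act_opY_squareMap a h0, act_opX_squareMap a h1]

/-- The model triangles tile the unit square, and `squareMap` maps them linearly onto the triangles
of the sail. -/
structure IsSquareTiling {T : Type*} (a : ℤ) (lab : T → Fin 3 → Label) : Prop where
  map_eq : ∀ t, ∀ b ∈ stdSimplex ℝ (Fin 3),
    squareMap a (∑ k, b k • modelVert (lab t k)) = ∑ k, b k • vert a (lab t k)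
  mem : ∀ t k, modelVert (lab t k) ∈ Set.Icc (0 : ℝ) 1 ×ˢ Set.Icc (0 : ℝ) 1
  exists_eq : ∀ z ∈ Set.Icc (0 : ℝ) 1 ×ˢ Set.Icc (0 : ℝ) 1,
    ∃ t, ∃ b ∈ stdSimplex ℝ (Fin 3), z = ∑ k, b k • modelVert (lab t k)

theorem act_latOp_sum_smul_vert {T : Type*} (a : ℤ) (lab : T → Fin 3 → Label) (τ : T × ℤ × ℤ)
    (q : ℤ × ℤ) (b : Fin 3 → ℝ) : act (latOp a q) (∑ k, b k • vert a (shiftVtx lab τ k)) =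
      ∑ k, b k • vert a (shiftVtx lab (τ.1, τ.2 + q) k) := by
  simp only [map_sum, map_smul, act_latOp_vert, shiftVtx, shift_shift]

theorem sum_smul_modelVert_shiftVtx {T : Type*} (lab : T → Fin 3 → Label) (τ : T × ℤ × ℤ)
    {b : Fin 3 → ℝ} (hb : b ∈ stdSimplex ℝ (Fin 3)) :
    ∑ k, b k • modelVert (shiftVtx lab τ k) =
      ∑ k, b k • modelVert (lab τ.1 k) + planeVec τ.2 := by
  simp only [shiftVtx, modelVert_shift, smul_add, Finset.sum_add_distrib, ← Finset.sum_smul,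
    hb.2, one_smul]

namespace IsFundamentalData

variable {T : Type*} [Finite T] [Nonempty T] {a : ℤ} {r : Fin 3 → ℝ} {lab : T → Fin 3 → Label}
  {f : T → Fin 3 → ℤ} {d : T → ℤ} (hF : IsFundamentalData a r lab f d) (h : IsSpectrum a r)

/-- The developing map of the sail to the model plane. -/
noncomputable def develop : E3 → ℝ × ℝ :=
  (hF.isConvexTriangulation h).piecewiseLinear modelVert

theorem develop_sum_smul (τ : T × ℤ × ℤ) {b : Fin 3 → ℝ} (hb : b ∈ stdSimplex ℝ (Fin 3)) :
    hF.develop h (∑ k, b k • vert a (shiftVtx lab τ k)) =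
      ∑ k, b k • modelVert (lab τ.1 k) + planeVec τ.2 :=
  ((hF.isConvexTriangulation h).piecewiseLinear_sum_smul modelVert hb).trans
    (sum_smul_modelVert_shiftVtx lab τ hb)

theorem continuous_develop : Continuous fun x : sail (orthant r) => hF.develop h x :=
  (hF.isConvexTriangulation h).continuous_piecewiseLinear modelVert

include hF h

theorem exists_sum_smul_of_mem_sail {p : E3} (hp : p ∈ sail (orthant r)) :
    ∃ τ, ∃ b ∈ stdSimplex ℝ (Fin 3), p = ∑ k, b k • vert a (shiftVtx lab τ k) :=
  (hF.isConvexTriangulation h).exists_mem_stdSimplex hp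

theorem sum_smul_mem_sail (τ : T × ℤ × ℤ) {b : Fin 3 → ℝ} (hb : b ∈ stdSimplex ℝ (Fin 3)) :
    ∑ k, b k • vert a (shiftVtx lab τ k) ∈ sail (orthant r) :=
  (hF.isConvexTriangulation h).cell_subset_frontier (sum_smul_mem_cell _ _ hb)

theorem develop_act (q : ℤ × ℤ) {p : E3} (hp : p ∈ sail (orthant r)) :
    hF.develop h (act (latOp a q) p) = hF.develop h p + planeVec q := by
  obtain ⟨τ, b, hb, rfl⟩ := hF.exists_sum_smul_of_mem_sail h hp
  rw [act_latOp_sum_smul_vert, hF.develop_sum_smul h _ hb, hF.develop_sum_smul h _ hb,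
    planeVec_add, add_assoc]

theorem planeMap_develop (hQ : IsSquareTiling a lab) {p : E3} (hp : p ∈ sail (orthant r)) :
    planeMap a (hF.develop h p) = p := by
  obtain ⟨⟨t, q⟩, b, hb, rfl⟩ := hF.exists_sum_smul_of_mem_sail h hp
  have hsquare : ∑ k, b k • modelVert (lab t k) ∈ Set.Icc (0 : ℝ) 1 ×ˢ Set.Icc (0 : ℝ) 1 :=
    ((convex_Icc 0 1).prod (convex_Icc 0 1)).sum_mem (fun k _ => hb.1 k) hb.2 fun k _ => hQ.mem t k
  rw [hF.develop_sum_smul h _ hb, planeMap_add_planeVec, planeMap_eq_squareMap a hsquare,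
    hQ.map_eq t b hb]
  simp only [map_sum, map_smul, act_latOp_vert, shiftVtx]

theorem compactSpace_sailQuotient : CompactSpace (SailQuotient (opA a) (orthant r)) := by
  let K : Set E3 := ⋃ t, cell (vert a) (Finset.univ.image (shiftVtx lab (t, 0)))
  have hK : IsCompact ((↑) ⁻¹' K : Set (sail (orthant r))) :=
    isClosed_frontier.isClosedEmbedding_subtypeVal.isCompact_preimage <|
      isCompact_iUnion fun t => isCompact_cell _ _
  have hquot : IsCompact (Quotient.mk (periodSetoid (opA a) (orthant r)) '' ((↑) ⁻¹' K)) :=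
    hK.image continuous_quotient_mk'
  refine ⟨hquot.of_isClosed_subset isClosed_univ fun y _ => ?_⟩
  obtain ⟨⟨p, hp⟩, rfl⟩ := Quotient.exists_rep y
  obtain ⟨⟨t, q⟩, b, hb, rfl⟩ := hF.exists_sum_smul_of_mem_sail h hp
  refine ⟨⟨_, hF.sum_smul_mem_sail h (t, 0) hb⟩,
    Set.mem_iUnion.2 ⟨t, sum_smul_mem_cell _ _ hb⟩, Quotient.sound
      ⟨latOp a q, h.latOp_mem_periodGroup q, ?_⟩⟩
  simp only [act_latOp_sum_smul_vert, zero_add]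

variable {R : ℕ → Finset (Finset Label)} (hR : IsTransversal lab R) (hQ : IsSquareTiling a lab)

include hR hQ

theorem toTorus_develop_eq_iff (x y : sail (orthant r)) :
    toTorus (hF.develop h x) = toTorus (hF.develop h y) ↔
      periodSetoid (opA a) (orthant r) x y := by
  constructor
  · intro hxy
    obtain ⟨q, hq⟩ := exists_eq_add_of_toTorus_eq hxy.symm
    refine ⟨latOp a q, h.latOp_mem_periodGroup q, ?_⟩
    rw [← hF.planeMap_develop h hQ x.2, ← planeMap_add_planeVec, ← hq,
      hF.planeMap_develop h hQ y.2]
  · rintro ⟨g, hg, hgx⟩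
    obtain ⟨q, rfl⟩ := hF.exists_eq_latOp h hR hg
    rw [← hgx, hF.develop_act h q x.2, toTorus_add_planeVec]

theorem exists_homeomorph : ∃ e : SailQuotient (opA a) (orthant r) ≃ₜ StdTorus,
    ∀ x : sail (orthant r), e (Quotient.mk _ x) = toTorus (hF.develop h x) := by
  have hiff := hF.toTorus_develop_eq_iff h hR hQ
  let F : SailQuotient (opA a) (orthant r) → StdTorus :=
    Quotient.lift (fun x => toTorus (hF.develop h x)) fun x y hxy => (hiff x y).2 hxy
  have hcont : Continuous F := (continuous_toTorus.comp (hF.continuous_develop h)).quotient_lift _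
  have hinj : Function.Injective F := by
    rintro ⟨x⟩ ⟨y⟩ hxy
    exact Quotient.sound ((hiff x y).1 hxy)
  have hsurj : Function.Surjective F := fun u => by
    obtain ⟨z, hz, rfl⟩ := exists_toTorus_eq u
    obtain ⟨t, b, hb, rfl⟩ := hQ.exists_eq z hz
    refine ⟨Quotient.mk _ ⟨_, hF.sum_smul_mem_sail h (t, 0) hb⟩, ?_⟩
    exact (congrArg toTorus (hF.develop_sum_smul h (t, 0) hb)).trans (toTorus_add_planeVec _ _)
  have := hF.compactSpace_sailQuotient h
  exact ⟨hcont.homeoOfEquivCompactToT2 (f := Equiv.ofBijective F ⟨hinj, hsurj⟩), fun x => rfl⟩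

theorem homeomorphicDecompositions :
    HomeomorphicDecompositions (sailTriangulation (opA a) (orthant r))
      (fun k => (fun c => toTorus '' c) '' cells modelVert R k) := by
  obtain ⟨e, he⟩ := hF.exists_homeomorph h hR hQ
  have himage {k : ℕ} {σ : Finset Label} (hσ : σ ∈ R k) (q : ℤ × ℤ) :
      e '' (Quotient.mk (periodSetoid (opA a) (orthant r)) ''
        {x : sail (orthant r) | (x : E3) ∈ cell (vert a) (σ.image (shift q))}) =
          toTorus '' cell modelVert σ := by
    obtain ⟨t, s, -, rfl⟩ := hR.simplex k σ hσ
    have hC := hF.isConvexTriangulation h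
    have hsub := hC.cell_subset_frontier (τ := (t, q)) (s := s)
    have hdevelop := hC.piecewiseLinear_image_cell modelVert (t, q) s
    rw [image_shiftVtx] at hsub hdevelop
    rw [← toTorus_image_cell_shift _ q, ← hdevelop]
    conv_rhs => rw [← Set.image_preimage_eq_of_subset (hsub.trans Subtype.range_val.superset)]
    simp only [← Set.image_comp]
    exact Set.image_congr fun x _ => he x
  refine ⟨e, fun k => Set.ext fun c => ⟨?_, ?_⟩⟩
  · rintro ⟨_, ⟨F, hFace, rfl⟩, rfl⟩
    obtain ⟨σ, hσ, q, rfl⟩ := (hF.isFace_iff h hR).1 hFace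
    exact ⟨_, ⟨σ, hσ, rfl⟩, (himage hσ q).symm⟩
  · rintro ⟨_, ⟨σ, hσ, rfl⟩, rfl⟩
    exact ⟨_, ⟨_, (hF.isFace_iff h hR).2 ⟨σ, hσ, 0, rfl⟩, rfl⟩, himage hσ 0⟩

end IsFundamentalData

/-! ### The two decompositions -/

/-- The simplices `A`; `AB`, `AD`, `BD`; `ABD`, `BCD`. -/
def transversalTwo : ℕ → Finset (Finset Label)
  | 0 => {{(false, 0, 0)}}
  | 1 => {{(false, 0, 0), (false, 0, 1)}, {(false, 0, 0), (false, 1, 0)},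
      {(false, 0, 1), (false, 1, 0)}}
  | 2 => {{(false, 0, 0), (false, 0, 1), (false, 1, 0)},
      {(false, 0, 1), (false, 1, 1), (false, 1, 0)}}
  | _ => ∅

/-- The simplices `A`, `E`; `AB`, `AD`, `BD`, `BE`, `CE`, `DE`; `ABD`, `BDE`, `BCE`, `CED`. -/
def transversalFour : ℕ → Finset (Finset Label)
  | 0 => {{(false, 0, 0)}, {(true, 0, 0)}}
  | 1 => {{(false, 0, 0), (false, 0, 1)}, {(false, 0, 0), (false, 1, 0)},
      {(false, 0, 1), (false, 1, 0)}, {(false, 0, 1), (true, 0, 0)},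
      {(false, 1, 1), (true, 0, 0)}, {(false, 1, 0), (true, 0, 0)}}
  | 2 => {{(false, 0, 0), (false, 0, 1), (false, 1, 0)},
      {(false, 0, 1), (false, 1, 0), (true, 0, 0)}, {(false, 0, 1), (false, 1, 1), (true, 0, 0)},
      {(false, 1, 1), (true, 0, 0), (false, 1, 0)}}
  | _ => ∅

theorem cells_transversalTwo {V : Type} [AddCommGroup V] [Module ℝ V] (P : Label → V) (k : ℕ) :
    cells P transversalTwo k =
      schemeTwo (P (false, 0, 0)) (P (false, 0, 1)) (P (false, 1, 1)) (P (false, 1, 0)) k := by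
  match k with
  | 0 => simp [cells, transversalTwo, schemeTwo, cell_singleton]
  | 1 => simp [cells, transversalTwo, schemeTwo, cell_pair, Set.image_insert_eq]
  | 2 => simp [cells, transversalTwo, schemeTwo, cell_triple, Set.image_insert_eq]
  | k + 3 => simp [cells, transversalTwo, schemeTwo]

theorem cells_transversalFour {V : Type} [AddCommGroup V] [Module ℝ V] (P : Label → V) (k : ℕ) :
    cells P transversalFour k =
      schemeFour (P (false, 0, 0)) (P (false, 0, 1)) (P (false, 1, 1)) (P (false, 1, 0))
        (P (true, 0, 0)) k := by
  match k with
  | 0 => simp [cells, transversalFour, schemeFour, cell_singleton, Set.image_insert_eq]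
  | 1 => simp [cells, transversalFour, schemeFour, cell_pair, Set.image_insert_eq]
  | 2 => simp [cells, transversalFour, schemeFour, cell_triple, Set.image_insert_eq]
  | k + 3 => simp [cells, transversalFour, schemeFour]

theorem exists_mem_transversalTwo : ∀ t (s : Finset (Fin 3)), s.Nonempty →
    ∃ σ ∈ transversalTwo (s.card - 1),
      ∃ q ∈ ({(0, 0), (1, 0), (0, 1), (1, 1)} : Finset (ℤ × ℤ)),
        s.image (labTwo t) = σ.image (shift q) := by
  decide +kernel

theorem isTransversal_two : IsTransversal labTwo transversalTwo where
  base := ⟨0, 0, rfl⟩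
  simplex
  | 0 | 1 | 2 => by decide +kernel
  | _ + 3 => by simp [transversalTwo]
  exists_mem t s hs :=
    let ⟨σ, hσ, q, _, hq⟩ := exists_mem_transversalTwo t s hs
    ⟨σ, hσ, q, hq⟩
  unique
  | 0 | 1 | 2 => by decide +kernel
  | _ + 3 => by simp [transversalTwo]

theorem exists_mem_transversalFour : ∀ t (s : Finset (Fin 3)), s.Nonempty →
    ∃ σ ∈ transversalFour (s.card - 1),
      ∃ q ∈ ({(0, 0), (1, 0), (0, 1), (1, 1)} : Finset (ℤ × ℤ)),
        s.image (labFour t) = σ.image (shift q) := by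
  decide +kernel

theorem isTransversal_four : IsTransversal labFour transversalFour where
  base := ⟨0, 0, rfl⟩
  simplex
  | 0 | 1 | 2 => by decide +kernel
  | _ + 3 => by simp [transversalFour]
  exists_mem t s hs :=
    let ⟨σ, hσ, q, _, hq⟩ := exists_mem_transversalFour t s hs
    ⟨σ, hσ, q, hq⟩
  unique
  | 0 | 1 | 2 => by decide +kernel
  | _ + 3 => by simp [transversalFour]

theorem modelVert_A : modelVert (false, 0, 0) = (0, 0) := by simp [modelVert, planeVec]
theorem modelVert_B : modelVert (false, 0, 1) = (0, 1) := by simp [modelVert, planeVec]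
theorem modelVert_C : modelVert (false, 1, 1) = (1, 1) := by simp [modelVert, planeVec]
theorem modelVert_D : modelVert (false, 1, 0) = (1, 0) := by simp [modelVert, planeVec]
theorem modelVert_E : modelVert (true, 0, 0) = (2 / 3, 2 / 3) := by simp [modelVert, planeVec]

theorem ptE_eq_centroid : ptE = (1 / 3 : ℝ) • (ptB + ptC + ptD 0) := by
  apply ext_three <;> simp [ptB, ptC, ptD, ptE] <;> norm_num

section SquareMap

variable (a : ℤ) {b : Fin 3 → ℝ} (hb : b ∈ stdSimplex ℝ (Fin 3))

include hb

theorem eq_one_sub_of_mem_stdSimplex : b 0 = 1 - b 1 - b 2 := by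
  have := hb.2
  rw [Fin.sum_univ_three] at this
  linarith

theorem squareMap_ABD :
    squareMap a (b 0 • (0, 0) + b 1 • (0, 1) + b 2 • (1, 0)) =
      b 0 • ptA + b 1 • ptB + b 2 • ptD a := by
  have h0 := eq_one_sub_of_mem_stdSimplex hb
  rw [squareMap_of_add_le_one _ (by simp; linarith [hb.1 0]), h0]
  simp only [Prod.smul_mk, Prod.mk_add_mk, smul_eq_mul]
  module

theorem squareMap_BCD :
    squareMap 0 (b 0 • (0, 1) + b 1 • (1, 1) + b 2 • (1, 0)) =
      b 0 • ptB + b 1 • ptC + b 2 • ptD 0 := by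
  have h0 := eq_one_sub_of_mem_stdSimplex hb
  have hb0 := hb.1 0
  have hb1 := hb.1 1
  have hb2 := hb.1 2
  rw [squareMap_of_one_le_add _ (by simp; linarith)
    (le_min (by simp; linarith) (le_min (by simp; linarith) (by simp; linarith))) rfl,
    ← ptE_eq_centroid, h0]
  simp only [Prod.smul_mk, Prod.mk_add_mk, smul_eq_mul]
  module

theorem squareMap_BDE :
    squareMap a (b 0 • (0, 1) + b 1 • (1, 0) + b 2 • (2 / 3, 2 / 3)) =
      b 0 • ptB + b 1 • ptD a + b 2 • ptE := by
  have h0 := eq_one_sub_of_mem_stdSimplex hb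
  have hb0 := hb.1 0
  have hb1 := hb.1 1
  have hb2 := hb.1 2
  rw [squareMap_of_one_le_add _ (m := b 2 / 3) (by simp; linarith) (by linarith), h0]
  · simp only [Prod.smul_mk, Prod.mk_add_mk, smul_eq_mul]
    module
  · simp only [Prod.smul_mk, Prod.mk_add_mk, smul_eq_mul]
    rw [min_eq_right (a := 1 - _) (b := _ - 1) (by linarith), min_eq_right (by linarith)]
    linarith

theorem squareMap_BCE :
    squareMap a (b 0 • (0, 1) + b 1 • (1, 1) + b 2 • (2 / 3, 2 / 3)) =
      b 0 • ptB + b 1 • ptC + b 2 • ptE := by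
  have h0 := eq_one_sub_of_mem_stdSimplex hb
  have hb0 := hb.1 0
  have hb1 := hb.1 1
  have hb2 := hb.1 2
  rw [squareMap_of_one_le_add _ (m := b 2 / 3) (by simp; linarith) (by linarith), h0]
  · simp only [Prod.smul_mk, Prod.mk_add_mk, smul_eq_mul]
    module
  · simp only [Prod.smul_mk, Prod.mk_add_mk, smul_eq_mul]
    rw [min_eq_left (b := _ - 1) (by linarith), min_eq_right (by linarith)]
    linarith

theorem squareMap_CED :
    squareMap a (b 0 • (1, 1) + b 1 • (2 / 3, 2 / 3) + b 2 • (1, 0)) =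
      b 0 • ptC + b 1 • ptE + b 2 • ptD a := by
  have h0 := eq_one_sub_of_mem_stdSimplex hb
  have hb0 := hb.1 0
  have hb1 := hb.1 1
  have hb2 := hb.1 2
  rw [squareMap_of_one_le_add _ (m := b 1 / 3) (by simp; linarith) (by linarith), h0]
  · simp only [Prod.smul_mk, Prod.mk_add_mk, smul_eq_mul]
    module
  · simp only [Prod.smul_mk, Prod.mk_add_mk, smul_eq_mul]
    rw [min_eq_left (le_min (by linarith) (by linarith))]
    linarith

end SquareMap

theorem mem_stdSimplex_three {x y z : ℝ} (hx : 0 ≤ x) (hy : 0 ≤ y) (hz : 0 ≤ z)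
    (hsum : x + y + z = 1) : ![x, y, z] ∈ stdSimplex ℝ (Fin 3) :=
  ⟨by simp [Fin.forall_fin_succ, hx, hy, hz], by simpa [Fin.sum_univ_three] using hsum⟩

theorem isSquareTiling_two : IsSquareTiling 0 labTwo where
  map_eq t b hb := by
    rw [Fin.sum_univ_three, Fin.sum_univ_three]
    fin_cases t <;> simp only [labTwo, Fin.zero_eta, Fin.mk_one, Matrix.cons_val, modelVert_A,
      modelVert_B, modelVert_C, modelVert_D, vert_A, vert_B, vert_C, vert_D]
    exacts [squareMap_ABD 0 hb, squareMap_BCD hb]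
  mem t k := by
    fin_cases t <;> fin_cases k <;>
      simp [labTwo, modelVert_A, modelVert_B, modelVert_C, modelVert_D]
  exists_eq := by
    rintro ⟨x, y⟩ ⟨⟨hx0, hx1⟩, hy0, hy1⟩
    rcases le_total (x + y) 1 with h | h
    · exact ⟨0, ![1 - x - y, y, x], mem_stdSimplex_three (by linarith) hy0 hx0 (by ring),
        by simp [Fin.sum_univ_three, labTwo, modelVert_A, modelVert_B, modelVert_D]⟩
    · exact ⟨1, ![1 - x, x + y - 1, 1 - y],
        mem_stdSimplex_three (by linarith) (by linarith) (by linarith) (by ring),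
        by simp [Fin.sum_univ_three, labTwo, modelVert_C, modelVert_B, modelVert_D]⟩

theorem exists_eq_sum_smul_modelVert_labFour {z : ℝ × ℝ}
    (hz : z ∈ Set.Icc (0 : ℝ) 1 ×ˢ Set.Icc (0 : ℝ) 1) :
    ∃ t, ∃ b ∈ stdSimplex ℝ (Fin 3), z = ∑ k, b k • modelVert (labFour t k) := by
  obtain ⟨x, y⟩ := z
  obtain ⟨⟨hx0, hx1⟩, hy0, hy1⟩ := hz
  rcases le_total (x + y) 1 with h | h
  · refine ⟨0, ![1 - x - y, y, x], mem_stdSimplex_three (by linarith) hy0 hx0 (by ring), ?_⟩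
    simp [Fin.sum_univ_three, labFour, modelVert_A, modelVert_B, modelVert_D]
  rcases le_total (x + y - 1) (min (1 - x) (1 - y)) with hxy | hxy
  · obtain ⟨hx, hy⟩ := le_min_iff.1 hxy
    refine ⟨1, ![1 - x - (x + y - 1), 1 - y - (x + y - 1), 3 * (x + y - 1)],
      mem_stdSimplex_three (by linarith) (by linarith) (by linarith) (by ring), ?_⟩
    ext <;> simp [Fin.sum_univ_three, labFour, modelVert_B, modelVert_D, modelVert_E] <;> ring
  rcases le_total (1 - y) (1 - x) with hle | hle
  · rw [min_eq_right hle] at hxy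
    refine ⟨2, ![1 - x - (1 - y), x + y - 1 - (1 - y), 3 * (1 - y)],
      mem_stdSimplex_three (by linarith) (by linarith) (by linarith) (by ring), ?_⟩
    ext <;> simp [Fin.sum_univ_three, labFour, modelVert_B, modelVert_C, modelVert_E] <;> ring
  · rw [min_eq_left hle] at hxy
    refine ⟨3, ![x + y - 1 - (1 - x), 3 * (1 - x), 1 - y - (1 - x)],
      mem_stdSimplex_three (by linarith) (by linarith) (by linarith) (by ring), ?_⟩
    ext <;> simp [Fin.sum_univ_three, labFour, modelVert_C, modelVert_D, modelVert_E] <;> ring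

theorem isSquareTiling_four (a : ℤ) : IsSquareTiling a labFour where
  map_eq t b hb := by
    rw [Fin.sum_univ_three, Fin.sum_univ_three]
    fin_cases t <;> simp only [labFour, Fin.zero_eta, Fin.mk_one, Fin.reduceFinMk, Matrix.cons_val,
      modelVert_A, modelVert_B, modelVert_C, modelVert_D, modelVert_E, vert_A, vert_B, vert_C,
      vert_D, vert_E]
    exacts [squareMap_ABD a hb, squareMap_BDE a hb, squareMap_BCE a hb, squareMap_CED a hb]
  mem t k := by
    fin_cases t <;> fin_cases k <;>
      simp [labFour, modelVert_A, modelVert_B, modelVert_C, modelVert_D, modelVert_E] <;> norm_num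
  exists_eq _ := exists_eq_sum_smul_modelVert_labFour

/-! ### Integer lengths, areas and distances from dual covectors -/

theorem add_mem_integerPoints {p q : E3} (hp : p ∈ integerPoints) (hq : q ∈ integerPoints) :
    p + q ∈ integerPoints := fun i => by
  obtain ⟨m, hm⟩ := hp i
  obtain ⟨n, hn⟩ := hq i
  exact ⟨m + n, by simp [hm, hn]⟩

theorem intCast_smul_mem_integerPoints (k : ℤ) {p : E3} (hp : p ∈ integerPoints) :
    (k : ℝ) • p ∈ integerPoints := fun i => by
  obtain ⟨m, hm⟩ := hp i
  exact ⟨k * m, by simp [hm]⟩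

theorem sub_mem_integerPoints {p q : E3} (hp : p ∈ integerPoints) (hq : q ∈ integerPoints) :
    p - q ∈ integerPoints := by
  simpa [sub_eq_add_neg] using
    add_mem_integerPoints hp (intCast_smul_mem_integerPoints (-1) hq)

theorem exists_intForm_eq (c : Fin 3 → ℤ) {p : E3} (hp : p ∈ integerPoints) :
    ∃ k : ℤ, intForm c p = k := by
  obtain ⟨x, y, z, rfl⟩ := exists_eq_pt hp
  exact ⟨_, intForm_pt c x y z⟩

theorem one_le_abs_of_ne_zero {x : ℝ} (hx : ∃ k : ℤ, x = k) (h0 : x ≠ 0) : 1 ≤ |x| := by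
  obtain ⟨k, rfl⟩ := hx
  exact_mod_cast Int.one_le_abs (Int.cast_ne_zero.1 h0)

theorem isLeast_dist {P Q e : E3} {s : ℝ} (hP : P ∈ integerPoints) (he : e ∈ integerPoints)
    (c : Fin 3 → ℤ) (hc : intForm c e = 1) (hQ : Q - P = s • e) (hs : s ≠ 0) :
    IsLeast {d | ∃ U ∈ integerPoints, ∃ V ∈ integerPoints,
      U ∈ line[ℝ, P, Q] ∧ V ∈ line[ℝ, P, Q] ∧ U ≠ V ∧ d = dist U V} ‖e‖ := by
  have he0 : e ≠ 0 := by
    rintro rfl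
    simp at hc
  have hline (t : ℝ) : AffineMap.lineMap P Q t = P + (t * s) • e := by
    rw [AffineMap.lineMap_apply, vsub_eq_sub, hQ, smul_smul, vadd_eq_add, add_comm]
  constructor
  · refine ⟨P, hP, P + e, add_mem_integerPoints hP he, left_mem_affineSpan_pair ℝ P Q,
      mem_affineSpan_pair_iff_exists_lineMap_eq.2 ⟨s⁻¹, ?_⟩, by simpa using he0, by simp⟩
    rw [hline, inv_mul_cancel₀ hs, one_smul]
  · rintro _ ⟨U, hU, V, hV, hUl, hVl, hUV, rfl⟩
    obtain ⟨t, rfl⟩ := mem_affineSpan_pair_iff_exists_lineMap_eq.1 hUl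
    obtain ⟨u, rfl⟩ := mem_affineSpan_pair_iff_exists_lineMap_eq.1 hVl
    have hdiff : AffineMap.lineMap P Q t - AffineMap.lineMap P Q u = (t * s - u * s) • e := by
      rw [hline, hline]
      module
    have hint := exists_intForm_eq c (sub_mem_integerPoints hU hV)
    rw [hdiff, map_smul, hc, smul_eq_mul, mul_one] at hint
    have hne : t * s - u * s ≠ 0 := fun h0 => sub_ne_zero.2 hUV (by rw [hdiff, h0, zero_smul])
    rw [dist_eq_norm, hdiff, norm_smul, Real.norm_eq_abs]
    exact le_mul_of_one_le_left (norm_nonneg _) (one_le_abs_of_ne_zero hint hne)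

theorem integerLength_eq {P Q e : E3} {s : ℝ} (hP : P ∈ integerPoints) (he : e ∈ integerPoints)
    (c : Fin 3 → ℤ) (hc : intForm c e = 1) (hQ : Q - P = s • e) (hs : s ≠ 0) :
    integerLength P Q = |s| := by
  have he0 : e ≠ 0 := by
    rintro rfl
    simp at hc
  rw [integerLength, (isLeast_dist hP he c hc hQ hs).csInf_eq, dist_comm, dist_eq_norm, hQ,
    norm_smul, Real.norm_eq_abs, mul_div_cancel_right₀ _ (norm_ne_zero_iff.2 he0)]

theorem left_mem_plane (P Q R : E3) : P ∈ plane P Q R := subset_affineSpan ℝ _ (by simp)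

theorem direction_plane (P Q R : E3) :
    (plane P Q R).direction = Submodule.span ℝ {Q - P, R - P} := by
  rw [plane, direction_affineSpan, vectorSpan_eq_span_vsub_set_right ℝ (Set.mem_insert P {Q, R})]
  simp [Set.image_insert_eq]

theorem affineIndependent_iff_linearIndependent_sub {U V W : E3} :
    AffineIndependent ℝ ![U, V, W] ↔ LinearIndependent ℝ ![V - U, W - U] := by
  rw [affineIndependent_iff_linearIndependent_vsub ℝ _ (0 : Fin 3),
    ← linearIndependent_equiv (finSuccAboveEquiv (0 : Fin 3))]
  convert! Iff.rfl
  ext i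
  fin_cases i <;> rfl

theorem triangleArea_eq {U V W e₁ e₂ : E3} {s₁ s₂ t₁ t₂ : ℝ} (hV : V - U = s₁ • e₁ + s₂ • e₂)
    (hW : W - U = t₁ • e₁ + t₂ • e₂) :
    triangleArea U V W = |s₁ * t₂ - s₂ * t₁| * triangleArea 0 e₁ e₂ := by
  have hgram : ‖V - U‖ ^ 2 * ‖W - U‖ ^ 2 - inner ℝ (V - U) (W - U) ^ 2 =
      (s₁ * t₂ - s₂ * t₁) ^ 2 * (‖e₁‖ ^ 2 * ‖e₂‖ ^ 2 - inner ℝ e₁ e₂ ^ 2) := by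
    rw [hV, hW]
    simp only [← real_inner_self_eq_norm_sq, inner_add_left, inner_add_right,
      real_inner_smul_left, real_inner_smul_right, real_inner_comm e₁ e₂]
    ring
  rw [triangleArea, hgram, Real.sqrt_mul (sq_nonneg _), Real.sqrt_sq_eq_abs, triangleArea,
    sub_zero, sub_zero, mul_div_assoc]

theorem triangleArea_zero_pos {e₁ e₂ : E3} (he : LinearIndependent ℝ ![e₁, e₂]) :
    0 < triangleArea 0 e₁ e₂ := by
  have h₁ : e₁ ≠ 0 := he.ne_zero 0
  have h₂ : e₂ ≠ 0 := he.ne_zero 1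
  have hlt : |inner ℝ e₁ e₂| < ‖e₁‖ * ‖e₂‖ := by
    refine (abs_real_inner_le_norm e₁ e₂).lt_of_ne fun heq => ?_
    obtain ⟨s, -, hs⟩ := (norm_inner_eq_norm_iff (𝕜 := ℝ) h₁ h₂).1 heq
    exact (LinearIndependent.pair_iff' h₁).1 he s hs.symm
  have hsq : 0 < ‖e₁‖ ^ 2 * ‖e₂‖ ^ 2 - inner ℝ e₁ e₂ ^ 2 := by
    rw [← mul_pow, ← sq_abs (inner ℝ e₁ e₂), sub_pos]
    exact pow_lt_pow_left₀ hlt (abs_nonneg _) two_ne_zero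
  simp only [triangleArea, sub_zero]
  positivity

/-- A pair of integer vectors together with a dual pair of integer forms. Such a pair is a basis of
the group of the integer vectors of the plane it spans. -/
structure IsIntegerBasis (e₁ e₂ : E3) (c₁ c₂ : Fin 3 → ℤ) : Prop where
  left_mem : e₁ ∈ integerPoints
  right_mem : e₂ ∈ integerPoints
  left_left : intForm c₁ e₁ = 1
  left_right : intForm c₁ e₂ = 0
  right_left : intForm c₂ e₁ = 0
  right_right : intForm c₂ e₂ = 1

namespace IsIntegerBasis

variable {e₁ e₂ : E3} {c₁ c₂ : Fin 3 → ℤ} (he : IsIntegerBasis e₁ e₂ c₁ c₂)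
include he

theorem linearIndependent : LinearIndependent ℝ ![e₁, e₂] := by
  refine LinearIndependent.pair_iff.2 fun s t hst => ⟨?_, ?_⟩
  · simpa [he.left_left, he.left_right] using congrArg (intForm c₁) hst
  · simpa [he.right_left, he.right_right] using congrArg (intForm c₂) hst

theorem eq_smul_add_smul {v : E3} (hv : v ∈ Submodule.span ℝ {e₁, e₂}) :
    v = intForm c₁ v • e₁ + intForm c₂ v • e₂ := by
  obtain ⟨s, t, rfl⟩ := Submodule.mem_span_pair.1 hv
  simp [he.left_left, he.left_right, he.right_left, he.right_right]

theorem triangleArea_le {U V W : E3} (hU : U ∈ integerPoints) (hV : V ∈ integerPoints)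
    (hW : W ∈ integerPoints) (hVU : V - U ∈ Submodule.span ℝ {e₁, e₂})
    (hWU : W - U ∈ Submodule.span ℝ {e₁, e₂}) (hUVW : AffineIndependent ℝ ![U, V, W]) :
    triangleArea 0 e₁ e₂ ≤ triangleArea U V W := by
  have hV' := he.eq_smul_add_smul hVU
  have hW' := he.eq_smul_add_smul hWU
  rw [affineIndependent_iff_linearIndependent_sub, hV', hW',
    LinearIndependent.pair_add_smul_add_smul_iff] at hUVW
  rw [triangleArea_eq hV' hW']
  refine le_mul_of_one_le_left (triangleArea_zero_pos he.linearIndependent).le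
    (one_le_abs_of_ne_zero ?_ (sub_ne_zero.2 hUVW.2))
  obtain ⟨k₁, hk₁⟩ := exists_intForm_eq c₁ (sub_mem_integerPoints hV hU)
  obtain ⟨k₂, hk₂⟩ := exists_intForm_eq c₂ (sub_mem_integerPoints hV hU)
  obtain ⟨l₁, hl₁⟩ := exists_intForm_eq c₁ (sub_mem_integerPoints hW hU)
  obtain ⟨l₂, hl₂⟩ := exists_intForm_eq c₂ (sub_mem_integerPoints hW hU)
  exact ⟨k₁ * l₂ - k₂ * l₁, by rw [hk₁, hk₂, hl₁, hl₂]; push_cast; rfl⟩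

theorem isLeast_triangleArea {H : AffineSubspace ℝ E3} {P : E3} (hP : P ∈ integerPoints)
    (hPH : P ∈ H) (hH : H.direction = Submodule.span ℝ {e₁, e₂}) :
    IsLeast {s | ∃ U ∈ integerPoints, ∃ V ∈ integerPoints, ∃ W ∈ integerPoints,
      U ∈ H ∧ V ∈ H ∧ W ∈ H ∧ AffineIndependent ℝ ![U, V, W] ∧ s = triangleArea U V W}
      (triangleArea 0 e₁ e₂) := by
  have hadd (e : E3) (hem : e ∈ ({e₁, e₂} : Set E3)) : P + e ∈ H := by
    rw [← AffineSubspace.vsub_right_mem_direction_iff_mem hPH, hH, vsub_eq_sub, add_sub_cancel_left]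
    exact Submodule.subset_span hem
  constructor
  · refine ⟨P, hP, P + e₁, add_mem_integerPoints hP he.left_mem, P + e₂,
      add_mem_integerPoints hP he.right_mem, hPH, hadd e₁ (by simp), hadd e₂ (by simp), ?_, ?_⟩
    · simpa [affineIndependent_iff_linearIndependent_sub] using he.linearIndependent
    · simp [triangleArea]
  · rintro _ ⟨U, hU, V, hV, W, hW, hUH, hVH, hWH, hUVW, rfl⟩
    exact he.triangleArea_le hU hV hW (hH ▸ AffineSubspace.vsub_mem_direction hVH hUH)
      (hH ▸ AffineSubspace.vsub_mem_direction hWH hUH) hUVW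

theorem direction_plane_eq {P Q R : E3} {s₁ s₂ t₁ t₂ : ℝ} (hQ : Q - P = s₁ • e₁ + s₂ • e₂)
    (hR : R - P = t₁ • e₁ + t₂ • e₂) (hdet : s₁ * t₂ - s₂ * t₁ ≠ 0) :
    (plane P Q R).direction = Submodule.span ℝ {e₁, e₂} := by
  have hQR : LinearIndependent ℝ ![Q - P, R - P] := by
    rw [hQ, hR, LinearIndependent.pair_add_smul_add_smul_iff]
    exact ⟨he.linearIndependent, sub_ne_zero.1 hdet⟩
  have hrank : Module.finrank ℝ (Submodule.span ℝ {Q - P, R - P}) =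
      Module.finrank ℝ (Submodule.span ℝ {e₁, e₂}) := by
    rw [← Matrix.range_cons_cons_empty, ← Matrix.range_cons_cons_empty, finrank_span_eq_card hQR,
      finrank_span_eq_card he.linearIndependent]
  rw [direction_plane]
  refine Submodule.eq_of_le_of_finrank_eq (Submodule.span_le.2 ?_) hrank
  rintro v (rfl | rfl)
  · exact Submodule.mem_span_pair.2 ⟨s₁, s₂, hQ.symm⟩
  · exact Submodule.mem_span_pair.2 ⟨t₁, t₂, hR.symm⟩

theorem integerArea_eq {P Q R : E3} (hP : P ∈ integerPoints) {s₁ s₂ t₁ t₂ : ℝ}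
    (hQ : Q - P = s₁ • e₁ + s₂ • e₂) (hR : R - P = t₁ • e₁ + t₂ • e₂)
    (hdet : s₁ * t₂ - s₂ * t₁ ≠ 0) : integerArea P Q R = |s₁ * t₂ - s₂ * t₁| := by
  rw [integerArea, (he.isLeast_triangleArea hP (left_mem_plane P Q R)
    (he.direction_plane_eq hQ hR hdet)).csInf_eq, triangleArea_eq hQ hR,
    mul_div_cancel_right₀ _ (triangleArea_zero_pos he.linearIndependent).ne']

end IsIntegerBasis

theorem infDist_setOf_inner_eq {E : Type*} [NormedAddCommGroup E] [InnerProductSpace ℝ E] {n : E}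
    (hn : n ≠ 0) (d : ℝ) (p : E) :
    Metric.infDist p {q : E | inner ℝ n q = d} = |inner ℝ n p - d| / ‖n‖ := by
  have hn' : 0 < ‖n‖ := norm_pos_iff.2 hn
  have hmem : p - ((inner ℝ n p - d) / ‖n‖ ^ 2) • n ∈ {q : E | inner ℝ n q = d} := by
    rw [Set.mem_ofPred_eq, inner_sub_right, real_inner_smul_right, real_inner_self_eq_norm_sq]
    field_simp
    ring
  refine le_antisymm ?_ ?_
  · refine (Metric.infDist_le_dist_of_mem hmem).trans_eq ?_
    rw [dist_eq_norm, sub_sub_cancel, norm_smul, Real.norm_eq_abs, abs_div,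
      abs_of_pos (by positivity : 0 < ‖n‖ ^ 2)]
    field_simp
  · refine (Metric.le_infDist ⟨_, hmem⟩).2 fun {q} hq => ?_
    rw [Set.mem_ofPred_eq] at hq
    rw [div_le_iff₀ hn', ← hq, ← inner_sub_right, dist_eq_norm, mul_comm]
    exact abs_real_inner_le_norm _ _

theorem infDist_setOf_intForm_eq {c : Fin 3 → ℤ} (hc : pt (c 0) (c 1) (c 2) ≠ 0) (d : ℝ) (p : E3) :
    Metric.infDist p {q | intForm c q = d} = |intForm c p - d| / ‖pt (c 0) (c 1) (c 2)‖ := by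
  have hinner (q : E3) : intForm c q = inner ℝ (pt (c 0) (c 1) (c 2)) q := by
    simp [intForm_apply, PiLp.inner_apply, Fin.sum_univ_three, mul_comm]
  simp only [hinner]
  exact infDist_setOf_inner_eq hc d p

theorem integerDistance_eq {H : AffineSubspace ℝ E3} {c : Fin 3 → ℤ} {d : ℤ}
    (hH : (H : Set E3) = {q | intForm c q = d}) {u : E3} (hu : u ∈ integerPoints)
    (hcu : intForm c u = 1) (p : E3) : integerDistance H p = |intForm c p - d| := by
  let n := pt (c 0) (c 1) (c 2)
  have hn : n ≠ 0 := fun h0 => by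
    have hc : c = 0 := funext fun i => by
      have hi := congrArg (fun q : E3 => q i) h0
      fin_cases i <;> simpa [n] using hi
    simp [hc, intForm_apply] at hcu
  have hmem (q : E3) : q ∈ H ↔ intForm c q = d := by rw [← SetLike.mem_coe, hH, Set.mem_ofPred_eq]
  have hdist (q : E3) : Metric.infDist q H = |intForm c q - d| / ‖n‖ := by
    rw [hH, infDist_setOf_intForm_eq hn]
  have hleast : IsLeast {e | ∃ q ∈ integerPoints, q ∉ H ∧ e = Metric.infDist q H} (1 / ‖n‖) := by
    constructor
    · refine ⟨((d + 1 : ℤ) : ℝ) • u, intCast_smul_mem_integerPoints _ hu, ?_, ?_⟩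
      · simp [hmem, hcu]
      · simp [hdist, hcu]
    · rintro _ ⟨q, hq, hqH, rfl⟩
      rw [hdist]
      refine div_le_div_of_nonneg_right (one_le_abs_of_ne_zero ?_ (sub_ne_zero.2 fun h0 =>
        hqH ((hmem q).2 h0))) (norm_nonneg n)
      obtain ⟨k, hk⟩ := exists_intForm_eq c hq
      exact ⟨k - d, by rw [hk]; push_cast; rfl⟩
  rw [integerDistance, hleast.csInf_eq, hdist]
  exact (div_div_div_cancel_right₀ (norm_ne_zero_iff.2 hn) _ _).trans (div_one _)

theorem coe_plane {p : Fin 3 → E3} (hp : LinearIndependent ℝ p) {f : E3 →ₗ[ℝ] ℝ} {d : ℝ}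
    (hd : d ≠ 0) (hf : ∀ k, f (p k) = d) :
    (plane (p 0) (p 1) (p 2) : Set E3) = {q | f q = d} := by
  ext q
  rw [SetLike.mem_coe, ← AffineSubspace.vsub_right_mem_direction_iff_mem (left_mem_plane _ _ _),
    direction_plane, Submodule.mem_span_pair, Set.mem_ofPred_eq, vsub_eq_sub]
  constructor
  · rintro ⟨s, t, hst⟩
    have hq := congrArg f hst
    simp only [map_add, map_smul, map_sub, hf, sub_self, smul_zero, add_zero] at hq
    exact sub_eq_zero.1 hq.symm
  · intro hq
    obtain ⟨b, rfl⟩ : ∃ b : Fin 3 → ℝ, q = ∑ k, b k • p k := by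
      let B := basisOfLinearIndependentOfCardEqFinrank hp (by simp)
      exact ⟨B.repr q, by simpa [B] using (B.sum_repr q).symm⟩
    simp only [Fin.sum_univ_three, map_add, map_smul, hf, smul_eq_mul] at hq
    have hb : b 0 = 1 - b 1 - b 2 := mul_right_cancel₀ hd (by linear_combination hq)
    refine ⟨b 1, b 2, ?_⟩
    rw [Fin.sum_univ_three, hb]
    module

/-! ### The orthants of the operator -/

theorem connectedComponentIn_setOf_forall_ne_zero {ι E : Type*} [AddCommGroup E] [Module ℝ E]
    [TopologicalSpace E] [IsTopologicalAddGroup E] [ContinuousSMul ℝ E] (f : ι → E →L[ℝ] ℝ) {p : E}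
    (hp : ∀ i, f i p ≠ 0) :
    connectedComponentIn {q | ∀ i, f i q ≠ 0} p = {q | ∀ i, 0 < f i p * f i q} := by
  refine Set.Subset.antisymm (fun q hq i => ?_) ?_
  · have himage : (f i '' connectedComponentIn {q | ∀ i, f i q ≠ 0} p).OrdConnected :=
      (isPreconnected_connectedComponentIn.image _ (f i).continuous.continuousOn).ordConnected
    have hpi := Set.mem_image_of_mem (f i) (mem_connectedComponentIn (F := {q | ∀ i, f i q ≠ 0}) hp)
    have hqi := Set.mem_image_of_mem (f i) hq
    have hzero : (0 : ℝ) ∉ f i '' connectedComponentIn {q | ∀ i, f i q ≠ 0} p := by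
      rintro ⟨x, hx, hx0⟩
      exact connectedComponentIn_subset _ _ hx i hx0
    by_contra! hneg
    rcases mul_nonpos_iff.1 hneg with ⟨h1, h2⟩ | ⟨h1, h2⟩
    · exact hzero (himage.out hqi hpi ⟨h2, h1⟩)
    · exact hzero (himage.out hpi hqi ⟨h1, h2⟩)
  · have hconv : Convex ℝ {q | ∀ i, 0 < f i p * f i q} := by
      simp only [Set.ofPred_forall]
      exact convex_iInter fun i => convex_halfSpace_gt (f i p • (f i : E →ₗ[ℝ] ℝ)).isLinear 0
    exact hconv.isPreconnected.subset_connectedComponentIn (fun i => mul_self_pos.2 (hp i))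
      fun q hq i => right_ne_zero_of_mul (hq i).ne'

theorem sail_subset {O S : Set E3} (hclosed : IsClosed S) (hconv : Convex ℝ S) (hO : O ⊆ S) :
    sail O ⊆ S :=
  frontier_subset_closure.trans <| closure_minimal
    (convexHull_min (fun _ hq => closure_minimal hO hclosed hq.1.1) hconv) hclosed

namespace IsSpectrum

variable {a : ℤ} {r : Fin 3 → ℝ} (h : IsSpectrum a r)
include h

theorem hasEigenvector (i : Fin 3) :
    Module.End.HasEigenvector (act (opA a)) (r i) (eigv r i) := by
  refine ⟨Module.End.mem_eigenspace_iff.2 (h.ext_ell fun j => ?_), fun h0 =>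
    h.ell_eigv_self_ne_zero i (by rw [h0, map_zero])⟩
  rw [h.eigenform_opA, map_smul, smul_eq_mul]
  obtain rfl | hij := eq_or_ne i j
  · rfl
  · rw [ell_eigv_of_ne hij, mul_zero, mul_zero]

theorem exists_eq_smul_eigv {μ : ℝ} {v : E3}
    (hv : Module.End.HasEigenvector (act (opA a)) μ v) : ∃ i, ∃ s : ℝ, v = s • eigv r i := by
  have heig (j : Fin 3) : r j * ell r j v = μ * ell r j v := by
    rw [← h.eigenform_opA, hv.apply_eq_smul, map_smul, smul_eq_mul]
  obtain ⟨i, hi⟩ : ∃ i, ell r i v ≠ 0 := by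
    by_contra! hz
    exact hv.2 (h.ext_ell fun i => by rw [hz i, map_zero])
  have hother (j : Fin 3) (hj : j ≠ i) : ell r j v = 0 := by
    by_contra hne
    exact hj (h.strictMono.injective
      ((mul_right_cancel₀ hne (heig j)).trans (mul_right_cancel₀ hi (heig i)).symm))
  exact ⟨i, _, (h.sum_smul_eigv v).symm.trans <| Finset.sum_eq_single i
    (fun j _ hj => by rw [hother j hj, zero_div, zero_smul]) (by simp)⟩

theorem linearIndependent_eigv {i j : Fin 3} (hij : i ≠ j) :
    LinearIndependent ℝ ![eigv r i, eigv r j] := by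
  refine LinearIndependent.pair_iff.2 fun s t hst => ⟨?_, ?_⟩
  · simpa [ell_eigv_of_ne hij.symm, h.ell_eigv_self_ne_zero] using congrArg (ell r i) hst
  · simpa [ell_eigv_of_ne hij, h.ell_eigv_self_ne_zero] using congrArg (ell r j) hst

theorem span_eigv_mem_eigenplanes {i j : Fin 3} (hij : i ≠ j) :
    Submodule.span ℝ {eigv r i, eigv r j} ∈ eigenplanes (opA a) :=
  ⟨r i, r j, eigv r i, eigv r j, h.hasEigenvector i, h.hasEigenvector j,
    h.linearIndependent_eigv hij, rfl⟩

theorem mem_span_eigv {k : Fin 3} {p : E3} (hp : ell r k p = 0) :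
    p ∈ Submodule.span ℝ {eigv r (k + 1), eigv r (k + 2)} := by
  rw [← h.sum_smul_eigv p]
  refine Submodule.sum_mem _ fun i _ => ?_
  obtain rfl | rfl | rfl : i = k ∨ i = k + 1 ∨ i = k + 2 :=
    (by decide : ∀ i k : Fin 3, i = k ∨ i = k + 1 ∨ i = k + 2) i k
  · simp [hp]
  · exact Submodule.smul_mem _ _ (Submodule.subset_span (by simp))
  · exact Submodule.smul_mem _ _ (Submodule.subset_span (by simp))

theorem eigenplanesCompl_eq : eigenplanesCompl (opA a) = {p | ∀ i, ell r i p ≠ 0} := by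
  ext p
  rw [eigenplanesCompl, Set.mem_compl_iff, Set.mem_ofPred_eq, ← not_exists, not_iff_not]
  simp only [Set.mem_iUnion, exists_prop]
  constructor
  · rintro ⟨H, ⟨μ, ν, v, w, hv, hw, hvw, rfl⟩, hp⟩
    obtain ⟨i, s, rfl⟩ := h.exists_eq_smul_eigv hv
    obtain ⟨j, t, rfl⟩ := h.exists_eq_smul_eigv hw
    obtain ⟨k, hki, hkj⟩ : ∃ k, i ≠ k ∧ j ≠ k :=
      (by decide : ∀ i j : Fin 3, ∃ k, i ≠ k ∧ j ≠ k) i j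
    obtain ⟨x, y, rfl⟩ := Submodule.mem_span_pair.1 hp
    exact ⟨k, by simp [ell_eigv_of_ne hki, ell_eigv_of_ne hkj]⟩
  · rintro ⟨k, hk⟩
    exact ⟨_, h.span_eigv_mem_eigenplanes (by simp), h.mem_span_eigv hk⟩

theorem connectedComponentIn_eq {p : E3} (hp : p ∈ eigenplanesCompl (opA a)) :
    connectedComponentIn (eigenplanesCompl (opA a)) p = {q | ∀ i, 0 < ell r i p * ell r i q} := by
  rw [h.eigenplanesCompl_eq] at hp ⊢
  exact connectedComponentIn_setOf_forall_ne_zero (fun i => (ell r i).toContinuousLinearMap) hp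

theorem isOrthant_orthant : IsOrthant (opA a) (orthant r) := by
  have hA : ptA ∈ eigenplanesCompl (opA a) := by
    simp [h.eigenplanesCompl_eq, ell_ptA]
  refine ⟨ptA, hA, ?_⟩
  simp [h.connectedComponentIn_eq hA, ell_ptA, orthant]

theorem eq_orthant {O : Set E3} (hO : IsOrthant (opA a) O) (hA : ptA ∈ sail O) :
    O = orthant r := by
  obtain ⟨p, hp, rfl⟩ := hO
  rw [h.connectedComponentIn_eq hp] at hA ⊢
  rw [h.eigenplanesCompl_eq] at hp
  have hpos (i : Fin 3) : 0 < ell r i p := by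
    have hclosed : IsClosed {q | 0 ≤ (ell r i p • ell r i) q} :=
      isClosed_le continuous_const (LinearMap.continuous_of_finiteDimensional _)
    have hconv := convex_halfSpace_ge (ell r i p • ell r i).isLinear 0
    have hnonneg : 0 ≤ ell r i p * ell r i ptA :=
      sail_subset hclosed hconv (fun q hq => (hq i).le) hA
    rw [ell_ptA, mul_one] at hnonneg
    exact hnonneg.lt_of_ne' (hp i)
  exact Set.ext fun q => forall_congr' fun i => mul_pos_iff_of_pos_left (hpos i)

end IsSpectrum

open Polynomial in
theorem charpoly_opA (a : ℤ) :
    (opA a : Matrix (Fin 3) (Fin 3) ℤ).charpoly =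
      X ^ 3 + C (2 * a + 3) * X ^ 2 + C (-a) * X + C (-1) := by
  rw [Matrix.charpoly, Matrix.det_fin_three, opA_coe]
  simp
  ring

open Polynomial in
theorem irreducible_charpoly_opA {a : ℤ} (ha : 0 ≤ a) :
    Irreducible ((opA a : Matrix (Fin 3) (Fin 3) ℤ).map (Int.cast : ℤ → ℚ)).charpoly := by
  let f : ℤ[X] := (opA a : Matrix (Fin 3) (Fin 3) ℤ).charpoly
  have hmonic : f.Monic := Matrix.charpoly_monic _
  have hdeg : (f.map (Int.castRingHom ℚ)).natDegree = 3 := by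
    rw [hmonic.natDegree_map, Matrix.charpoly_natDegree_eq_dim, Fintype.card_fin]
  rw [show ((opA a : Matrix (Fin 3) (Fin 3) ℤ).map (Int.cast : ℤ → ℚ)).charpoly =
    f.map (Int.castRingHom ℚ) from Matrix.charpoly_map _ (Int.castRingHom ℚ),
    (hmonic.map _).irreducible_iff_roots_eq_zero_of_degree_le_three (by omega) (by omega),
    Multiset.eq_zero_iff_forall_notMem]
  intro q hq
  have hroot : aeval q f = 0 := by
    simpa [aeval_def, eval_map] using (mem_roots'.1 hq).2
  obtain ⟨n, rfl⟩ := isInteger_of_is_root_of_monic hmonic hroot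
  rw [aeval_algebraMap_apply, map_eq_zero_iff _ (algebraMap ℤ ℚ).injective_int,
    coe_aeval_eq_eval] at hroot
  have heval : f.eval n = n ^ 3 + (2 * a + 3) * n ^ 2 + -a * n + -1 := by
    simp [f, charpoly_opA]
  have hn : n * (n ^ 2 + (2 * a + 3) * n - a) = 1 := by linear_combination heval.symm.trans hroot
  rcases Int.isUnit_iff.1 (IsUnit.of_mul_eq_one _ hn) with rfl | rfl
  · linarith
  · linarith

/-! ### Vertices, lengths, areas and distances -/

theorem cell_image_univ {Λ : Type*} {V : Type} [DecidableEq Λ] [AddCommGroup V] [Module ℝ V]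
    (P : Λ → V) (v : Fin 3 → Λ) :
    cell P (Finset.univ.image v) = tri (P (v 0)) (P (v 1)) (P (v 2)) := by
  rw [← cell_triple]
  congr 1
  ext x
  simp [Fin.exists_fin_succ, eq_comm]

theorem IsTransversal.iUnion_cells {T V : Type*} [AddCommGroup V] [Module ℝ V]
    {lab : T → Fin 3 → Label} {R : ℕ → Finset (Finset Label)} (hR : IsTransversal lab R)
    (htop : ∀ t, Finset.univ.image (lab t) ∈ R 2) (P : Label → V) :
    (⋃ k, ⋃ F ∈ cells P R k, F) = ⋃ t, cell P (Finset.univ.image (lab t)) := by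
  refine Set.Subset.antisymm (Set.iUnion_subset fun k => Set.iUnion₂_subset ?_)
    (Set.iUnion_subset fun t => ?_)
  · rintro _ ⟨σ, hσ, rfl⟩
    obtain ⟨t, s, -, rfl⟩ := hR.simplex k σ hσ
    exact Set.subset_iUnion_of_subset t
      (cell_mono P (Finset.image_subset_image (Finset.subset_univ s)))
  · exact Set.subset_iUnion_of_subset 2
      (Set.subset_biUnion_of_mem (u := fun F => F) ⟨_, htop t, rfl⟩)

theorem cells_vert_transversalTwo (a : ℤ) :
    cells (vert a) transversalTwo = schemeTwo ptA ptB ptC (ptD a) := by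
  funext k
  rw [cells_transversalTwo, vert_A, vert_B, vert_C, vert_D]

theorem cells_vert_transversalFour (a : ℤ) :
    cells (vert a) transversalFour = schemeFour ptA ptB ptC (ptD a) ptE := by
  funext k
  rw [cells_transversalFour, vert_A, vert_B, vert_C, vert_D, vert_E]

theorem image_cells_modelVert_transversalTwo :
    (fun k => (fun c => toTorus '' c) '' cells modelVert transversalTwo k) = modelTwo := by
  funext k
  rw [cells_transversalTwo, modelVert_A, modelVert_B, modelVert_C, modelVert_D, modelTwo]

theorem image_cells_modelVert_transversalFour :
    (fun k => (fun c => toTorus '' c) '' cells modelVert transversalFour k) = modelFour := by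
  funext k
  rw [cells_transversalFour, modelVert_A, modelVert_B, modelVert_C, modelVert_D, modelVert_E,
    modelFour]

theorem iUnion_cell_labTwo (a : ℤ) :
    ⋃ t, cell (vert a) (Finset.univ.image (labTwo t)) =
      tri ptA ptB (ptD a) ∪ tri ptB ptC (ptD a) := by
  simp only [cell_image_univ, ← vert_A a, ← vert_B a, ← vert_C a, ← vert_D a]
  ext x
  simp [Fin.exists_fin_two, labTwo]

theorem iUnion_cell_labFour (a : ℤ) :
    ⋃ t, cell (vert a) (Finset.univ.image (labFour t)) =
      tri ptA ptB (ptD a) ∪ tri ptB (ptD a) ptE ∪ tri ptB ptC ptE ∪ tri ptC ptE (ptD a) := by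
  simp only [cell_image_univ, ← vert_A a, ← vert_B a, ← vert_C a, ← vert_D a, ← vert_E a]
  ext x
  simp [Fin.exists_fin_succ, labFour, or_assoc]

theorem iUnion_schemeTwo (a : ℤ) :
    (⋃ k, ⋃ F ∈ schemeTwo ptA ptB ptC (ptD a) k, F) =
      tri ptA ptB (ptD a) ∪ tri ptB ptC (ptD a) := by
  rw [← cells_vert_transversalTwo, isTransversal_two.iUnion_cells (by decide), iUnion_cell_labTwo]

theorem iUnion_schemeFour (a : ℤ) :
    (⋃ k, ⋃ F ∈ schemeFour ptA ptB ptC (ptD a) ptE k, F) =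
      tri ptA ptB (ptD a) ∪ tri ptB (ptD a) ptE ∪ tri ptB ptC ptE ∪ tri ptC ptE (ptD a) := by
  rw [← cells_vert_transversalFour, isTransversal_four.iUnion_cells (by decide),
    iUnion_cell_labFour]

theorem range_vert_labTwo (a : ℤ) :
    Set.range (fun x : Fin 2 × Fin 3 => vert a (labTwo x.1 x.2)) = {ptA, ptB, ptC, ptD a} := by
  have hlabels : Finset.univ.image (fun x : Fin 2 × Fin 3 => labTwo x.1 x.2) =
      {(false, 0, 0), (false, 0, 1), (false, 1, 1), (false, 1, 0)} := by decide
  have hvert := congrArg (fun s : Finset Label => vert a '' (s : Set Label)) hlabels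
  rw [← vert_A a, ← vert_B a, ← vert_C a, ← vert_D a]
  simpa [Set.image_insert_eq, ← Set.range_comp, Function.comp_def] using hvert

theorem range_vert_labFour (a : ℤ) :
    Set.range (fun x : Fin 4 × Fin 3 => vert a (labFour x.1 x.2)) =
      {ptA, ptB, ptC, ptD a, ptE} := by
  have hlabels : Finset.univ.image (fun x : Fin 4 × Fin 3 => labFour x.1 x.2) =
      {(false, 0, 0), (false, 0, 1), (false, 1, 1), (false, 1, 0), (true, 0, 0)} := by decide
  have hvert := congrArg (fun s : Finset Label => vert a '' (s : Set Label)) hlabels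
  rw [← vert_A a, ← vert_B a, ← vert_C a, ← vert_D a, ← vert_E a]
  simpa [Set.image_insert_eq, ← Set.range_comp, Function.comp_def] using hvert

theorem act_image_segment (g : SL3Z) (p q : E3) :
    act g '' segment ℝ p q = segment ℝ (act g p) (act g q) :=
  image_segment ℝ (act g).toAffineMap p q

theorem pt_sub_pt (x y z x' y' z' : ℤ) :
    pt x y z - pt x' y' z' = pt (x - x') (y - y') (z - z') := by
  apply ext_three <;> simp

theorem integerLength_pt_eq_one {x y z x' y' z' : ℤ} (c : Fin 3 → ℤ)
    (hc : c 0 * (x' - x) + c 1 * (y' - y) + c 2 * (z' - z) = 1) :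
    integerLength (pt x y z) (pt x' y' z') = 1 := by
  rw [integerLength_eq (s := 1) (pt_mem x y z) (pt_mem (x' - x) (y' - y) (z' - z)) c
    (by rw [intForm_pt]; exact_mod_cast hc) (by rw [pt_sub_pt, one_smul]) one_ne_zero, abs_one]

theorem integerLength_AB : integerLength ptA ptB = 1 := integerLength_pt_eq_one ![0, 1, 0] (by simp)

theorem integerLength_BC : integerLength ptB ptC = 1 := integerLength_pt_eq_one ![0, 0, 1] (by simp)

theorem integerLength_CD (a : ℤ) : integerLength ptC (ptD a) = 1 :=
  integerLength_pt_eq_one ![0, 1, -2] (by simp)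

theorem integerLength_DA (a : ℤ) : integerLength (ptD a) ptA = 1 :=
  integerLength_pt_eq_one ![0, 0, 1] (by simp)

theorem integerLength_BD (a : ℤ) : integerLength ptB (ptD a) = 1 :=
  integerLength_pt_eq_one ![0, 0, -1] (by simp)

theorem integerLength_BE : integerLength ptB ptE = 1 := integerLength_pt_eq_one ![1, 0, 0] (by simp)

theorem integerLength_CE : integerLength ptC ptE = 1 :=
  integerLength_pt_eq_one ![0, 0, -1] (by simp)

theorem integerLength_DE (a : ℤ) : integerLength (ptD a) ptE = 1 :=
  integerLength_pt_eq_one ![0, 0, 1] (by simp)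

theorem integerArea_pt_eq_one {x y z x' y' z' x'' y'' z'' : ℤ} (c₁ c₂ : Fin 3 → ℤ)
    (h₁ : c₁ 0 * (x' - x) + c₁ 1 * (y' - y) + c₁ 2 * (z' - z) = 1)
    (h₁₂ : c₁ 0 * (x'' - x) + c₁ 1 * (y'' - y) + c₁ 2 * (z'' - z) = 0)
    (h₂₁ : c₂ 0 * (x' - x) + c₂ 1 * (y' - y) + c₂ 2 * (z' - z) = 0)
    (h₂ : c₂ 0 * (x'' - x) + c₂ 1 * (y'' - y) + c₂ 2 * (z'' - z) = 1) :
    integerArea (pt x y z) (pt x' y' z') (pt x'' y'' z'') = 1 := by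
  have hbasis : IsIntegerBasis (pt (x' - x) (y' - y) (z' - z)) (pt (x'' - x) (y'' - y) (z'' - z))
      c₁ c₂ := by
    constructor <;> first | exact pt_mem _ _ _ | (rw [intForm_pt]; exact_mod_cast ‹_›)
  rw [hbasis.integerArea_eq (s₁ := 1) (s₂ := 0) (t₁ := 0) (t₂ := 1) (pt_mem x y z)
    (by rw [pt_sub_pt]; module) (by rw [pt_sub_pt]; module) (by norm_num)]
  norm_num

theorem integerArea_ABD (a : ℤ) : integerArea ptA ptB (ptD a) = 1 :=
  integerArea_pt_eq_one ![0, 1, 1] ![0, 0, -1] (by simp) (by simp) (by simp) (by simp)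

theorem integerArea_BDE (a : ℤ) : integerArea ptB (ptD a) ptE = 1 :=
  integerArea_pt_eq_one ![0, 0, -1] ![0, 1, 0] (by simp) (by simp) (by simp) (by simp)

theorem integerArea_BCE : integerArea ptB ptC ptE = 1 :=
  integerArea_pt_eq_one ![0, 0, 1] ![0, 1, -3] (by simp) (by simp) (by simp) (by simp)

theorem integerArea_CED (a : ℤ) : integerArea ptC ptE (ptD a) = 1 :=
  integerArea_pt_eq_one ![0, -2, 3] ![0, 1, -2] (by simp) (by simp) (by simp) (by simp)

theorem integerArea_BCD : integerArea ptB ptC (ptD 0) = 3 := by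
  have hB : ptB ∈ integerPoints := pt_mem 2 1 1
  have hbasis : IsIntegerBasis (pt 1 1 0) (pt 2 0 1) ![0, 1, 0] ![0, 0, 1] := by
    constructor <;> first | exact pt_mem _ _ _ | simp [intForm_pt]
  rw [hbasis.integerArea_eq (s₁ := 3) (s₂ := 1) (t₁ := 0) (t₂ := -1) hB
    (by apply ext_three <;> simp [ptB, ptC] <;> norm_num)
    (by apply ext_three <;> simp [ptB, ptD]) (by norm_num)]
  norm_num

theorem integerDistance_plane {p : Fin 3 → E3} (hp : LinearIndependent ℝ p) {c : Fin 3 → ℤ} {d : ℤ}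
    (hd : 0 < d) (hc : ∀ k, intForm c (p k) = d) {u : E3} (hu : u ∈ integerPoints)
    (hcu : intForm c u = 1) : integerDistance (plane (p 0) (p 1) (p 2)) 0 = d := by
  have hd' : (0 : ℝ) < d := Int.cast_pos.2 hd
  rw [integerDistance_eq (coe_plane hp hd'.ne' hc) hu hcu, map_zero, zero_sub, abs_neg,
    abs_of_pos hd']

theorem integerDistance_plane_labFour {a : ℤ} (ha : 0 ≤ a) (t : Fin 4) :
    integerDistance
      (plane (vert a (labFour t 0)) (vert a (labFour t 1)) (vert a (labFour t 2))) 0 =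
        heightFour a t :=
  integerDistance_plane (linearIndependent_labFour ha t) (heightFour_pos (by omega) t)
    (intForm_covFour_vert a t) (pt_mem (-1) 0 0) (by fin_cases t <;> simp [intForm_pt, covFour])

theorem integerDistance_ABD {a : ℤ} (ha : 0 ≤ a) :
    integerDistance (plane ptA ptB (ptD a)) 0 = a + 2 := by
  simpa [labFour, heightFour, vert_A, vert_B, vert_D] using integerDistance_plane_labFour ha 0

theorem integerDistance_BDE {a : ℤ} (ha : 0 ≤ a) :
    integerDistance (plane ptB (ptD a) ptE) 0 = a + 1 := by
  simpa [labFour, heightFour, vert_B, vert_D, vert_E] using integerDistance_plane_labFour ha 1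

theorem integerDistance_BCE : integerDistance (plane ptB ptC ptE) 0 = 1 := by
  simpa [labFour, heightFour, vert_B, vert_C, vert_E] using
    integerDistance_plane_labFour le_rfl 2

theorem integerDistance_CED {a : ℤ} (ha : 0 ≤ a) :
    integerDistance (plane ptC ptE (ptD a)) 0 = 1 := by
  simpa [labFour, heightFour, vert_C, vert_E, vert_D] using integerDistance_plane_labFour ha 3

theorem integerDistance_BCD : integerDistance (plane ptB ptC (ptD 0)) 0 = 1 := by
  simpa [labTwo, heightTwo, heightFour, vert_B, vert_C, vert_D] using
    integerDistance_plane (linearIndependent_labTwo 1) (heightFour_pos (by decide) 2)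
      (intForm_covTwo_vert 1) (pt_mem (-1) 0 0) (by simp [intForm_pt, covTwo, covFour])

namespace IsFundamentalData

variable {T : Type*} {a : ℤ} {r : Fin 3 → ℝ} {lab : T → Fin 3 → Label} {f : T → Fin 3 → ℤ}
  {d : T → ℤ} (hF : IsFundamentalData a r lab f d)

include hF

theorem setOf_isFace_zero [Finite T] [Nonempty T] (h : IsSpectrum a r) :
    {p | p ∈ ⋃ t, cell (vert a) (Finset.univ.image (lab t)) ∧ IsFace (orthant r) 0 {p}} =
      Set.range (fun x : T × Fin 3 => vert a (lab x.1 x.2)) := by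
  have hC := hF.isConvexTriangulation h
  have hlab (t : T) : shiftVtx lab (t, 0) = lab t := funext fun k => shift_zero (lab t k)
  ext p
  constructor
  · rintro ⟨hp, -, hsub, hexp, -⟩
    obtain ⟨t, ht⟩ := Set.mem_iUnion.1 hp
    obtain ⟨τ, k, rfl⟩ := hC.mem_extremePoints_iff.1
      ⟨isExtreme_singleton.1 hexp.isExtreme, hsub rfl⟩
    rw [← hlab t] at ht
    obtain ⟨l, -, hl⟩ := Finset.mem_image.1 (hC.mem_of_vertex_mem_cell ht)
    exact ⟨(t, l), congrArg (vert a) ((congrFun (hlab t) l).symm.trans hl)⟩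
  · rintro ⟨⟨t, k⟩, rfl⟩
    refine ⟨Set.mem_iUnion.2 ⟨t, subset_convexHull ℝ _ ⟨lab t k, by simp, rfl⟩⟩, ?_⟩
    have hface := hF.isFace_cell h (t := t) (q := 0) (s := {k}) (k := 0) rfl
    simpa [shift_zero, cell_singleton] using hface

end IsFundamentalData

namespace IsSpectrum

variable {a : ℤ} {r : Fin 3 → ℝ} (h : IsSpectrum a r)

include h

theorem eq_zero_of_zpow_mul_zpow_eq_one {i j : ℤ} (hij : opX a ^ i * opY a ^ j = 1) :
    i = 0 ∧ j = 0 := by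
  have hfix : act (latOp a (i, j)) ptA = ptA := by rw [latOp, hij, act_one_apply]
  exact Prod.mk_eq_zero.1 (h.eq_zero_of_act_latOp_eq (ptA_mem_orthant r) hfix)

theorem periodGroup_orthant :
    periodGroup (opA a) (orthant r) = Subgroup.closure {opX a, opY a} := by
  rcases h.nonneg.eq_or_lt with rfl | ha
  · exact h.isFundamentalData_two.periodGroup_eq_closure h isTransversal_two
  · exact (h.isFundamentalData_four ha).periodGroup_eq_closure h isTransversal_four

theorem ptA_mem_sail : ptA ∈ sail (orthant r) := by
  rw [← vert_A a]
  rcases h.nonneg.eq_or_lt with rfl | ha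
  · exact h.isFundamentalData_two.vert_mem_sail h 0 0
  · exact (h.isFundamentalData_four ha).vert_mem_sail h 0 0

theorem ptE_mem_sail : ptE ∈ sail (orthant r) := by
  rcases h.nonneg.eq_or_lt with rfl | ha
  · have hcentroid := h.isFundamentalData_two.sum_smul_mem_sail h (1, 0)
      (b := fun _ => 1 / 3) ⟨fun _ => by norm_num, by simp⟩
    simp only [shiftVtx, shift_zero, ← Finset.smul_sum, Fin.sum_univ_three] at hcentroid
    rw [ptE_eq_centroid, ← vert_B 0, ← vert_C 0, ← vert_D 0]
    exact hcentroid
  · rw [← vert_E a]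
    exact (h.isFundamentalData_four ha).vert_mem_sail h 1 2

omit h in
theorem homeomorphicDecompositions_two (h : IsSpectrum 0 r) :
    HomeomorphicDecompositions (sailTriangulation (opA 0) (orthant r)) modelTwo :=
  image_cells_modelVert_transversalTwo ▸
    h.isFundamentalData_two.homeomorphicDecompositions h isTransversal_two isSquareTiling_two

theorem homeomorphicDecompositions_four (ha : 0 < a) :
    HomeomorphicDecompositions (sailTriangulation (opA a) (orthant r)) modelFour :=
  image_cells_modelVert_transversalFour ▸
    (h.isFundamentalData_four ha).homeomorphicDecompositions h isTransversal_four
      (isSquareTiling_four a)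

omit h in
theorem isFundamentalFamily_two (h : IsSpectrum 0 r) :
    IsFundamentalFamily (opA 0) (orthant r) (schemeTwo ptA ptB ptC (ptD 0)) :=
  cells_vert_transversalTwo 0 ▸ h.isFundamentalData_two.isFundamentalFamily h isTransversal_two

theorem isFundamentalFamily_four (ha : 0 < a) :
    IsFundamentalFamily (opA a) (orthant r) (schemeFour ptA ptB ptC (ptD a) ptE) :=
  cells_vert_transversalFour a ▸
    (h.isFundamentalData_four ha).isFundamentalFamily h isTransversal_four

omit h in
theorem setOf_isFace_zero_two (h : IsSpectrum 0 r) :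
    {p | p ∈ tri ptA ptB (ptD 0) ∪ tri ptB ptC (ptD 0) ∧ IsFace (orthant r) 0 {p}} =
      {ptA, ptB, ptC, ptD 0} := by
  rw [← iUnion_cell_labTwo, h.isFundamentalData_two.setOf_isFace_zero h, range_vert_labTwo]

theorem setOf_isFace_zero_four (ha : 0 < a) :
    {p | p ∈ tri ptA ptB (ptD a) ∪ tri ptB (ptD a) ptE ∪ tri ptB ptC ptE ∪ tri ptC ptE (ptD a) ∧
        IsFace (orthant r) 0 {p}} =
      {ptA, ptB, ptC, ptD a, ptE} := by
  rw [← iUnion_cell_labFour, (h.isFundamentalData_four ha).setOf_isFace_zero h, range_vert_labFour]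

end IsSpectrum

end TorusSail

theorem proposition3p2 (a : ℤ) (ha : 0 ≤ a) :
    -- the operator defines a continued fraction of a cubic irrationality
    Irreducible ((opA a : Matrix (Fin 3) (Fin 3) ℤ).map (Int.cast : ℤ → ℚ)).charpoly ∧
    (∃ l : Fin 3 → ℝ, StrictMono l ∧
      ∀ i, Module.End.HasEigenvalue (act (opA a)) (l i)) ∧
    -- there is exactly one sail containing the point `(0, 0, 1)`
    (∃! O : Set E3, IsOrthant (opA a) O ∧ ptA ∈ sail O) ∧
    ∀ O : Set E3, IsOrthant (opA a) O → ptA ∈ sail O →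
      -- the period group is free abelian with the basis `X`, `Y`
      periodGroup (opA a) O = Subgroup.closure {opX a, opY a} ∧
      opX a * opY a = opY a * opX a ∧
      (∀ i j : ℤ, opX a ^ i * opY a ^ j = 1 → i = 0 ∧ j = 0) ∧
      -- the gluing of the sides
      act (opX a) ptA = ptD a ∧ act (opX a) ptB = ptC ∧
      act (opX a) '' segment ℝ ptA ptB = segment ℝ (ptD a) ptC ∧
      act (opY a) ptA = ptB ∧ act (opY a) (ptD a) = ptC ∧
      act (opY a) '' segment ℝ ptA (ptD a) = segment ℝ ptB ptC ∧
      -- the point `E` belongs to the sail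
      ptE ∈ sail O ∧
      -- the case `a = 0`
      (a = 0 →
        HomeomorphicDecompositions (sailTriangulation (opA a) O) modelTwo ∧
        IsFundamentalFamily (opA a) O (schemeTwo ptA ptB ptC (ptD a)) ∧
        (⋃ k, ⋃ F ∈ schemeTwo ptA ptB ptC (ptD a) k, F) =
          tri ptA ptB (ptD a) ∪ tri ptB ptC (ptD a) ∧
        {p | p ∈ tri ptA ptB (ptD a) ∪ tri ptB ptC (ptD a) ∧ IsFace O 0 {p}} =
          {ptA, ptB, ptC, ptD a} ∧
        (3 : ℝ) • ptE = ptB + ptC + ptD a ∧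
        integerLength ptA ptB = 1 ∧ integerLength ptB ptC = 1 ∧
        integerLength ptC (ptD a) = 1 ∧ integerLength (ptD a) ptA = 1 ∧
        integerArea ptA ptB (ptD a) = 1 ∧ integerArea ptB ptC (ptD a) = 3 ∧
        integerDistance (plane ptA ptB (ptD a)) 0 = 2 ∧
        integerDistance (plane ptB ptC (ptD a)) 0 = 1) ∧
      -- the case `a > 0`
      (0 < a →
        HomeomorphicDecompositions (sailTriangulation (opA a) O) modelFour ∧
        IsFundamentalFamily (opA a) O (schemeFour ptA ptB ptC (ptD a) ptE) ∧
        (⋃ k, ⋃ F ∈ schemeFour ptA ptB ptC (ptD a) ptE k, F) =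
          tri ptA ptB (ptD a) ∪ tri ptB (ptD a) ptE ∪ tri ptB ptC ptE ∪ tri ptC ptE (ptD a) ∧
        {p | p ∈ tri ptA ptB (ptD a) ∪ tri ptB (ptD a) ptE ∪ tri ptB ptC ptE ∪
            tri ptC ptE (ptD a) ∧ IsFace O 0 {p}} =
          {ptA, ptB, ptC, ptD a, ptE} ∧
        integerLength ptA ptB = 1 ∧ integerLength ptB ptC = 1 ∧
        integerLength ptC (ptD a) = 1 ∧ integerLength (ptD a) ptA = 1 ∧
        integerLength ptB (ptD a) = 1 ∧ integerLength ptB ptE = 1 ∧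
        integerLength ptC ptE = 1 ∧ integerLength (ptD a) ptE = 1 ∧
        integerArea ptA ptB (ptD a) = 1 ∧ integerArea ptB (ptD a) ptE = 1 ∧
        integerArea ptB ptC ptE = 1 ∧ integerArea ptC ptE (ptD a) = 1 ∧
        integerDistance (plane ptA ptB (ptD a)) 0 = a + 2 ∧
        integerDistance (plane ptB (ptD a) ptE) 0 = a + 1 ∧
        integerDistance (plane ptB ptC ptE) 0 = 1 ∧
        integerDistance (plane ptC ptE (ptD a)) 0 = 1) := by
  obtain ⟨r, h⟩ := exists_isSpectrum ha
  refine ⟨irreducible_charpoly_opA ha,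
    ⟨r, h.strictMono, fun i => Module.End.hasEigenvalue_of_hasEigenvector (h.hasEigenvector i)⟩,
    ⟨orthant r, ⟨h.isOrthant_orthant, h.ptA_mem_sail⟩, fun O hO => h.eq_orthant hO.1 hO.2⟩,
    fun O hO hA => ?_⟩
  obtain rfl := h.eq_orthant hO hA
  refine ⟨h.periodGroup_orthant, (commute_opX_opY a).eq,
    fun i j => h.eq_zero_of_zpow_mul_zpow_eq_one, act_opX_ptA a, act_opX_ptB a,
    by rw [act_image_segment, act_opX_ptA, act_opX_ptB], act_opY_ptA a, act_opY_ptD a,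
    by rw [act_image_segment, act_opY_ptA, act_opY_ptD], h.ptE_mem_sail, ?_, fun h0 => ?_⟩
  · rintro rfl
    exact ⟨h.homeomorphicDecompositions_two, h.isFundamentalFamily_two, iUnion_schemeTwo 0,
      h.setOf_isFace_zero_two, by simp [ptE_eq_centroid], integerLength_AB, integerLength_BC,
      integerLength_CD 0, integerLength_DA 0, integerArea_ABD 0, integerArea_BCD,
      by simpa using integerDistance_ABD le_rfl, integerDistance_BCD⟩
  · exact ⟨h.homeomorphicDecompositions_four h0, h.isFundamentalFamily_four h0,
      iUnion_schemeFour a, h.setOf_isFace_zero_four h0, integerLength_AB, integerLength_BC,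
      integerLength_CD a, integerLength_DA a, integerLength_BD a, integerLength_BE,
      integerLength_CE, integerLength_DE a, integerArea_ABD a, integerArea_BDE a,
      integerArea_BCE, integerArea_CED a, integerDistance_ABD ha, integerDistance_BDE ha,
      integerDistance_BCE, integerDistance_CED ha⟩
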